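/- For $\sigma\in L_2(0,\pi)$ (complex-valued) and $H\in\mathbb C$ let $L(\sigma,H)$ be the boundary value problem $$-(y^{[1]})'-\sigma y^{[1]}-\sigma^2y=\lambda y\ \text{ a.e. on }(0,\pi),\qquad y^{[1]}(0)=0,\quad y^{[1]}(\pi)+Hy(\pi)=0,$$ where $y^{[1]}:=y'-\sigma y$ and $y$, $y^{[1]}$ are absolutely continuous on $[0,\pi]$. (This is $-y''+\sigma'y=\lambda y$ with the singular potential $\sigma'\in W_2^{-1}(0,\pi)$.) Let $\varphi(x,\lambda)$ be the solution of the equation with $\varphi(0,\lambda)=1$, $\varphi^{[1]}(0,\lambda)=0$. The eigenvalues are the zeros of $\Delta(\lambda)=\varphi^{[1]}(\pi,\lambda)+H\varphi(\pi,\lambda)$; it is assumed that for all the problems considered they are simple (simple zeros of $\Delta$), which is automatic if $\sigma$ and $H$ are real. They are numbered as $\{\lambda_n\}_{n\ge0}$ with $|\lambda_n|\le|\lambda_{n+1}|$; put $\rho_n=\sqrt{\lambda_n}$ with $\arg\rho_n\in[-\frac\pi2,\frac\pi2)$ and $\alpha_n=\bigl(\int_0^\pi\varphi^2(x,\lambda_n)\,dx\bigr)^{-1}$.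 Let $\sigma,\sigma^N\in L_2(0,\pi)$ and $H,H^N\in\mathbb C$ ($N\in\mathbb N$) be such that $\sigma^N\to\sigma$ in $L_2(0,\pi)$ and $H^N\to H$ as $N\to\infty$. Let $\{\lambda_n,\alpha_n\}$ and $\{\lambda^N_n,\alpha^N_n\}$ be the spectral data of $L(\sigma,H)$ and of $L(\sigma^N,H^N)$, numbered as above. Then there are permutations $p_N$ of $\{0,1,2,\dots\}$ with $|\lambda_{p_N(n)}|=|\lambda_n|$ for all $N,n$, and signs $s^N_n\in\{1,-1\}$ with $s^N_n=1$ unless $\lambda_n\in(-\infty,0)$, such that $$\lim_{N\to\infty}\sum_{n=0}^\infty\Bigl(\bigl|s^N_n\rho^N_{p_N(n)}-\rho_n\bigr|+\bigl|\alpha^N_{p_N(n)}-\alpha_n\bigr|\Bigr)^2=0 .$$ If $\sigma,\sigma^N,H,H^N$ are all real, then this holds with all $s^N_n=1$. In particular, if $\sigma,\sigma^N,H,H^N$ are real (or no $\lambda_n$ is a negative real number) and the numbers $|\lambda_n|$ are pairwise distinct, then $$\lim_{N\to\infty}\sum_{n=0}^\infty\bigl(|\rho^N_n-\rho_n|+|\alpha^N_n-\alpha_n|\bigr)^2=0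 .$$ -/

import Mathlib

open Filter Topology MeasureTheory

/-- The pair `(y, y1)` is a solution on `[0, π]` of the Sturm-Liouville equation `ℓ y = μ y` with the
singular potential `q = σ'`, where `ℓ y = -(y^{[1]})' - σ y^{[1]} - σ² y`, and
`y1 = y^{[1]} = y' - σ y` is the quasi-derivative of `y`. Both functions are absolutely continuous
on `[0, π]` and the equations hold almost everywhere. -/
structure IsSLSolution (σ : ℝ → ℂ) (μ : ℂ) (y y1 : ℝ → ℂ) : Prop where
  ac : AbsolutelyContinuousOnInterval y 0 Real.pi
  ac_quasi : AbsolutelyContinuousOnInterval y1 0 Real.pi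
  quasi_deriv : ∀ᵐ x ∂(volume.restrict (Set.Ioo 0 Real.pi)),
    HasDerivAt y (y1 x + σ x * y x) x
  equation : ∀ᵐ x ∂(volume.restrict (Set.Ioo 0 Real.pi)),
    HasDerivAt y1 (-σ x * y1 x - σ x ^ 2 * y x - μ * y x) x

/-- `μ` is an eigenvalue of the boundary value problem `L(σ, H)`:
`ℓ y = μ y`, `y^{[1]}(0) = 0`, `y^{[1]}(π) + H y(π) = 0`. -/
def IsSLEigenvalue (σ : ℝ → ℂ) (H μ : ℂ) : Prop :=
  ∃ y y1 : ℝ → ℂ, IsSLSolution σ μ y y1 ∧ y1 0 = 0 ∧ y1 Real.pi + H * y Real.pi = 0 ∧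
    ∃ x ∈ Set.Icc 0 Real.pi, y x ≠ 0

/-- The solution `(φ(·, μ), φ^{[1]}(·, μ))` of `ℓ y = μ y` with `φ(0, μ) = 1`, `φ^{[1]}(0, μ) = 0`.
(For `σ ∈ L₂(0, π)` it exists and is unique on `[0, π]`.) -/
noncomputable def slPhiPair (σ : ℝ → ℂ) (μ : ℂ) : (ℝ → ℂ) × (ℝ → ℂ) :=
  Classical.epsilon fun u => IsSLSolution σ μ u.1 u.2 ∧ u.1 0 = 1 ∧ u.2 0 = 0

/-- `φ(x, μ)`. -/
noncomputable def slPhi (σ : ℝ → ℂ) (x : ℝ) (μ : ℂ) : ℂ := (slPhiPair σ μ).1 x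

/-- `φ^{[1]}(x, μ)`. -/
noncomputable def slPhiQuasi (σ : ℝ → ℂ) (x : ℝ) (μ : ℂ) : ℂ := (slPhiPair σ μ).2 x

/-- The characteristic function `Δ(μ) = φ^{[1]}(π, μ) + H φ(π, μ)` of `L(σ, H)`. -/
noncomputable def slCharFun (σ : ℝ → ℂ) (H μ : ℂ) : ℂ :=
  slPhiQuasi σ Real.pi μ + H * slPhi σ Real.pi μ

/-- `lam`, `rho`, `alpha` are the eigenvalues, their square roots and the weight numbers of `L(σ, H)`,
all of whose eigenvalues are simple: `lam` lists all the eigenvalues without repetition, with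
nondecreasing modulus, and each of them is a simple zero of the characteristic function;
`rho n` is the square root of `lam n` with argument in `[-π/2, π/2)`. -/
structure IsSLSpectralData (σ : ℝ → ℂ) (H : ℂ) (lam rho alpha : ℕ → ℂ) : Prop where
  range_eq : Set.range lam = {μ : ℂ | IsSLEigenvalue σ H μ}
  injective : Function.Injective lam
  simple : ∀ n, analyticOrderAt (slCharFun σ H) (lam n) = 1
  monotone_norm : Monotone fun n => ‖lam n‖
  rho_sq : ∀ n, rho n ^ 2 = lam n
  rho_arg : ∀ n, (rho n).arg ∈ Set.Ico (-(Real.pi / 2)) (Real.pi / 2)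
  alpha_eq : ∀ n, alpha n = (∫ x in (0 : ℝ)..Real.pi, slPhi σ x (lam n) ^ 2)⁻¹

/-- `L(σ, H)` is self-adjoint: `σ` is real-valued (a.e. on `(0, π)`) and `H` is real. -/
def IsSLReal (σ : ℝ → ℂ) (H : ℂ) : Prop :=
  (∀ᵐ x ∂(volume.restrict (Set.Ioo 0 Real.pi)), (σ x).im = 0) ∧ H.im = 0

/-! Write `λ = ρ²`. The waves `φ ± (i/ρ) φ^{[1]}` diagonalise the leading part of the first order
system: they behave like `exp(∓iρx)`, the potential `σ` only couples each wave to its companion, and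
`σ²` enters with a factor `1/ρ`. Grönwall estimates for them therefore need `σ` only in `L₂` and are
uniform over a neighbourhood of the limit potential.

The eigenvalues are the zeros of the entire function `Δ`, and Lagrange's identity gives, whenever
`Δ(μ) = 0`, the relation `(l - μ) ∫ φ(x,l) φ(x,μ) dx = -φ(π,μ) Δ(l)` (`integral_phi_mul_phi`). It
replaces the counting of zeros by contour integrals: where the integral does not vanish, two zeros
must coincide, and the existence of a zero comes from the minimum modulus principle
(`exists_zero_mem_ball`). For large `ρ`, `Δ(ρ²)` is close to `-ρ sin πρ`, so that there is exactly
one eigenvalue in the square of each small disc around a large integer, uniformly in the problem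
(`tailControl_locally_uniform`). The finitely many other eigenvalues converge because they are
simple. `exists_matching` collects this; ordering by modulus then forces the permutation to preserve
`|λ_n|`.

Square summability comes from Bessel's inequality. Near `ρ = k`, with the factor `exp(∓ikx)`
removed, the difference of the waves of two problems is governed by the Fourier integrals of `σ^N -
σ` over `(0, x)` with frequencies `±2k`. Their squares, summed over `k`, are bounded by a multiple
of `‖σ^N - σ‖²` at every `x` (`slPhi_sub_near`). Put into the identity above, this controls the
differences of the `ρ_k` and of the weight numbers, and the tails are bounded by a multiple of `‖σ^N
- σ‖² + |H^N - H|²` (`sum_spectral_gap_le`).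

Convergence of `λ` gives convergence of `ρ` unless the chosen branch of the root jumps, which can
happen only at a negative limit eigenvalue; the signs repair this. In the self-adjoint case the
nearby eigenvalues are real as well, and no jump occurs. -/

/-! ### Calculus of primitives of integrable functions -/

/-- `f` is a primitive of the integrable function `f'` on `[0, π]`. -/
def IsPrim (f f' : ℝ → ℂ) : Prop :=
  IntervalIntegrable f' volume 0 Real.pi ∧
    ∀ x ∈ Set.Icc 0 Real.pi, f x = f 0 + ∫ t in (0 : ℝ)..x, f' t

/-- The real-valued statement is applied to the real and imaginary parts. -/
theorem absolutelyContinuousOnInterval_intervalIntegral_complex {f : ℝ → ℂ} {a b : ℝ}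
    (h : IntervalIntegrable f volume a b) :
    AbsolutelyContinuousOnInterval (fun x => ∫ t in a..x, f t) a b := by
  have hre : IntervalIntegrable (fun t => (f t).re) volume a b :=
    ⟨h.1.re, h.2.re⟩
  have him : IntervalIntegrable (fun t => (f t).im) volume a b :=
    ⟨h.1.im, h.2.im⟩
  have h1 := hre.absolutelyContinuousOnInterval_intervalIntegral (c := a) (by simp)
  have h2 := him.absolutelyContinuousOnInterval_intervalIntegral (c := a) (by simp)
  have hc : ∀ c : ℂ, AbsolutelyContinuousOnInterval (fun _ : ℝ => c) a b := fun c =>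
    (LipschitzWith.const (α := ℝ) c).lipschitzOnWith.absolutelyContinuousOnInterval
  have h3 := (h1.smul (hc 1)).add (h2.smul (hc Complex.I))
  have hint : ∀ x ∈ Set.uIcc a b, IntervalIntegrable f volume a x := fun x hx =>
    h.mono_set (Set.uIcc_subset_uIcc_left hx)
  have key : ∀ x ∈ Set.uIcc a b, (∫ t in a..x, f t) =
      (∫ t in a..x, (f t).re) • (1 : ℂ) + (∫ t in a..x, (f t).im) • Complex.I := by
    intro x hx
    have hre' : (∫ t in a..x, f t).re = ∫ t in a..x, (f t).re := by
      simpa using (Complex.reCLM.intervalIntegral_comp_comm (hint x hx)).symm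
    have him' : (∫ t in a..x, f t).im = ∫ t in a..x, (f t).im := by
      simpa using (Complex.imCLM.intervalIntegral_comp_comm (hint x hx)).symm
    apply Complex.ext <;> simp [hre', him']
  unfold AbsolutelyContinuousOnInterval at h3 ⊢
  refine h3.congr' ?_
  filter_upwards [mem_inf_of_right (mem_principal_self _)] with E hE
  refine Finset.sum_congr rfl fun i hi => ?_
  rw [key _ (hE.1 i hi).1, key _ (hE.1 i hi).2]
  rfl

theorem ae_Ioo_iff {p : ℝ → Prop} {a b : ℝ} :
    (∀ᵐ x ∂(volume.restrict (Set.Ioo a b)), p x) ↔ ∀ᵐ x, x ∈ Set.Icc a b → p x := by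
  rw [Measure.restrict_congr_set Ioo_ae_eq_Icc, ae_restrict_iff' measurableSet_Icc]

namespace IsPrim

variable {f f' g g' : ℝ → ℂ}

theorem integrable_mono (hf : IsPrim f f') {x : ℝ} (hx : x ∈ Set.Icc 0 Real.pi) :
    IntervalIntegrable f' volume 0 x :=
  hf.1.mono_set (Set.uIcc_subset_uIcc_left (by rwa [Set.uIcc_of_le Real.pi_pos.le]))

theorem continuousOn (hf : IsPrim f f') : ContinuousOn f (Set.Icc 0 Real.pi) := by
  have h := intervalIntegral.continuousOn_primitive_interval' hf.1 (a := 0) (by simp)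
  rw [Set.uIcc_of_le Real.pi_pos.le] at h
  exact (continuousOn_const.add h).congr hf.2

theorem ac (hf : IsPrim f f') : AbsolutelyContinuousOnInterval f 0 Real.pi := by
  have h1 := absolutelyContinuousOnInterval_intervalIntegral_complex hf.1
  have hc : AbsolutelyContinuousOnInterval (fun _ : ℝ => f 0) 0 Real.pi :=
    (LipschitzWith.const (α := ℝ) (f 0)).lipschitzOnWith.absolutelyContinuousOnInterval
  have h3 := hc.add h1
  unfold AbsolutelyContinuousOnInterval at h3 ⊢
  refine h3.congr' ?_
  filter_upwards [mem_inf_of_right (mem_principal_self _)] with E hE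
  refine Finset.sum_congr rfl fun i hi => ?_
  have h4 := hE.1 i hi
  rw [Set.uIcc_of_le Real.pi_pos.le] at h4
  rw [hf.2 _ h4.1, hf.2 _ h4.2]
  rfl

theorem ae_hasDerivAt (hf : IsPrim f f') :
    ∀ᵐ x ∂(volume.restrict (Set.Ioo 0 Real.pi)), HasDerivAt f (f' x) x := by
  rw [ae_restrict_iff' measurableSet_Ioo]
  filter_upwards [hf.1.ae_hasDerivAt_integral] with x hx hx'
  have h := (hx (by rw [Set.uIcc_of_le Real.pi_pos.le]; exact Set.Ioo_subset_Icc_self hx') 0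
    (by simp)).const_add (f 0)
  refine h.congr_of_eventuallyEq ?_
  filter_upwards [Ioo_mem_nhds hx'.1 hx'.2] with y hy
  exact hf.2 y (Set.Ioo_subset_Icc_self hy)

/-- The difference of `f` and the integral of `f'` is absolutely continuous with zero derivative
almost everywhere, hence constant. -/
theorem of_ac (h : AbsolutelyContinuousOnInterval f 0 Real.pi)
    (hi : IntervalIntegrable f' volume 0 Real.pi)
    (hd : ∀ᵐ x ∂(volume.restrict (Set.Ioo 0 Real.pi)), HasDerivAt f (f' x) x) : IsPrim f f' := by
  refine ⟨hi, ?_⟩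
  have hg := h.sub (absolutelyContinuousOnInterval_intervalIntegral_complex hi)
  rw [ae_Ioo_iff] at hd
  obtain ⟨c, hc⟩ := hg.const_of_ae_hasDerivAt_zero (by
    filter_upwards [hd, hi.ae_hasDerivAt_integral] with x hx1 hx2 hx
    have := (hx1 (by rwa [Set.uIcc_of_le Real.pi_pos.le] at hx)).sub (hx2 hx 0 (by simp))
    simpa using this)
  rw [Set.uIcc_of_le Real.pi_pos.le] at hc
  intro x hx
  have h1 := hc x hx
  have h2 := hc 0 ⟨le_rfl, Real.pi_pos.le⟩
  simp only [Pi.sub_apply, intervalIntegral.integral_same, sub_zero] at h1 h2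
  rw [h2, ← h1]; ring

theorem mul (hf : IsPrim f f') (hg : IsPrim g g') :
    IsPrim (fun x => f x * g x) (fun x => f' x * g x + f x * g' x) := by
  refine of_ac (hf.ac.smul hg.ac) ?_ ?_
  · have h1 := hf.continuousOn
    have h2 := hg.continuousOn
    rw [← Set.uIcc_of_le Real.pi_pos.le] at h1 h2
    exact (hf.1.mul_continuousOn h2).add (hg.1.continuousOn_mul h1)
  · filter_upwards [hf.ae_hasDerivAt, hg.ae_hasDerivAt] with x h1 h2
    exact h1.mul h2

theorem add (hf : IsPrim f f') (hg : IsPrim g g') :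
    IsPrim (fun x => f x + g x) (fun x => f' x + g' x) := by
  refine ⟨hf.1.add hg.1, fun x hx => ?_⟩
  simp only
  rw [intervalIntegral.integral_add (hf.integrable_mono hx) (hg.integrable_mono hx),
    hf.2 x hx, hg.2 x hx]
  ring

theorem const_mul (hf : IsPrim f f') (c : ℂ) : IsPrim (fun x => c * f x) (fun x => c * f' x) := by
  refine ⟨hf.1.const_mul c, fun x hx => ?_⟩
  simp only
  rw [intervalIntegral.integral_const_mul, hf.2 x hx]
  ring

theorem sub (hf : IsPrim f f') (hg : IsPrim g g') :
    IsPrim (fun x => f x - g x) (fun x => f' x - g' x) := by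
  refine ⟨hf.1.sub hg.1, fun x hx => ?_⟩
  simp only
  rw [intervalIntegral.integral_sub (hf.integrable_mono hx) (hg.integrable_mono hx),
    hf.2 x hx, hg.2 x hx]
  ring

theorem of_hasDerivAt (h : ∀ x, HasDerivAt f (f' x) x) (hc : Continuous f') : IsPrim f f' := by
  refine ⟨hc.intervalIntegrable _ _, fun x _ => ?_⟩
  rw [intervalIntegral.integral_eq_sub_of_hasDerivAt (fun y _ => h y) (hc.intervalIntegrable _ _)]
  ring

theorem congr_deriv (hf : IsPrim f f') (h : ∀ x ∈ Set.Icc 0 Real.pi, f' x = g' x) :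
    IsPrim f g' := by
  have h' : ∀ x ∈ Set.Icc 0 Real.pi, Set.EqOn f' g' (Set.uIoc 0 x) := fun x hx t ht => by
    rw [Set.uIoc_of_le hx.1] at ht
    exact h t ⟨ht.1.le, ht.2.trans hx.2⟩
  refine ⟨hf.1.congr (h' _ ⟨Real.pi_pos.le, le_rfl⟩), fun x hx => ?_⟩
  rw [hf.2 x hx]
  congr 1
  exact intervalIntegral.integral_congr_ae (Eventually.of_forall fun t ht => h' x hx ht)

theorem norm_sub_le (hf : IsPrim f f') {x : ℝ} (hx : x ∈ Set.Icc 0 Real.pi) :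
    ‖f x - f 0‖ ≤ ∫ t in (0 : ℝ)..x, ‖f' t‖ := by
  rw [hf.2 x hx, add_sub_cancel_left]
  exact intervalIntegral.norm_integral_le_integral_norm hx.1

end IsPrim

/-! ### Grönwall inequalities with an integrable coefficient -/

theorem AbsolutelyContinuousOnInterval.comp_lipschitz {f : ℝ → ℝ} {a b : ℝ} {g : ℝ → ℝ}
    {K : NNReal} {s : Set ℝ}
    (hf : AbsolutelyContinuousOnInterval f a b) (hg : LipschitzOnWith K g s)
    (hs : ∀ x ∈ Set.uIcc a b, f x ∈ s) : AbsolutelyContinuousOnInterval (fun x => g (f x)) a b := by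
  unfold AbsolutelyContinuousOnInterval at hf ⊢
  refine squeeze_zero' (Eventually.of_forall fun _ => Finset.sum_nonneg fun _ _ => dist_nonneg) ?_
    (by simpa using hf.const_mul (K : ℝ))
  filter_upwards [mem_inf_of_right (mem_principal_self _)] with E hE
  rw [Finset.mul_sum]
  refine Finset.sum_le_sum fun i hi => ?_
  exact hg.dist_le_mul _ (hs _ (hE.1 i hi).1) _ (hs _ (hE.1 i hi).2)

/-- Exponentials of primitives of integrable functions. -/
theorem exp_primitive_ac {h : ℝ → ℝ} (hi : IntervalIntegrable h volume 0 Real.pi) (c : ℝ) :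
    AbsolutelyContinuousOnInterval (fun x => Real.exp (c * ∫ t in (0 : ℝ)..x, h t)) 0 Real.pi ∧
    ∀ᵐ x, x ∈ Set.uIcc 0 Real.pi → HasDerivAt (fun x => Real.exp (c * ∫ t in (0 : ℝ)..x, h t))
      (Real.exp (c * ∫ t in (0 : ℝ)..x, h t) * (c * h x)) x := by
  constructor
  · have h1 := (hi.absolutelyContinuousOnInterval_intervalIntegral (c := 0) (by simp)).const_mul c
    obtain ⟨B, hB⟩ := h1.exists_bound
    obtain ⟨K, hK⟩ := (Real.contDiff_exp (n := 1)).contDiffOn.exists_lipschitzOnWith (by decide)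
      (convex_Icc (-B) B) isCompact_Icc
    exact h1.comp_lipschitz hK fun x hx => abs_le.1 (hB x hx)
  · filter_upwards [hi.ae_hasDerivAt_integral] with x hx hx'
    exact ((hx hx' 0 (by simp)).const_mul c).exp

theorem integral_mul_exp_primitive {h : ℝ → ℝ} (hi : IntervalIntegrable h volume 0 Real.pi)
    (c : ℝ) {x : ℝ} (hx : x ∈ Set.Icc 0 Real.pi) :
    ∫ t in (0 : ℝ)..x, Real.exp (c * ∫ s in (0 : ℝ)..t, h s) * (c * h t) =
      Real.exp (c * ∫ s in (0 : ℝ)..x, h s) - 1 := by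
  obtain ⟨h1, h2⟩ := exp_primitive_ac hi c
  have hsub : Set.uIcc 0 x ⊆ Set.uIcc 0 Real.pi :=
    Set.uIcc_subset_uIcc_left (by rwa [Set.uIcc_of_le Real.pi_pos.le])
  have h3 := (h1.mono hsub).integral_deriv_eq_sub
  simp only [intervalIntegral.integral_same, mul_zero, Real.exp_zero] at h3
  rw [← h3]
  refine intervalIntegral.integral_congr_ae ?_
  filter_upwards [h2] with t ht ht'
  exact ((ht (hsub (Set.uIoc_subset_uIcc ht'))).deriv).symm

/-- Grönwall's inequality with an integrable coefficient. -/
theorem gronwall_integrable {E h : ℝ → ℝ} {c : ℝ} (hE : ContinuousOn E (Set.Icc 0 Real.pi))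
    (hh : ∀ x, 0 ≤ h x) (hi : IntervalIntegrable h volume 0 Real.pi)
    (hle : ∀ x ∈ Set.Icc 0 Real.pi, E x ≤ c + ∫ t in (0 : ℝ)..x, h t * E t) :
    ∀ x ∈ Set.Icc 0 Real.pi, E x ≤ c * Real.exp (∫ t in (0 : ℝ)..x, h t) := by
  intro x hx
  -- The integrating factor `exp(-∫h)`: its product with the right-hand side of `hle` is absolutely
  -- continuous, and `hle` makes the derivative of that product nonpositive.
  obtain ⟨h1, h2⟩ := exp_primitive_ac hi (-1)
  have hsub : Set.uIcc 0 x ⊆ Set.uIcc 0 Real.pi :=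
    Set.uIcc_subset_uIcc_left (by rwa [Set.uIcc_of_le Real.pi_pos.le])
  have hE' := hE
  rw [← Set.uIcc_of_le Real.pi_pos.le] at hE'
  have hiE : IntervalIntegrable (fun t => h t * E t) volume 0 Real.pi := hi.mul_continuousOn hE'
  have hG : AbsolutelyContinuousOnInterval (fun x => c + ∫ t in (0 : ℝ)..x, h t * E t) 0 Real.pi :=
    (LipschitzWith.const (α := ℝ) c).lipschitzOnWith.absolutelyContinuousOnInterval.add
      (hiE.absolutelyContinuousOnInterval_intervalIntegral (c := 0) (by simp))
  have hP := ((hG.mul h1).mono hsub).integral_deriv_eq_sub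
  have hneg : ∫ t in (0 : ℝ)..x, deriv ((fun x => c + ∫ t in (0 : ℝ)..x, h t * E t) *
      fun x => Real.exp (-1 * ∫ t in (0 : ℝ)..x, h t)) t ≤ 0 := by
    rw [intervalIntegral.integral_of_le hx.1]
    refine integral_nonpos_of_ae ?_
    rw [EventuallyLE, ae_restrict_iff' measurableSet_Ioc]
    filter_upwards [h2, hiE.ae_hasDerivAt_integral] with t ht1 ht2 ht
    have ht0 : t ∈ Set.Icc 0 Real.pi := ⟨ht.1.le, ht.2.trans hx.2⟩
    have ht' : t ∈ Set.uIcc 0 Real.pi := by rwa [Set.uIcc_of_le Real.pi_pos.le]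
    have := ((ht2 ht' 0 (by simp)).const_add c).mul (ht1 ht')
    rw [this.deriv]
    have h5 := hle t ht0
    have h6 := Real.exp_pos (-1 * ∫ t in (0 : ℝ)..t, h t)
    have h7 := mul_le_mul_of_nonneg_left h5 (mul_nonneg (hh t) h6.le)
    simp only [Pi.zero_apply]
    nlinarith
  rw [hP] at hneg
  simp only [Pi.mul_apply, intervalIntegral.integral_same, Real.exp_zero, add_zero,
    neg_mul, one_mul, Real.exp_neg, inv_one, mul_one] at hneg
  have hpos := Real.exp_pos (∫ t in (0 : ℝ)..x, h t)
  refine (hle x hx).trans ?_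
  rw [← div_eq_mul_inv, sub_nonpos, div_le_iff₀ hpos] at hneg
  exact hneg

/-- Grönwall's inequality with an integrable coefficient and a nonconstant free term. -/
theorem gronwall_integrable_free {E F h : ℝ → ℝ} (hE : ContinuousOn E (Set.Icc 0 Real.pi))
    (hF : ContinuousOn F (Set.Icc 0 Real.pi)) (hF0 : ∀ x ∈ Set.Icc 0 Real.pi, 0 ≤ F x)
    (hh : ∀ x, 0 ≤ h x) (hi : IntervalIntegrable h volume 0 Real.pi)
    (hle : ∀ x ∈ Set.Icc 0 Real.pi, E x ≤ F x + ∫ t in (0 : ℝ)..x, h t * E t) :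
    ∀ x ∈ Set.Icc 0 Real.pi, E x ≤ F x +
      (∫ t in (0 : ℝ)..Real.pi, h t * F t) * Real.exp (∫ t in (0 : ℝ)..Real.pi, h t) := by
  have hE' := hE
  have hF' := hF
  rw [← Set.uIcc_of_le Real.pi_pos.le] at hE' hF'
  have hiE : IntervalIntegrable (fun t => h t * E t) volume 0 Real.pi := hi.mul_continuousOn hE'
  have hiF : IntervalIntegrable (fun t => h t * F t) volume 0 Real.pi := hi.mul_continuousOn hF'
  have hsub : ∀ x ∈ Set.Icc 0 Real.pi, Set.uIcc 0 x ⊆ Set.uIcc 0 Real.pi := fun x hx =>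
    Set.uIcc_subset_uIcc_left (by rwa [Set.uIcc_of_le Real.pi_pos.le])
  have hGc : ContinuousOn (fun x => ∫ t in (0 : ℝ)..x, h t * E t) (Set.Icc 0 Real.pi) := by
    have := intervalIntegral.continuousOn_primitive_interval' hiE (a := 0) (by simp)
    rwa [Set.uIcc_of_le Real.pi_pos.le] at this
  have hmono : ∀ k : ℝ → ℝ, (∀ x ∈ Set.Icc 0 Real.pi, 0 ≤ k x) →
      IntervalIntegrable k volume 0 Real.pi → ∀ x ∈ Set.Icc 0 Real.pi,
      ∫ t in (0 : ℝ)..x, k t ≤ ∫ t in (0 : ℝ)..Real.pi, k t := by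
    intro k hk hki x hx
    refine intervalIntegral.integral_mono_interval le_rfl hx.1 hx.2 ?_ hki
    filter_upwards [ae_restrict_mem measurableSet_Ioc] with t ht using hk t ⟨ht.1.le, ht.2⟩
  have hc0 : 0 ≤ ∫ t in (0 : ℝ)..Real.pi, h t * F t :=
    intervalIntegral.integral_nonneg Real.pi_pos.le fun t ht => mul_nonneg (hh t) (hF0 t ht)
  intro x hx
  -- The primitive of `h * E` satisfies an inequality with a constant free term, so the constant
  -- version is applied to it instead of `E`. The value `F x` at the point itself thus survives in
  -- the bound.
  have hG := gronwall_integrable hGc hh hi (c := ∫ t in (0 : ℝ)..Real.pi, h t * F t) (by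
    intro y hy
    have hiG : IntervalIntegrable (fun t => h t * ∫ s in (0 : ℝ)..t, h s * E s) volume 0 y := by
      refine (hi.mul_continuousOn ?_).mono_set (hsub y hy)
      rwa [Set.uIcc_of_le Real.pi_pos.le]
    calc ∫ t in (0 : ℝ)..y, h t * E t
        ≤ ∫ t in (0 : ℝ)..y, (h t * F t + h t * ∫ s in (0 : ℝ)..t, h s * E s) := by
          refine intervalIntegral.integral_mono_on hy.1 (hiE.mono_set (hsub y hy))
            ((hiF.mono_set (hsub y hy)).add hiG) fun t ht => ?_
          rw [← mul_add]
          exact mul_le_mul_of_nonneg_left (hle t ⟨ht.1, ht.2.trans hy.2⟩) (hh t)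
      _ = (∫ t in (0 : ℝ)..y, h t * F t) + ∫ t in (0 : ℝ)..y, h t * ∫ s in (0 : ℝ)..t, h s * E s :=
          intervalIntegral.integral_add (hiF.mono_set (hsub y hy)) hiG
      _ ≤ _ := by
          gcongr
          exact hmono _ (fun t ht => mul_nonneg (hh t) (hF0 t ht)) hiF y hy) x hx
  refine (hle x hx).trans ?_
  gcongr
  refine hG.trans ?_
  gcongr
  exact hmono h (fun t _ => hh t) hi x hx

/-! ### The norm of `L₂(0, π)` -/

/-- Square integrability on `(0, π)`. -/
abbrev MemL2 (f : ℝ → ℂ) : Prop := MemLp f 2 (volume.restrict (Set.Ioo 0 Real.pi))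

/-- The norm of `L₂(0, π)`. -/
noncomputable def l2norm (f : ℝ → ℂ) : ℝ :=
  (eLpNorm f 2 (volume.restrict (Set.Ioo 0 Real.pi))).toReal

theorem l2norm_nonneg (f : ℝ → ℂ) : 0 ≤ l2norm f := ENNReal.toReal_nonneg

theorem intervalIntegrable_iff_Ioo {E : Type*} [NormedAddCommGroup E] {f : ℝ → E} :
    IntervalIntegrable f volume 0 Real.pi ↔
      Integrable f (volume.restrict (Set.Ioo 0 Real.pi)) := by
  rw [intervalIntegrable_iff_integrableOn_Ioo_of_le Real.pi_pos.le, IntegrableOn]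

theorem intervalIntegral_eq_Ioo {E : Type*} [NormedAddCommGroup E] [NormedSpace ℝ E] (f : ℝ → E) :
    ∫ t in (0 : ℝ)..Real.pi, f t = ∫ t in Set.Ioo 0 Real.pi, f t := by
  rw [intervalIntegral.integral_of_le Real.pi_pos.le, integral_Ioc_eq_integral_Ioo]

namespace MemL2

variable {f g : ℝ → ℂ}

theorem intervalIntegrable (hf : MemL2 f) : IntervalIntegrable f volume 0 Real.pi :=
  intervalIntegrable_iff_Ioo.2 (hf.integrable (by norm_num))

theorem intervalIntegrable_mul (hf : MemL2 f) (hg : MemL2 g) :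
    IntervalIntegrable (fun x => f x * g x) volume 0 Real.pi :=
  intervalIntegrable_iff_Ioo.2 (hf.integrable_mul hg)

theorem intervalIntegrable_sq (hf : MemL2 f) :
    IntervalIntegrable (fun x => f x ^ 2) volume 0 Real.pi := by
  simpa only [sq] using hf.intervalIntegrable_mul hf

theorem intervalIntegrable_norm_sq (hf : MemL2 f) :
    IntervalIntegrable (fun x => ‖f x‖ ^ 2) volume 0 Real.pi := by
  simpa only [norm_pow] using hf.intervalIntegrable_sq.norm

end MemL2

theorem integral_norm_sq_eq {f : ℝ → ℂ} (hf : MemL2 f) :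
    ∫ t in (0 : ℝ)..Real.pi, ‖f t‖ ^ 2 = l2norm f ^ 2 := by
  have h0 : 0 ≤ ∫ t in Set.Ioo 0 Real.pi, ‖f t‖ ^ 2 := integral_nonneg fun t => by positivity
  rw [l2norm, hf.eLpNorm_eq_integral_rpow_norm (by norm_num) (by norm_num), intervalIntegral_eq_Ioo]
  simp only [ENNReal.toReal_ofNat, Real.rpow_ofNat]
  rw [ENNReal.toReal_ofReal (by positivity), ← Real.rpow_natCast, ← Real.rpow_mul h0]
  norm_num

theorem integral_norm_mul_le {f g : ℝ → ℂ} (hf : MemL2 f) (hg : MemL2 g) :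
    ∫ t in (0 : ℝ)..Real.pi, ‖f t‖ * ‖g t‖ ≤ l2norm f * l2norm g := by
  have h := integral_mul_norm_le_Lp_mul_Lq (μ := volume.restrict (Set.Ioo 0 Real.pi)) (f := f)
    (g := g) (p := 2) (q := 2) (by constructor <;> norm_num) (by simpa using hf) (by simpa using hg)
  simp only [Real.rpow_ofNat] at h
  rw [← intervalIntegral_eq_Ioo, ← intervalIntegral_eq_Ioo, ← intervalIntegral_eq_Ioo,
    integral_norm_sq_eq hf, integral_norm_sq_eq hg] at h
  rwa [← Real.sqrt_eq_rpow, ← Real.sqrt_eq_rpow, Real.sqrt_sq (l2norm_nonneg _),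
    Real.sqrt_sq (l2norm_nonneg _)] at h

theorem memL2_one : MemL2 fun _ => 1 := memLp_const 1

theorem l2norm_one_le : l2norm (fun _ => 1) ≤ 2 := by
  have h := integral_norm_sq_eq memL2_one
  simp only [norm_one, one_pow, intervalIntegral.integral_const, smul_eq_mul] at h
  nlinarith [Real.pi_lt_four, l2norm_nonneg fun _ => 1]

/-- Cauchy–Schwarz against the constant one, whose norm `√π` is rounded up to 2. -/
theorem integral_norm_le {f : ℝ → ℂ} (hf : MemL2 f) :
    ∫ t in (0 : ℝ)..Real.pi, ‖f t‖ ≤ 2 * l2norm f := by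
  have h := integral_norm_mul_le hf memL2_one
  simp only [norm_one, mul_one] at h
  nlinarith [l2norm_one_le, l2norm_nonneg f]

theorem l2norm_add_le {f g : ℝ → ℂ} (hf : MemL2 f) (hg : MemL2 g) :
    l2norm (fun x => f x + g x) ≤ l2norm f + l2norm g := by
  unfold l2norm
  rw [← ENNReal.toReal_add hf.2.ne hg.2.ne]
  exact ENNReal.toReal_mono (ENNReal.add_ne_top.2 ⟨hf.2.ne, hg.2.ne⟩)
    (eLpNorm_add_le hf.1 hg.1 (by norm_num))

theorem l2norm_le_of_sub {f g : ℝ → ℂ} (hf : MemL2 f) (hg : MemL2 g) :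
    l2norm g ≤ l2norm (fun x => g x - f x) + l2norm f := by
  have h := l2norm_add_le (hg.sub hf) hf
  simp only [Pi.sub_apply, sub_add_cancel] at h
  exact h

theorem integral_norm_sq_sub_sq_le {f g : ℝ → ℂ} (hf : MemL2 f) (hg : MemL2 g) :
    ∫ t in (0 : ℝ)..Real.pi, ‖f t ^ 2 - g t ^ 2‖ ≤
      l2norm (fun x => f x - g x) * (l2norm f + l2norm g) := by
  have h := integral_norm_mul_le (hf.sub hg) (hf.add hg)
  calc _ = ∫ t in (0 : ℝ)..Real.pi, ‖(f - g) t‖ * ‖(f + g) t‖ := by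
        congr 1; ext t
        simp only [Pi.sub_apply, Pi.add_apply]
        rw [← norm_mul]; ring_nf
    _ ≤ _ := h
    _ ≤ _ := mul_le_mul_of_nonneg_left (l2norm_add_le hf hg) (l2norm_nonneg _)

theorem integral_mono_right {k : ℝ → ℝ} (hk : ∀ x, 0 ≤ k x)
    (hki : IntervalIntegrable k volume 0 Real.pi) {x : ℝ} (hx : x ∈ Set.Icc 0 Real.pi) :
    ∫ t in (0 : ℝ)..x, k t ≤ ∫ t in (0 : ℝ)..Real.pi, k t :=
  intervalIntegral.integral_mono_interval le_rfl hx.1 hx.2 (Eventually.of_forall hk) hki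

theorem uIcc_subset_of_mem {x : ℝ} (hx : x ∈ Set.Icc 0 Real.pi) :
    Set.uIcc 0 x ⊆ Set.uIcc 0 Real.pi :=
  Set.uIcc_subset_uIcc_left (by rwa [Set.uIcc_of_le Real.pi_pos.le])

/-! ### Existence and uniqueness for the singular Sturm–Liouville system -/

/-- Linear Volterra equations with an integrable kernel are solvable. -/
theorem exists_volterra_solution {E : Type*} [NormedAddCommGroup E] [NormedSpace ℝ E]
    [CompleteSpace E] (F : ℝ → E →ₗ[ℝ] E) {h : ℝ → ℝ} (hh : ∀ x, 0 ≤ h x)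
    (hi : IntervalIntegrable h volume 0 Real.pi) (hF : ∀ t p, ‖F t p‖ ≤ h t * ‖p‖)
    (hint : ∀ Y : ℝ → E, ContinuousOn Y (Set.Icc 0 Real.pi) →
      IntervalIntegrable (fun t => F t (Y t)) volume 0 Real.pi) (c : E) :
    ∃ Y : ℝ → E, ContinuousOn Y (Set.Icc 0 Real.pi) ∧
      ∀ x ∈ Set.Icc 0 Real.pi, Y x = c + ∫ t in (0 : ℝ)..x, F t (Y t) := by
  set m : ℝ → ℝ := fun x => ∫ t in (0 : ℝ)..x, h t with hm
  have hmc : ContinuousOn m (Set.Icc 0 Real.pi) := by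
    have := intervalIntegral.continuousOn_primitive_interval' hi (a := 0) (by simp)
    rwa [Set.uIcc_of_le Real.pi_pos.le] at this
  have hec : ∀ a : ℝ, ContinuousOn (fun x => Real.exp (a * m x)) (Set.Icc 0 Real.pi) := fun a =>
    (continuousOn_const.mul hmc).rexp
  let ext : C(Set.Icc 0 Real.pi, E) → ℝ → E := fun Z => Set.IccExtend Real.pi_pos.le Z
  have hext : ∀ Z, Continuous (ext Z) := fun Z => Z.continuous.Icc_extend'
  have hextv : ∀ (Z : C(Set.Icc 0 Real.pi, E)) (x : ℝ) (hx : x ∈ Set.Icc 0 Real.pi),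
      ext Z x = Z ⟨x, hx⟩ := fun Z x hx => Set.IccExtend_of_mem _ _ hx
  have hY : ∀ Z, ContinuousOn (fun x => Real.exp (2 * m x) • ext Z x) (Set.Icc 0 Real.pi) :=
    fun Z => (hec 2).smul (hext Z).continuousOn
  have hI := fun Z => hint _ (hY Z)
  -- The unknown is rescaled as `Y = exp(2m) Z` with `m` the primitive of `h`. In the weighted norm
  -- the Volterra operator contracts by `1/2` on all of `[0, π]`, so the interval need not be
  -- subdivided.
  let S : C(Set.Icc 0 Real.pi, E) → ℝ → E := fun Z x =>
    Real.exp (-2 * m x) • (c + ∫ t in (0 : ℝ)..x, F t (Real.exp (2 * m t) • ext Z t))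
  have hS : ∀ Z, ContinuousOn (S Z) (Set.Icc 0 Real.pi) := by
    intro Z
    have := intervalIntegral.continuousOn_primitive_interval' (hI Z) (a := 0) (by simp)
    rw [Set.uIcc_of_le Real.pi_pos.le] at this
    exact (hec (-2)).smul (continuousOn_const.add this)
  let T : C(Set.Icc 0 Real.pi, E) → C(Set.Icc 0 Real.pi, E) := fun Z =>
    ⟨(Set.Icc 0 Real.pi).domRestrict (S Z), (hS Z).domRestrict⟩
  have hT : ContractingWith (1 / 2) T := by
    refine ⟨by rw [← NNReal.coe_lt_coe]; norm_num, LipschitzWith.of_dist_le_mul fun Z W => ?_⟩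
    refine (ContinuousMap.dist_le (by positivity)).2 fun x => ?_
    obtain ⟨x, hx⟩ := x
    have hsub := uIcc_subset_of_mem hx
    change dist (S Z x) (S W x) ≤ _
    simp only [S]
    rw [dist_eq_norm, ← smul_sub, add_sub_add_left_eq_sub, ← intervalIntegral.integral_sub
      ((hI Z).mono_set hsub) ((hI W).mono_set hsub), norm_smul, Real.norm_of_nonneg (by positivity)]
    have hexi : IntervalIntegrable (fun t => Real.exp (2 * m t) * (2 * h t)) volume 0 Real.pi := by
      refine (hi.const_mul 2).continuousOn_mul ?_
      rw [Set.uIcc_of_le Real.pi_pos.le]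
      exact hec 2
    have h1 : ‖∫ t in (0 : ℝ)..x, (F t (Real.exp (2 * m t) • ext Z t) -
        F t (Real.exp (2 * m t) • ext W t))‖ ≤
        ∫ t in (0 : ℝ)..x, dist Z W / 2 * (Real.exp (2 * m t) * (2 * h t)) := by
      refine intervalIntegral.norm_integral_le_of_norm_le hx.1 (Eventually.of_forall fun t ht => ?_)
        ((hexi.mono_set hsub).const_mul _)
      have ht' : t ∈ Set.Icc 0 Real.pi := ⟨ht.1.le, ht.2.trans hx.2⟩
      rw [← map_sub, ← smul_sub]
      refine (hF _ _).trans ?_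
      rw [norm_smul, Real.norm_of_nonneg (by positivity)]
      have h2 : ‖ext Z t - ext W t‖ ≤ dist Z W := by
        rw [hextv Z t ht', hextv W t ht', ← dist_eq_norm]
        exact ContinuousMap.dist_apply_le_dist _
      have h3 : 0 ≤ h t * Real.exp (2 * m t) := mul_nonneg (hh t) (Real.exp_pos _).le
      have h4 := mul_le_mul_of_nonneg_left h2 h3
      nlinarith
    -- The majorant is an exact derivative; its integral `exp(2m) - 1` is absorbed by the weight
    -- `exp(-2m)` and the factor `1/2` remains.
    rw [intervalIntegral.integral_const_mul, integral_mul_exp_primitive hi 2 hx] at h1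
    refine (mul_le_mul_of_nonneg_left h1 (Real.exp_pos _).le).trans ?_
    have h5 : Real.exp (-2 * m x) * Real.exp (2 * m x) = 1 := by
      rw [← Real.exp_add]; simp
    have h6 := Real.exp_pos (-2 * m x)
    have h7 : (0 : ℝ) ≤ dist Z W := dist_nonneg
    push_cast
    change Real.exp (-2 * m x) * (dist Z W / 2 * (Real.exp (2 * m x) - 1)) ≤ _
    nlinarith [mul_nonneg h7 h6.le]
  obtain ⟨Z, hZ⟩ : ∃ Z, T Z = Z := ⟨_, hT.fixedPoint_isFixedPt⟩
  refine ⟨fun x => Real.exp (2 * m x) • ext Z x, hY Z, fun x hx => ?_⟩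
  have h1 : ext Z x = S Z x := by
    rw [hextv Z x hx]
    conv_lhs => rw [← hZ]
    rfl
  have h5 : Real.exp (2 * m x) * Real.exp (-2 * m x) = 1 := by
    rw [← Real.exp_add]; simp
  simp only
  rw [h1]
  simp only [S]
  rw [smul_smul, h5, one_smul]

/-- The integrated form of `IsSLSolution`. -/
def SLSol (σ : ℝ → ℂ) (μ : ℂ) (y y1 : ℝ → ℂ) : Prop :=
  IsPrim y (fun x => y1 x + σ x * y x) ∧
    IsPrim y1 (fun x => -σ x * y1 x - σ x ^ 2 * y x - μ * y x)

theorem intervalIntegrable_system {σ : ℝ → ℂ} (hσ : MemL2 σ) {y y1 : ℝ → ℂ} (μ : ℂ) (hy : ContinuousOn y (Set.Icc 0 Real.pi))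
    (hy1 : ContinuousOn y1 (Set.Icc 0 Real.pi)) :
    IntervalIntegrable (fun x => y1 x + σ x * y x) volume 0 Real.pi ∧
    IntervalIntegrable (fun x => -σ x * y1 x - σ x ^ 2 * y x - μ * y x) volume 0 Real.pi := by
  rw [← Set.uIcc_of_le Real.pi_pos.le] at hy hy1
  exact ⟨hy1.intervalIntegrable.add (hσ.intervalIntegrable.mul_continuousOn hy),
    ((hσ.intervalIntegrable.neg.mul_continuousOn hy1).sub
      (hσ.intervalIntegrable_sq.mul_continuousOn hy)).sub (hy.intervalIntegrable.const_mul μ)⟩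

/-- Square integrability of `σ` makes both right-hand sides integrable for continuous `y` and `y1`,
so the almost everywhere derivatives can be integrated. -/
theorem isSLSolution_iff {σ : ℝ → ℂ} (hσ : MemL2 σ) {μ : ℂ} {y y1 : ℝ → ℂ} : IsSLSolution σ μ y y1 ↔ SLSol σ μ y y1 := by
  constructor
  · intro h
    have hc := h.ac.continuousOn
    have hc1 := h.ac_quasi.continuousOn
    rw [Set.uIcc_of_le Real.pi_pos.le] at hc hc1
    obtain ⟨h1, h2⟩ := intervalIntegrable_system hσ μ hc hc1
    exact ⟨IsPrim.of_ac h.ac h1 h.quasi_deriv, IsPrim.of_ac h.ac_quasi h2 h.equation⟩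
  · intro h
    exact ⟨h.1.ac, h.2.ac, h.1.ae_hasDerivAt, h.2.ae_hasDerivAt⟩

theorem intervalIntegrable_coeff {σ : ℝ → ℂ} (hσ : MemL2 σ) (c : ℝ) :
    IntervalIntegrable (fun x => c + ‖σ x‖ + ‖σ x‖ ^ 2) volume 0 Real.pi :=
  ((continuous_const.intervalIntegrable _ _).add hσ.intervalIntegrable.norm).add
    hσ.intervalIntegrable_norm_sq

theorem integral_coeff_le {σ : ℝ → ℂ} (hσ : MemL2 σ) (c : ℝ) (hc : 0 ≤ c) :
    ∫ x in (0 : ℝ)..Real.pi, (c + ‖σ x‖ + ‖σ x‖ ^ 2) ≤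
      4 * c + 2 * l2norm σ + l2norm σ ^ 2 := by
  rw [intervalIntegral.integral_add ((continuous_const.intervalIntegrable _ _).add
    hσ.intervalIntegrable.norm) hσ.intervalIntegrable_norm_sq, intervalIntegral.integral_add
    (continuous_const.intervalIntegrable _ _) hσ.intervalIntegrable.norm, integral_norm_sq_eq hσ]
  have h1 := integral_norm_le hσ
  simp only [intervalIntegral.integral_const, smul_eq_mul, sub_zero]
  nlinarith [Real.pi_lt_four]

theorem exists_slSol {σ : ℝ → ℂ} (hσ : MemL2 σ) (μ a b : ℂ) : ∃ y y1, SLSol σ μ y y1 ∧ y 0 = a ∧ y1 0 = b := by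
  let F : ℝ → (ℂ × ℂ) →ₗ[ℝ] (ℂ × ℂ) := fun t =>
    { toFun := fun p => (p.2 + σ t * p.1, -σ t * p.2 - σ t ^ 2 * p.1 - μ * p.1)
      map_add' := fun p q => by
        apply Prod.ext <;> simp <;> ring
      map_smul' := fun r p => by
        apply Prod.ext <;> simp <;> ring }
  obtain ⟨Y, hYc, hY⟩ := exists_volterra_solution F (h := fun x => (1 + ‖μ‖) + ‖σ x‖ + ‖σ x‖ ^ 2)
    (fun x => by positivity) (intervalIntegrable_coeff hσ _) (by
      intro t p
      have h1 := norm_fst_le p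
      have h2 := norm_snd_le p
      have h0 := norm_nonneg p
      have hs := norm_nonneg (σ t)
      have hmu := norm_nonneg μ
      rw [Prod.norm_def, max_le_iff]
      constructor
      · calc ‖p.2 + σ t * p.1‖ ≤ ‖p.2‖ + ‖σ t‖ * ‖p.1‖ := by
              simpa using norm_add_le p.2 (σ t * p.1)
          _ ≤ ‖p‖ + ‖σ t‖ * ‖p‖ := by gcongr
          _ ≤ _ := by nlinarith [mul_nonneg hmu h0, mul_nonneg (sq_nonneg ‖σ t‖) h0]
      · calc ‖-σ t * p.2 - σ t ^ 2 * p.1 - μ * p.1‖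
            ≤ ‖σ t‖ * ‖p.2‖ + ‖σ t‖ ^ 2 * ‖p.1‖ + ‖μ‖ * ‖p.1‖ := by
              refine (norm_sub_le _ _).trans ?_
              rw [norm_mul μ]
              gcongr
              refine (norm_sub_le _ _).trans ?_
              simp
          _ ≤ ‖σ t‖ * ‖p‖ + ‖σ t‖ ^ 2 * ‖p‖ + ‖μ‖ * ‖p‖ := by gcongr
          _ ≤ _ := by nlinarith) (by
      intro Y hY
      obtain ⟨h1, h2⟩ := intervalIntegrable_system hσ μ hY.fst hY.snd
      exact ⟨h1.1.prodMk h2.1, h1.2.prodMk h2.2⟩) (a, b)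
  obtain ⟨h1, h2⟩ := intervalIntegrable_system hσ μ hYc.fst hYc.snd
  have h0 : Y 0 = (a, b) := by simpa using hY 0 ⟨le_rfl, Real.pi_pos.le⟩
  have hi : ∀ x ∈ Set.Icc 0 Real.pi, IntervalIntegrable (fun t => F t (Y t)) volume 0 x :=
    fun x hx => by
      have h1' := h1.mono_set (uIcc_subset_of_mem hx)
      have h2' := h2.mono_set (uIcc_subset_of_mem hx)
      exact ⟨h1'.1.prodMk h2'.1, h1'.2.prodMk h2'.2⟩
  refine ⟨fun x => (Y x).1, fun x => (Y x).2, ⟨⟨h1, fun x hx => ?_⟩, ⟨h2, fun x hx => ?_⟩⟩, ?_, ?_⟩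
  · have := (ContinuousLinearMap.fst ℝ ℂ ℂ).intervalIntegral_comp_comm (hi x hx)
    simp only [ContinuousLinearMap.coe_fst', F, LinearMap.coe_mk, AddHom.coe_mk] at this
    simp only
    rw [this, h0]
    conv_lhs => rw [hY x hx]
    rfl
  · have := (ContinuousLinearMap.snd ℝ ℂ ℂ).intervalIntegral_comp_comm (hi x hx)
    simp only [ContinuousLinearMap.coe_snd', F, LinearMap.coe_mk, AddHom.coe_mk] at this
    simp only
    rw [this, h0]
    conv_lhs => rw [hY x hx]
    rfl
  · simp [h0]
  · simp [h0]

theorem mem_Icc_zero : (0 : ℝ) ∈ Set.Icc 0 Real.pi := ⟨le_rfl, Real.pi_pos.le⟩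
theorem mem_Icc_pi : Real.pi ∈ Set.Icc 0 Real.pi := ⟨Real.pi_pos.le, le_rfl⟩

theorem SLSol.linear {σ : ℝ → ℂ} {μ : ℂ} {y y1 z z1 : ℝ → ℂ} (hy : SLSol σ μ y y1)
    (hz : SLSol σ μ z z1) (a b : ℂ) :
    SLSol σ μ (fun x => a * y x + b * z x) (fun x => a * y1 x + b * z1 x) :=
  ⟨((hy.1.const_mul a).add (hz.1.const_mul b)).congr_deriv fun x _ => by ring,
    ((hy.2.const_mul a).add (hz.2.const_mul b)).congr_deriv fun x _ => by ring⟩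

/-- Lagrange's identity. -/
theorem SLSol.lagrange {σ : ℝ → ℂ} {μ ν : ℂ} {y y1 z z1 : ℝ → ℂ} (hy : SLSol σ μ y y1)
    (hz : SLSol σ ν z z1) :
    IsPrim (fun x => y x * z1 x - y1 x * z x) (fun x => (μ - ν) * (y x * z x)) :=
  ((hy.1.mul hz.2).sub (hy.2.mul hz.1)).congr_deriv fun x _ => by ring

theorem SLSol.lagrange_pi {σ : ℝ → ℂ} {μ ν : ℂ} {y y1 z z1 : ℝ → ℂ} (hy : SLSol σ μ y y1)
    (hz : SLSol σ ν z z1) :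
    (μ - ν) * ∫ x in (0 : ℝ)..Real.pi, y x * z x =
      (y Real.pi * z1 Real.pi - y1 Real.pi * z Real.pi) - (y 0 * z1 0 - y1 0 * z 0) := by
  have h := (hy.lagrange hz).2 Real.pi mem_Icc_pi
  simp only [intervalIntegral.integral_const_mul] at h
  rw [h]; ring

/-- Grönwall for the sum of the norms of a pair. With `g = 0` it gives a priori bounds; with a
forcing `g` it compares the solutions of two problems. -/
theorem norm_sub_add_norm_sub_le {p q p' q' : ℝ → ℂ} {h : ℝ → ℝ} {g : ℝ → ℝ}
    (hp : IsPrim p p') (hq : IsPrim q q') (hh : ∀ x, 0 ≤ h x)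
    (hi : IntervalIntegrable h volume 0 Real.pi) (hg : ∀ x, 0 ≤ g x)
    (hgi : IntervalIntegrable g volume 0 Real.pi)
    (hle : ∀ x ∈ Set.Icc 0 Real.pi, ‖p' x‖ + ‖q' x‖ ≤ h x * (‖p x‖ + ‖q x‖) + g x) :
    ∀ x ∈ Set.Icc 0 Real.pi, ‖p x‖ + ‖q x‖ ≤
      (‖p 0‖ + ‖q 0‖ + ∫ t in (0 : ℝ)..Real.pi, g t) *
        Real.exp (∫ t in (0 : ℝ)..Real.pi, h t) := by
  have hc : ContinuousOn (fun x => ‖p x‖ + ‖q x‖) (Set.Icc 0 Real.pi) :=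
    hp.continuousOn.norm.add hq.continuousOn.norm
  have hc' := hc
  rw [← Set.uIcc_of_le Real.pi_pos.le] at hc'
  have hhE : IntervalIntegrable (fun x => h x * (‖p x‖ + ‖q x‖)) volume 0 Real.pi :=
    hi.mul_continuousOn hc'
  intro x hx
  refine (gronwall_integrable hc hh hi (c := ‖p 0‖ + ‖q 0‖ + ∫ t in (0 : ℝ)..Real.pi, g t)
    (fun y hy => ?_) x hx).trans ?_
  · have hs := uIcc_subset_of_mem hy
    have h1 := hp.norm_sub_le hy
    have h2 := hq.norm_sub_le hy
    have h3 := norm_sub_norm_le (p y) (p 0)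
    have h4 := norm_sub_norm_le (q y) (q 0)
    have h5 : (∫ t in (0 : ℝ)..y, ‖p' t‖) + (∫ t in (0 : ℝ)..y, ‖q' t‖) ≤
        (∫ t in (0 : ℝ)..y, h t * (‖p t‖ + ‖q t‖)) + ∫ t in (0 : ℝ)..y, g t := by
      rw [← intervalIntegral.integral_add (hp.integrable_mono hy).norm (hq.integrable_mono hy).norm,
        ← intervalIntegral.integral_add (hhE.mono_set hs) (hgi.mono_set hs)]
      exact intervalIntegral.integral_mono_on hy.1
        ((hp.integrable_mono hy).norm.add (hq.integrable_mono hy).norm)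
        ((hhE.mono_set hs).add (hgi.mono_set hs)) fun t ht => hle t ⟨ht.1, ht.2.trans hy.2⟩
    have h6 := integral_mono_right hg hgi hy
    linarith
  · have h0 : 0 ≤ ∫ t in (0 : ℝ)..Real.pi, g t :=
      intervalIntegral.integral_nonneg Real.pi_pos.le fun t _ => hg t
    gcongr
    exact integral_mono_right hh hi hx

/-- The terms `e` and `e1` leave room for the forcing that appears when two problems are subtracted.
-/
theorem norm_system_le {σ μ p q e e1 : ℂ} :
    ‖q + σ * p + e‖ + ‖-σ * q - σ ^ 2 * p - μ * p + e1‖ ≤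
      2 * ((1 + ‖μ‖) + ‖σ‖ + ‖σ‖ ^ 2) * (‖p‖ + ‖q‖) + (‖e‖ + ‖e1‖) := by
  have h1 : ‖q + σ * p + e‖ ≤ ‖q‖ + ‖σ‖ * ‖p‖ + ‖e‖ := by
    refine (norm_add₃_le).trans ?_
    rw [norm_mul]
  have h2 : ‖-σ * q - σ ^ 2 * p - μ * p + e1‖ ≤
      ‖σ‖ * ‖q‖ + ‖σ‖ ^ 2 * ‖p‖ + ‖μ‖ * ‖p‖ + ‖e1‖ := by
    refine (norm_add_le _ _).trans ?_
    gcongr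
    refine (norm_sub_le _ _).trans ?_
    rw [norm_mul μ]
    gcongr
    refine (norm_sub_le _ _).trans ?_
    simp
  have hp := norm_nonneg p
  have hq := norm_nonneg q
  have hs := norm_nonneg σ
  have hm := norm_nonneg μ
  nlinarith [mul_nonneg hs hp, mul_nonneg hs hq, mul_nonneg hm hp, mul_nonneg hm hq,
    mul_nonneg (sq_nonneg ‖σ‖) hp, mul_nonneg (sq_nonneg ‖σ‖) hq]

theorem SLSol.norm_le {σ : ℝ → ℂ} (hσ : MemL2 σ) {μ : ℂ} {y y1 : ℝ → ℂ} (hy : SLSol σ μ y y1) :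
    ∀ x ∈ Set.Icc 0 Real.pi, ‖y x‖ + ‖y1 x‖ ≤ (‖y 0‖ + ‖y1 0‖) *
      Real.exp (2 * (4 * (1 + ‖μ‖) + 2 * l2norm σ + l2norm σ ^ 2)) := by
  intro x hx
  have hi := (intervalIntegrable_coeff hσ (1 + ‖μ‖)).const_mul 2
  have h := norm_sub_add_norm_sub_le hy.1 hy.2 (g := fun _ => 0)
    (h := fun x => 2 * ((1 + ‖μ‖) + ‖σ x‖ + ‖σ x‖ ^ 2)) (fun x => by positivity) hi
    (fun _ => le_rfl) (continuous_const.intervalIntegrable _ _) (fun t _ => by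
      simpa using norm_system_le (σ := σ t) (μ := μ) (p := y t) (q := y1 t) (e := 0) (e1 := 0)) x hx
  simp only [intervalIntegral.integral_zero, add_zero, intervalIntegral.integral_const_mul] at h
  refine h.trans ?_
  gcongr
  exact integral_coeff_le hσ _ (by positivity)

theorem SLSol.eq_zero {σ : ℝ → ℂ} (hσ : MemL2 σ) {μ : ℂ} {y y1 : ℝ → ℂ} (hy : SLSol σ μ y y1)
    (h0 : y 0 = 0) (h1 : y1 0 = 0) {x : ℝ} (hx : x ∈ Set.Icc 0 Real.pi) : y x = 0 ∧ y1 x = 0 := by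
  have h := hy.norm_le hσ x hx
  rw [h0, h1] at h
  simp only [norm_zero, add_zero, zero_mul] at h
  exact ⟨norm_le_zero_iff.1 (by linarith [norm_nonneg (y1 x)]),
    norm_le_zero_iff.1 (by linarith [norm_nonneg (y x)])⟩

theorem SLSol.unique {σ : ℝ → ℂ} (hσ : MemL2 σ) {μ : ℂ} {y y1 z z1 : ℝ → ℂ} (hy : SLSol σ μ y y1)
    (hz : SLSol σ μ z z1) (h0 : y 0 = z 0) (h1 : y1 0 = z1 0) {x : ℝ}
    (hx : x ∈ Set.Icc 0 Real.pi) : y x = z x ∧ y1 x = z1 x := by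
  have h := (hy.linear hz 1 (-1)).eq_zero hσ (by rw [h0]; ring) (by rw [h1]; ring) hx
  constructor
  · linear_combination h.1
  · linear_combination h.2

/-! ### Lipschitz dependence of `φ` and `Δ` on the problem and the spectral parameter -/

section phi

variable {σ : ℝ → ℂ}

/-- Existence of a solution is what makes the choice in `slPhiPair` meaningful. -/
theorem slPhi_spec (hσ : MemL2 σ) (μ : ℂ) :
    SLSol σ μ (fun x => slPhi σ x μ) (fun x => slPhiQuasi σ x μ) ∧
      slPhi σ 0 μ = 1 ∧ slPhiQuasi σ 0 μ = 0 := by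
  have h : ∃ u : (ℝ → ℂ) × (ℝ → ℂ), IsSLSolution σ μ u.1 u.2 ∧ u.1 0 = 1 ∧ u.2 0 = 0 := by
    obtain ⟨y, y1, h1, h2, h3⟩ := exists_slSol hσ μ 1 0
    exact ⟨(y, y1), (isSLSolution_iff hσ).2 h1, h2, h3⟩
  have := Classical.epsilon_spec h
  exact ⟨(isSLSolution_iff hσ).1 this.1, this.2⟩

theorem slPhi_continuousOn (hσ : MemL2 σ) (μ : ℂ) :
    ContinuousOn (fun x => slPhi σ x μ) (Set.Icc 0 Real.pi) := (slPhi_spec hσ μ).1.1.continuousOn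

theorem slPhi_norm_le (hσ : MemL2 σ) {μ : ℂ} {S R : ℝ} (hS : l2norm σ ≤ S) (hR : ‖μ‖ ≤ R) :
    ∀ x ∈ Set.Icc 0 Real.pi, ‖slPhi σ x μ‖ + ‖slPhiQuasi σ x μ‖ ≤
      Real.exp (2 * (4 * (1 + R) + 2 * S + S ^ 2)) := by
  intro x hx
  obtain ⟨h1, h2, h3⟩ := slPhi_spec hσ μ
  have h := h1.norm_le hσ x hx
  have hn := l2norm_nonneg σ
  simp only [h2, h3, norm_one, norm_zero, add_zero, one_mul] at h
  exact h.trans (by gcongr)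

/-- Lipschitz dependence of `φ` on the potential and on the spectral parameter. -/
theorem slPhi_sub_le (S R : ℝ) (hS : 0 ≤ S) : ∃ C > 0, ∀ σ τ : ℝ → ℂ, MemL2 σ →
    MemL2 τ → l2norm σ ≤ S → l2norm τ ≤ S → ∀ μ ν : ℂ, ‖μ‖ ≤ R → ‖ν‖ ≤ R →
    ∀ x ∈ Set.Icc 0 Real.pi,
      ‖slPhi τ x ν - slPhi σ x μ‖ + ‖slPhiQuasi τ x ν - slPhiQuasi σ x μ‖ ≤
        C * (l2norm (fun x => τ x - σ x) + ‖ν - μ‖) := by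
  set B := Real.exp (2 * (4 * (1 + R) + 2 * S + S ^ 2)) with hB
  have hBpos : 0 < B := Real.exp_pos _
  refine ⟨(B * (8 + 2 * S)) * B, by positivity, ?_⟩
  intro σ τ hσ hτ hσS hτS μ ν hμ hν x hx
  obtain ⟨⟨hφ, hφ1⟩, hφ0, hφ10⟩ := slPhi_spec hσ μ
  obtain ⟨⟨hψ, hψ1⟩, hψ0, hψ10⟩ := slPhi_spec hτ ν
  have hbd := slPhi_norm_le hσ hσS hμ
  have hd : MemL2 fun x => τ x - σ x := hτ.sub hσ
  -- The difference solves the system of `τ` at `ν`, with a forcing made of `τ - σ`, `τ² - σ²` and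
  -- `ν - μ` times the solution for `σ`, which `B` bounds.
  set g : ℝ → ℝ := fun t => B * (2 * ‖τ t - σ t‖ + ‖τ t ^ 2 - σ t ^ 2‖ + ‖ν - μ‖) with hg
  have hgi1 : IntervalIntegrable (fun t => 2 * ‖τ t - σ t‖) volume 0 Real.pi :=
    (hd.intervalIntegrable.norm).const_mul 2
  have hgi2 : IntervalIntegrable (fun t => ‖τ t ^ 2 - σ t ^ 2‖) volume 0 Real.pi :=
    (hτ.intervalIntegrable_sq.sub hσ.intervalIntegrable_sq).norm
  have hgi : IntervalIntegrable g volume 0 Real.pi :=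
    ((hgi1.add hgi2).add (continuous_const.intervalIntegrable _ _)).const_mul B
  have hgint : ∫ t in (0 : ℝ)..Real.pi, g t ≤
      (B * (8 + 2 * S)) * (l2norm (fun x => τ x - σ x) + ‖ν - μ‖) := by
    simp only [hg]
    rw [intervalIntegral.integral_const_mul, intervalIntegral.integral_add (hgi1.add hgi2)
      (continuous_const.intervalIntegrable _ _), intervalIntegral.integral_add hgi1 hgi2,
      intervalIntegral.integral_const_mul, intervalIntegral.integral_const, smul_eq_mul, sub_zero,
      mul_assoc]
    have h1 := integral_norm_le hd
    have h2 := integral_norm_sq_sub_sq_le hτ hσ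
    have h3 := l2norm_nonneg (fun x => τ x - σ x)
    have h4 := norm_nonneg (ν - μ)
    refine mul_le_mul_of_nonneg_left ?_ hBpos.le
    have h5 : l2norm (fun x => τ x - σ x) * (l2norm τ + l2norm σ) ≤
      l2norm (fun x => τ x - σ x) * (2 * S) := mul_le_mul_of_nonneg_left (by linarith) h3
    have h1' : ∫ t in (0 : ℝ)..Real.pi, ‖τ t - σ t‖ ≤ 2 * l2norm (fun x => τ x - σ x) := h1
    nlinarith [Real.pi_lt_four, mul_nonneg hS h4]
  have key := norm_sub_add_norm_sub_le (hψ.sub hφ) (hψ1.sub hφ1) (g := g)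
    (h := fun x => 2 * ((1 + ‖ν‖) + ‖τ x‖ + ‖τ x‖ ^ 2)) (fun x => by positivity)
    ((intervalIntegrable_coeff hτ _).const_mul 2) (fun t => by positivity) hgi (fun t ht => by
      have h1 := norm_system_le (σ := τ t) (μ := ν) (p := slPhi τ t ν - slPhi σ t μ)
        (q := slPhiQuasi τ t ν - slPhiQuasi σ t μ) (e := (τ t - σ t) * slPhi σ t μ)
        (e1 := -((τ t - σ t) * slPhiQuasi σ t μ) - (τ t ^ 2 - σ t ^ 2) * slPhi σ t μ -
          (ν - μ) * slPhi σ t μ)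
      have h2 := hbd t ht
      have hp := norm_nonneg (slPhi σ t μ)
      have hq := norm_nonneg (slPhiQuasi σ t μ)
      have h3 : ‖(τ t - σ t) * slPhi σ t μ‖ ≤ ‖τ t - σ t‖ * B := by
        rw [norm_mul]; gcongr; linarith
      have h4 : ‖-((τ t - σ t) * slPhiQuasi σ t μ) - (τ t ^ 2 - σ t ^ 2) * slPhi σ t μ -
          (ν - μ) * slPhi σ t μ‖ ≤
          ‖τ t - σ t‖ * B + ‖τ t ^ 2 - σ t ^ 2‖ * B + ‖ν - μ‖ * B := by
        refine (norm_sub_le _ _).trans (add_le_add ((norm_sub_le _ _).trans (add_le_add ?_ ?_)) ?_)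
        · rw [norm_neg, norm_mul]; gcongr; linarith
        · rw [norm_mul]; gcongr; linarith
        · rw [norm_mul]; gcongr; linarith
      refine le_trans (le_of_eq ?_) (h1.trans ?_)
      · congr 2 <;> ring
      · simp only [hg]; linarith) x hx
  simp only [hφ0, hψ0, hφ10, hψ10, sub_self, norm_zero, zero_add,
    intervalIntegral.integral_const_mul] at key
  refine key.trans ?_
  have hn := l2norm_nonneg τ
  have h1 := integral_coeff_le hτ (1 + ‖ν‖) (by positivity)
  have h2 : Real.exp (2 * ∫ x in (0 : ℝ)..Real.pi, ((1 + ‖ν‖) + ‖τ x‖ + ‖τ x‖ ^ 2)) ≤ B := by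
    rw [hB]
    gcongr
    refine h1.trans ?_
    gcongr
  calc _ ≤ ((B * (8 + 2 * S)) * (l2norm (fun x => τ x - σ x) + ‖ν - μ‖)) * B := by
        have := l2norm_nonneg (fun x => τ x - σ x)
        exact mul_le_mul hgint h2 (Real.exp_pos _).le (by positivity)
    _ = _ := by ring

end phi

theorem norm_integral_le_four_mul {f : ℝ → ℂ} {B : ℝ} (hf : ∀ x ∈ Set.Icc 0 Real.pi, ‖f x‖ ≤ B) :
    ‖∫ x in (0 : ℝ)..Real.pi, f x‖ ≤ 4 * B := by
  have hB : 0 ≤ B := (norm_nonneg _).trans (hf 0 mem_Icc_zero)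
  have h := intervalIntegral.norm_integral_le_of_norm_le_const (a := 0) (b := Real.pi) (f := f)
    (C := B) fun x hx => by
      rw [Set.uIoc_of_le Real.pi_pos.le] at hx
      exact hf x ⟨hx.1.le, hx.2⟩
  rw [sub_zero, abs_of_pos Real.pi_pos] at h
  nlinarith [Real.pi_lt_four]

theorem intervalIntegrable_of_continuousOn {f : ℝ → ℂ} (hf : ContinuousOn f (Set.Icc 0 Real.pi)) :
    IntervalIntegrable f volume 0 Real.pi := by
  rw [← Set.uIcc_of_le Real.pi_pos.le] at hf
  exact hf.intervalIntegrable

/-- Two independent spectral parameters are allowed because products of `φ` at two different zeros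
appear in the uniqueness argument. -/
theorem integral_phi_mul_sub_le (S R : ℝ) (hS : 0 ≤ S) : ∃ C > 0, ∀ σ τ : ℝ → ℂ,
    MemL2 σ → MemL2 τ → l2norm σ ≤ S → l2norm τ ≤ S → ∀ μ ν μ' ν' : ℂ, ‖μ‖ ≤ R → ‖ν‖ ≤ R →
      ‖μ'‖ ≤ R → ‖ν'‖ ≤ R →
      ‖(∫ x in (0 : ℝ)..Real.pi, slPhi τ x ν * slPhi τ x ν') -
        ∫ x in (0 : ℝ)..Real.pi, slPhi σ x μ * slPhi σ x μ'‖ ≤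
        C * (l2norm (fun x => τ x - σ x) + ‖ν - μ‖ + ‖ν' - μ'‖) := by
  obtain ⟨C, hC, h⟩ := slPhi_sub_le S R hS
  set B := Real.exp (2 * (4 * (1 + R) + 2 * S + S ^ 2))
  have hBpos : 0 < B := Real.exp_pos _
  refine ⟨8 * B * C, by positivity, fun σ τ hσ hτ hσS hτS μ ν μ' ν' hμ hν hμ' hν' => ?_⟩
  rw [← intervalIntegral.integral_sub (intervalIntegrable_of_continuousOn
    ((slPhi_continuousOn hτ ν).fun_mul (slPhi_continuousOn hτ ν'))) (intervalIntegrable_of_continuousOn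
    ((slPhi_continuousOn hσ μ).fun_mul (slPhi_continuousOn hσ μ')))]
  have hn := l2norm_nonneg (fun x => τ x - σ x)
  have hb := norm_nonneg (ν - μ)
  have hb' := norm_nonneg (ν' - μ')
  refine (norm_integral_le_four_mul (B := 2 * B * C *
    (l2norm (fun x => τ x - σ x) + ‖ν - μ‖ + ‖ν' - μ'‖)) fun x hx => ?_).trans (le_of_eq (by ring))
  have h1 := h σ τ hσ hτ hσS hτS μ ν hμ hν x hx
  have h2 := h σ τ hσ hτ hσS hτS μ' ν' hμ' hν' x hx
  have h3 := slPhi_norm_le hτ hτS hν' x hx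
  have h4 := slPhi_norm_le hσ hσS hμ x hx
  have e : slPhi τ x ν * slPhi τ x ν' - slPhi σ x μ * slPhi σ x μ' =
    (slPhi τ x ν - slPhi σ x μ) * slPhi τ x ν' + slPhi σ x μ * (slPhi τ x ν' - slPhi σ x μ') := by
    ring
  rw [e]
  refine (norm_add_le _ _).trans ?_
  rw [norm_mul, norm_mul]
  have h5 : ‖slPhi τ x ν - slPhi σ x μ‖ * ‖slPhi τ x ν'‖ ≤
      (C * (l2norm (fun x => τ x - σ x) + ‖ν - μ‖ + ‖ν' - μ'‖)) * B := by
    refine mul_le_mul ?_ (by linarith [norm_nonneg (slPhiQuasi τ x ν')]) (norm_nonneg _)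
      (by positivity)
    nlinarith [norm_nonneg (slPhiQuasi τ x ν - slPhiQuasi σ x μ)]
  have h6 : ‖slPhi σ x μ‖ * ‖slPhi τ x ν' - slPhi σ x μ'‖ ≤
      B * (C * (l2norm (fun x => τ x - σ x) + ‖ν - μ‖ + ‖ν' - μ'‖)) := by
    refine mul_le_mul (by linarith [norm_nonneg (slPhiQuasi σ x μ)]) ?_ (norm_nonneg _)
      (by positivity)
    nlinarith [norm_nonneg (slPhiQuasi τ x ν' - slPhiQuasi σ x μ')]
  linarith

theorem slCharFun_sub_le (S R : ℝ) (hS : 0 ≤ S) : ∃ C > 0, ∀ σ τ : ℝ → ℂ,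
    MemL2 σ → MemL2 τ → l2norm σ ≤ S → l2norm τ ≤ S → ∀ H H' μ ν : ℂ, ‖H'‖ ≤ S →
      ‖μ‖ ≤ R → ‖ν‖ ≤ R →
      ‖slCharFun τ H' ν - slCharFun σ H μ‖ ≤
        C * (l2norm (fun x => τ x - σ x) + ‖H' - H‖ + ‖ν - μ‖) := by
  obtain ⟨C, hC, h⟩ := slPhi_sub_le S R hS
  set B := Real.exp (2 * (4 * (1 + R) + 2 * S + S ^ 2))
  have hBpos : 0 < B := Real.exp_pos _
  refine ⟨(1 + S) * C + B, by positivity, fun σ τ hσ hτ hσS hτS H H' μ ν hH' hμ hν => ?_⟩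
  have h1 := h σ τ hσ hτ hσS hτS μ ν hμ hν Real.pi mem_Icc_pi
  have h4 := slPhi_norm_le hσ hσS hμ Real.pi mem_Icc_pi
  have hn := l2norm_nonneg (fun x => τ x - σ x)
  have hb := norm_nonneg (ν - μ)
  have hb' := norm_nonneg (H' - H)
  have e : slCharFun τ H' ν - slCharFun σ H μ =
      (slPhiQuasi τ Real.pi ν - slPhiQuasi σ Real.pi μ) +
      H' * (slPhi τ Real.pi ν - slPhi σ Real.pi μ) + (H' - H) * slPhi σ Real.pi μ := by
    unfold slCharFun; ring
  rw [e]
  refine norm_add₃_le.trans ?_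
  rw [norm_mul, norm_mul]
  have p1 := norm_nonneg (slPhiQuasi τ Real.pi ν - slPhiQuasi σ Real.pi μ)
  have p2 := norm_nonneg (slPhi τ Real.pi ν - slPhi σ Real.pi μ)
  have p3 := norm_nonneg (slPhiQuasi σ Real.pi μ)
  have h5 : ‖H'‖ * ‖slPhi τ Real.pi ν - slPhi σ Real.pi μ‖ ≤
      S * (C * (l2norm (fun x => τ x - σ x) + ‖ν - μ‖)) :=
    mul_le_mul hH' (by linarith) p2 hS
  have h6 : ‖H' - H‖ * ‖slPhi σ Real.pi μ‖ ≤ ‖H' - H‖ * B :=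
    mul_le_mul_of_nonneg_left (by linarith) hb'
  have h7 : 0 ≤ (1 + S) * C * ‖H' - H‖ := by positivity
  have h8 : 0 ≤ B * (l2norm (fun x => τ x - σ x) + ‖ν - μ‖) := by positivity
  nlinarith

/-! ### The characteristic function and Lagrange's identity -/

section char

variable {σ : ℝ → ℂ}

/-- Solutions with prescribed values at the right end, together with the value at the left end of
their quasi-derivative. -/
theorem exists_slSol_right (hσ : MemL2 σ) (H μ : ℂ) : ∃ z z1, SLSol σ μ z z1 ∧
    z Real.pi = 1 ∧ z1 Real.pi = -H ∧ z1 0 = -slCharFun σ H μ := by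
  obtain ⟨h1, h2, h3⟩ := slPhi_spec hσ μ
  obtain ⟨t, t1, ht, ht0, ht10⟩ := exists_slSol hσ μ 0 1
  have hw := h1.lagrange_pi ht
  rw [sub_self, zero_mul, ht0, ht10, h2, h3] at hw
  -- The Wronskian of `φ` and the solution with initial data `(0, 1)` equals one (`hw`), and
  -- Cramer's rule gives the coefficients.
  refine ⟨_, _, h1.linear ht (t1 Real.pi + H * t Real.pi) (-slCharFun σ H μ), ?_, ?_, ?_⟩
  · simp only [slCharFun]; linear_combination -hw
  · simp only [slCharFun]; linear_combination H * hw
  · simp only [h3, ht10]; ring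

/-- If `φ(π)` vanished, so would `φ^{[1]}(π)`, and the Wronskian with a second solution could not be
the constant one. -/
theorem slPhi_pi_ne_zero (hσ : MemL2 σ) {H μ : ℂ} (h0 : slCharFun σ H μ = 0) :
    slPhi σ Real.pi μ ≠ 0 := by
  intro h
  have hq : slPhiQuasi σ Real.pi μ = 0 := by
    rw [slCharFun, h] at h0
    simpa using h0
  obtain ⟨h1, h2, h3⟩ := slPhi_spec hσ μ
  obtain ⟨t, t1, ht, ht0, ht10⟩ := exists_slSol hσ μ 0 1
  have hw := h1.lagrange_pi ht
  rw [sub_self, zero_mul, ht0, ht10, h2, h3, h, hq] at hw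
  norm_num at hw

/-- Lagrange's identity with the boundary term at `π` simplified by `Δ(μ) = 0`. A nonzero integral
forces two zeros to coincide, and a lower bound for it turns smallness of `Δ(l)` into closeness of
`l` to `μ`. -/
theorem integral_phi_mul_phi (hσ : MemL2 σ) {H μ : ℂ} (h0 : slCharFun σ H μ = 0) (l : ℂ) :
    (l - μ) * ∫ x in (0 : ℝ)..Real.pi, slPhi σ x l * slPhi σ x μ =
      -slPhi σ Real.pi μ * slCharFun σ H l := by
  obtain ⟨h1, h2, h3⟩ := slPhi_spec hσ μ
  obtain ⟨g1, g2, g3⟩ := slPhi_spec hσ l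
  rw [g1.lagrange_pi h1, h2, h3, g2, g3]
  unfold slCharFun at *
  linear_combination slPhi σ Real.pi l * h0

/-- Lagrange's identity against the solution `z` normalised at `π` writes the difference quotient
exactly as `-∫ φ(x,l) z(x) dx`, which has a limit as `l → μ`. -/
theorem slCharFun_differentiable (hσ : MemL2 σ) (H : ℂ) : Differentiable ℂ (slCharFun σ H) := by
  intro μ
  obtain ⟨z, z1, hz, hz1, hz2, hz3⟩ := exists_slSol_right hσ H μ
  have hzc := hz.1.continuousOn
  obtain ⟨M, hM⟩ := isCompact_Icc.exists_bound_of_continuousOn hzc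
  have key : ∀ l, slCharFun σ H l - slCharFun σ H μ =
      (l - μ) * -∫ x in (0 : ℝ)..Real.pi, slPhi σ x l * z x := by
    intro l
    obtain ⟨g1, g2, g3⟩ := slPhi_spec hσ l
    have h := g1.lagrange_pi hz
    rw [hz1, hz2, hz3, g2, g3] at h
    rw [mul_neg, h]
    simp only [slCharFun]
    ring
  suffices HasDerivAt (slCharFun σ H) (-∫ x in (0 : ℝ)..Real.pi, slPhi σ x μ * z x) μ from
    this.differentiableAt
  rw [hasDerivAt_iff_tendsto_slope]
  have hs : ∀ l ∈ ({μ}ᶜ : Set ℂ), -∫ x in (0 : ℝ)..Real.pi, slPhi σ x l * z x =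
      slope (slCharFun σ H) μ l := by
    intro l hl
    rw [slope_def_field, key l, mul_comm, mul_div_assoc, div_self (sub_ne_zero.2 hl), mul_one]
  refine Tendsto.congr' (eventually_nhdsWithin_of_forall hs) ?_
  refine Tendsto.mono_left (Tendsto.neg ?_) nhdsWithin_le_nhds
  obtain ⟨C, hC, h⟩ := slPhi_sub_le (l2norm σ) (‖μ‖ + 1) (l2norm_nonneg _)
  rw [tendsto_iff_norm_sub_tendsto_zero]
  have hlim : Tendsto (fun l : ℂ => 4 * (C * ‖l - μ‖ * M)) (𝓝 μ) (𝓝 0) := by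
    have : Continuous fun l : ℂ => 4 * (C * ‖l - μ‖ * M) := by fun_prop
    simpa using this.tendsto μ
  refine squeeze_zero' (Eventually.of_forall fun _ => norm_nonneg _) ?_ hlim
  filter_upwards [Metric.ball_mem_nhds μ one_pos] with l hl
  rw [← intervalIntegral.integral_sub
    (intervalIntegrable_of_continuousOn ((slPhi_continuousOn hσ l).fun_mul hzc))
    (intervalIntegrable_of_continuousOn ((slPhi_continuousOn hσ μ).fun_mul hzc))]
  refine norm_integral_le_four_mul fun x hx => ?_
  have hl' : ‖l‖ ≤ ‖μ‖ + 1 := by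
    rw [Metric.mem_ball, dist_eq_norm] at hl
    linarith [norm_le_norm_add_norm_sub' l μ]
  have h1 := h σ σ hσ hσ le_rfl le_rfl μ l (by linarith) hl' x hx
  have h2 : l2norm (fun x => σ x - σ x) = 0 := by simp [l2norm]
  rw [h2, zero_add] at h1
  rw [← sub_mul, norm_mul]
  exact mul_le_mul (by linarith [norm_nonneg (slPhiQuasi σ x l - slPhiQuasi σ x μ)]) (hM x hx)
    (norm_nonneg _) (by positivity)

theorem isSLEigenvalue_iff (hσ : MemL2 σ) {H μ : ℂ} :
    IsSLEigenvalue σ H μ ↔ slCharFun σ H μ = 0 := by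
  obtain ⟨h1, h2, h3⟩ := slPhi_spec hσ μ
  constructor
  · rintro ⟨y, y1, hy, hy0, hypi, x, hx, hyx⟩
    rw [isSLSolution_iff hσ] at hy
    have hu : ∀ x ∈ Set.Icc 0 Real.pi, _ := fun x hx =>
      hy.unique hσ (h1.linear h1 (y 0) 0) (by simp only [h2]; ring)
        (by simp only [h3, hy0]; ring) hx
    simp only [zero_mul, add_zero] at hu
    have hne : y 0 ≠ 0 := by
      intro h0
      apply hyx
      rw [(hu x hx).1, h0, zero_mul]
    have h4 := hu Real.pi mem_Icc_pi
    rw [h4.1, h4.2] at hypi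
    have : y 0 * slCharFun σ H μ = 0 := by
      unfold slCharFun; linear_combination hypi
    exact (mul_eq_zero.1 this).resolve_left hne
  · intro h
    exact ⟨_, _, (isSLSolution_iff hσ).2 h1, h3, h, 0, mem_Icc_zero, by simp [h2]⟩

/-- Dividing `integral_phi_mul_phi` by `l - μ` and letting `l → μ` gives `∫ φ² = -φ(π,μ) Δ'(μ)`;
neither factor vanishes at a simple zero. Here `g μ` plays the part of `Δ'(μ)`. -/
theorem integral_phi_sq_ne_zero (hσ : MemL2 σ) {H μ : ℂ}
    (h0 : slCharFun σ H μ = 0) (h1 : analyticOrderAt (slCharFun σ H) μ = 1) :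
    ∫ x in (0 : ℝ)..Real.pi, slPhi σ x μ ^ 2 ≠ 0 := by
  intro hint
  have han : AnalyticAt ℂ (slCharFun σ H) μ := (slCharFun_differentiable hσ H).analyticAt μ
  obtain ⟨g, hg, hg0, hgeq⟩ := (han.analyticOrderAt_eq_natCast (n := 1)).1 (by simpa using h1)
  apply hg0
  have hlim : Tendsto (fun l => -slPhi σ Real.pi μ * g l) (𝓝[≠] μ)
      (𝓝 (-slPhi σ Real.pi μ * g μ)) :=
    (tendsto_const_nhds.mul hg.continuousAt.tendsto).mono_left nhdsWithin_le_nhds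
  obtain ⟨C, hC, h⟩ := integral_phi_mul_sub_le (l2norm σ) (‖μ‖ + 1) (l2norm_nonneg _)
  have h2 : l2norm (fun x => σ x - σ x) = 0 := by simp [l2norm]
  have hlim2 : Tendsto (fun l => -slPhi σ Real.pi μ * g l) (𝓝[≠] μ) (𝓝 0) := by
    have hz : Tendsto (fun l : ℂ => C * ‖l - μ‖) (𝓝[≠] μ) (𝓝 0) := by
      have : Continuous fun l : ℂ => C * ‖l - μ‖ := by fun_prop
      have := this.tendsto μ
      simp only [sub_self, norm_zero, mul_zero] at this
      exact this.mono_left nhdsWithin_le_nhds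
    refine squeeze_zero_norm' ?_ hz
    filter_upwards [nhdsWithin_le_nhds hgeq, self_mem_nhdsWithin,
      nhdsWithin_le_nhds (Metric.ball_mem_nhds μ one_pos)] with l hl hlne hlb
    have hl' : ‖l‖ ≤ ‖μ‖ + 1 := by
      rw [Metric.mem_ball, dist_eq_norm] at hlb
      linarith [norm_le_norm_add_norm_sub' l μ]
    have h3 := integral_phi_mul_phi hσ h0 l
    rw [hl, pow_one, smul_eq_mul] at h3
    have h4 : -slPhi σ Real.pi μ * g l = ∫ x in (0 : ℝ)..Real.pi, slPhi σ x l * slPhi σ x μ :=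
      mul_left_cancel₀ (sub_ne_zero.2 hlne) (by linear_combination -h3)
    have h5 := h σ σ hσ hσ le_rfl le_rfl μ l μ μ (by linarith) hl' (by linarith) (by linarith)
    simp only [← sq, hint, sub_zero, h2, sub_self μ, norm_zero, add_zero, zero_add] at h5
    rw [h4]
    exact h5
  have := tendsto_nhds_unique hlim hlim2
  exact (mul_eq_zero.1 this).resolve_left (neg_ne_zero.2 (slPhi_pi_ne_zero hσ h0))

theorem IsPrim.conj {f f' g' : ℝ → ℂ} (hf : IsPrim f f')
    (h : ∀ᵐ x ∂(volume.restrict (Set.Ioo 0 Real.pi)), g' x = (starRingEnd ℂ) (f' x)) :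
    IsPrim (fun x => (starRingEnd ℂ) (f x)) g' := by
  have hi : IntervalIntegrable (fun x => (starRingEnd ℂ) (f' x)) volume 0 Real.pi := by
    rw [intervalIntegrable_iff_Ioo]
    exact Complex.conjCLE.toContinuousLinearMap.integrable_comp (intervalIntegrable_iff_Ioo.1 hf.1)
  refine ⟨intervalIntegrable_iff_Ioo.2 ((intervalIntegrable_iff_Ioo.1 hi).congr
    (h.mono fun _ hx => hx.symm)), fun x hx => ?_⟩
  have h1 : ∫ t in (0 : ℝ)..x, g' t = ∫ t in (0 : ℝ)..x, (starRingEnd ℂ) (f' t) := by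
    refine intervalIntegral.integral_congr_ae ?_
    filter_upwards [ae_Ioo_iff.1 h] with t ht ht'
    rw [Set.uIoc_of_le hx.1] at ht'
    exact ht ⟨ht'.1.le, ht'.2.trans hx.2⟩
  have h2 : ∫ t in (0 : ℝ)..x, (starRingEnd ℂ) (f' t) =
      (starRingEnd ℂ) (∫ t in (0 : ℝ)..x, f' t) := by
    rw [intervalIntegral.integral_of_le hx.1, intervalIntegral.integral_of_le hx.1, integral_conj]
  simp only
  rw [h1, h2, hf.2 x hx, map_add]

/-- With real coefficients, conjugation carries `φ(·, μ)` to a solution at the conjugate parameter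
with the same initial data. -/
theorem slCharFun_conj (hσ : MemL2 σ) {H : ℂ} (hreal : IsSLReal σ H) (μ : ℂ) :
    slCharFun σ H ((starRingEnd ℂ) μ) = (starRingEnd ℂ) (slCharFun σ H μ) := by
  obtain ⟨h1, h2, h3⟩ := slPhi_spec hσ μ
  obtain ⟨g1, g2, g3⟩ := slPhi_spec hσ ((starRingEnd ℂ) μ)
  have hc : SLSol σ ((starRingEnd ℂ) μ) (fun x => (starRingEnd ℂ) (slPhi σ x μ))
      (fun x => (starRingEnd ℂ) (slPhiQuasi σ x μ)) := by
    refine ⟨h1.1.conj ?_, h1.2.conj ?_⟩ <;>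
    · filter_upwards [hreal.1] with x hx
      have := Complex.conj_eq_iff_im.2 hx
      simp [this]
  have hH := Complex.conj_eq_iff_im.2 hreal.2
  obtain ⟨e1, e2⟩ := g1.unique hσ hc (by simp [g2, h2]) (by simp [g3, h3]) mem_Icc_pi
  unfold slCharFun
  rw [e1, e2, map_add, map_mul, hH]

end char

/-! ### Waves and their asymptotics for large `ρ` -/

theorem isPrim_cexp (c : ℂ) :
    IsPrim (fun x : ℝ => Complex.exp (c * x)) fun x : ℝ => c * Complex.exp (c * x) := by
  refine IsPrim.of_hasDerivAt (fun x => ?_) (by fun_prop)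
  have h : HasDerivAt (fun x : ℝ => c * (x : ℂ)) (c * 1) x :=
    (Complex.ofRealCLM.hasDerivAt (x := x)).const_mul c
  have := h.cexp
  simpa [mul_comm] using this

theorem norm_cexp_mul_le {c : ℂ} {k x : ℝ} (hc : |c.re| ≤ k) (hx : 0 ≤ x) :
    ‖Complex.exp (c * x)‖ ≤ Real.exp (k * x) := by
  rw [Complex.norm_exp]
  have : (c * (x : ℂ)).re = c.re * x := by simp
  rw [this]
  gcongr
  exact (le_abs_self _).trans hc

/-- The a priori estimate for the equation `f' = c f + r`. -/
theorem IsPrim.damped_le {f r : ℝ → ℂ} {c : ℂ} {k : ℝ} (hf : IsPrim f fun x => c * f x + r x)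
    (hr : IntervalIntegrable r volume 0 Real.pi) (hc : |c.re| ≤ k) {x : ℝ}
    (hx : x ∈ Set.Icc 0 Real.pi) :
    Real.exp (-k * x) * ‖f x‖ ≤ ‖f 0‖ + ∫ t in (0 : ℝ)..x, Real.exp (-k * t) * ‖r t‖ := by
  have h1 := ((isPrim_cexp (-c)).mul hf).congr_deriv (g' := fun t => Complex.exp (-c * t) * r t)
    fun t _ => by ring
  have h2 := h1.2 x hx
  simp only [Complex.ofReal_zero, mul_zero, Complex.exp_zero, one_mul] at h2
  have h3 : f x = Complex.exp (c * x) * f 0 +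
      ∫ t in (0 : ℝ)..x, Complex.exp (c * x) * (Complex.exp (-c * t) * r t) := by
    rw [intervalIntegral.integral_const_mul, ← mul_add, ← h2, ← mul_assoc, ← Complex.exp_add]
    simp
  have hk : Real.exp (-k * x) * Real.exp (k * x) = 1 := by rw [← Real.exp_add]; simp
  have hI : IntervalIntegrable (fun t => Real.exp (-k * t) * ‖r t‖) volume 0 x :=
    (hr.mono_set (uIcc_subset_of_mem hx)).norm.continuousOn_mul (by fun_prop)
  have h4 : ‖∫ t in (0 : ℝ)..x, Complex.exp (c * x) * (Complex.exp (-c * t) * r t)‖ ≤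
      ∫ t in (0 : ℝ)..x, Real.exp (k * x) * (Real.exp (-k * t) * ‖r t‖) := by
    refine intervalIntegral.norm_integral_le_of_norm_le hx.1 (Eventually.of_forall fun t ht => ?_)
      (hI.const_mul _)
    rw [← mul_assoc, ← mul_assoc, ← Complex.exp_add, ← Real.exp_add, norm_mul]
    refine mul_le_mul_of_nonneg_right ?_ (norm_nonneg _)
    have : c * x + -c * t = c * ((x - t : ℝ) : ℂ) := by push_cast; ring
    rw [this]
    refine (norm_cexp_mul_le hc (by linarith [ht.2])).trans (le_of_eq ?_)
    ring_nf
  rw [intervalIntegral.integral_const_mul (Real.exp (k * x))] at h4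
  have h5 : ‖f x‖ ≤ Real.exp (k * x) * ‖f 0‖ +
      Real.exp (k * x) * ∫ t in (0 : ℝ)..x, Real.exp (-k * t) * ‖r t‖ := by
    rw [h3]
    refine (norm_add_le _ _).trans (add_le_add ?_ h4)
    rw [norm_mul]
    exact mul_le_mul_of_nonneg_right (norm_cexp_mul_le hc hx.1) (norm_nonneg _)
  calc _ ≤ Real.exp (-k * x) * (Real.exp (k * x) * ‖f 0‖ +
      Real.exp (k * x) * ∫ t in (0 : ℝ)..x, Real.exp (-k * t) * ‖r t‖) := by gcongr
    _ = _ := by rw [← mul_add, ← mul_assoc, hk, one_mul]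

/-- The combination `φ + i ρ⁻¹ φ^{[1]}` at `λ = ρ²`; its companion is obtained from `-ρ`. -/
noncomputable def slWave (σ : ℝ → ℂ) (ρ : ℂ) (x : ℝ) : ℂ :=
  slPhi σ x (ρ ^ 2) + Complex.I / ρ * slPhiQuasi σ x (ρ ^ 2)

theorem slPhi_eq_wave (σ : ℝ → ℂ) (ρ : ℂ) (x : ℝ) :
    slPhi σ x (ρ ^ 2) = (slWave σ ρ x + slWave σ (-ρ) x) / 2 := by
  simp only [slWave, neg_sq, div_neg]; ring

theorem slPhiQuasi_eq_wave (σ : ℝ → ℂ) {ρ : ℂ} (hρ : ρ ≠ 0) (x : ℝ) :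
    slPhiQuasi σ x (ρ ^ 2) = ρ * ((slWave σ ρ x - slWave σ (-ρ) x) / (2 * Complex.I)) := by
  simp only [slWave, neg_sq, div_neg]
  field_simp
  ring

theorem slWave_zero {σ : ℝ → ℂ} (hσ : MemL2 σ) (ρ : ℂ) : slWave σ ρ 0 = 1 := by
  obtain ⟨-, h2, h3⟩ := slPhi_spec hσ (ρ ^ 2)
  simp [slWave, h2, h3]

/-- The remainder in the equation for `slWave`. -/
noncomputable def slWaveRem (σ : ℝ → ℂ) (ρ : ℂ) (x : ℝ) : ℂ :=
  σ x * slWave σ (-ρ) x -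
    Complex.I * σ x ^ 2 / (2 * ρ) * (slWave σ ρ x + slWave σ (-ρ) x)

/-- The reason for introducing the waves: the equation is diagonal up to `slWaveRem`, in which `σ`
multiplies only the companion and `σ²` carries `1/ρ`. -/
theorem slWave_isPrim {σ : ℝ → ℂ} (hσ : MemL2 σ) {ρ : ℂ} (hρ : ρ ≠ 0) :
    IsPrim (slWave σ ρ) fun x => -(Complex.I * ρ) * slWave σ ρ x + slWaveRem σ ρ x := by
  obtain ⟨⟨h1, h2⟩, -, -⟩ := slPhi_spec hσ (ρ ^ 2)
  refine (h1.add (h2.const_mul (Complex.I / ρ))).congr_deriv fun x _ => ?_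
  simp only [slWaveRem, slWave, neg_sq, div_neg]
  field_simp
  ring_nf
  simp only [Complex.I_sq]
  ring

theorem slWave_continuousOn {σ : ℝ → ℂ} (hσ : MemL2 σ) (ρ : ℂ) :
    ContinuousOn (slWave σ ρ) (Set.Icc 0 Real.pi) := by
  obtain ⟨⟨h1, h2⟩, -, -⟩ := slPhi_spec hσ (ρ ^ 2)
  exact (h1.add (h2.const_mul (Complex.I / ρ))).continuousOn

theorem slWaveRem_intervalIntegrable {σ : ℝ → ℂ} (hσ : MemL2 σ) (ρ : ℂ) :
    IntervalIntegrable (slWaveRem σ ρ) volume 0 Real.pi := by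
  have h1 := slWave_continuousOn hσ ρ
  have h2 := slWave_continuousOn hσ (-ρ)
  rw [← Set.uIcc_of_le Real.pi_pos.le] at h1 h2
  refine (hσ.intervalIntegrable.mul_continuousOn h2).sub ?_
  exact ((hσ.intervalIntegrable_sq.const_mul Complex.I).div_const (2 * ρ)).mul_continuousOn
    (h1.add h2)

theorem slWaveRem_norm_le {σ : ℝ → ℂ} {ρ : ℂ} (hρ : 1 / 2 ≤ ‖ρ‖) (x : ℝ) :
    ‖slWaveRem σ ρ x‖ ≤ (‖σ x‖ + ‖σ x‖ ^ 2) * (‖slWave σ ρ x‖ + ‖slWave σ (-ρ) x‖) := by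
  have h1 : ‖Complex.I * σ x ^ 2 / (2 * ρ)‖ ≤ ‖σ x‖ ^ 2 := by
    rw [norm_div, norm_mul, norm_mul, norm_pow, Complex.norm_I, one_mul, Complex.norm_two]
    exact div_le_self (by positivity) (by linarith)
  have h2 := norm_nonneg (slWave σ ρ x)
  have h3 := norm_nonneg (slWave σ (-ρ) x)
  calc _ ≤ ‖σ x‖ * ‖slWave σ (-ρ) x‖ +
      ‖σ x‖ ^ 2 * (‖slWave σ ρ x‖ + ‖slWave σ (-ρ) x‖) := by
        refine (norm_sub_le _ _).trans ?_
        rw [norm_mul, norm_mul]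
        gcongr
        exact norm_add_le _ _
    _ ≤ _ := by nlinarith [mul_nonneg (norm_nonneg (σ x)) h2]

theorem abs_re_I_mul (ρ : ℂ) : |(-(Complex.I * ρ)).re| ≤ |ρ.im| := by simp

/-- A priori bound for the waves. -/
theorem slWave_norm_le {σ : ℝ → ℂ} (hσ : MemL2 σ) {S : ℝ} (hS : l2norm σ ≤ S) {ρ : ℂ}
    (hρ : 1 / 2 ≤ ‖ρ‖) {x : ℝ} (hx : x ∈ Set.Icc 0 Real.pi) :
    ‖slWave σ ρ x‖ + ‖slWave σ (-ρ) x‖ ≤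
      2 * Real.exp (2 * (2 * S + S ^ 2)) * Real.exp (|ρ.im| * x) := by
  have hρ0 : ρ ≠ 0 := fun h => by simp [h] at hρ; linarith
  set k := |ρ.im|
  set E : ℝ → ℝ := fun x => Real.exp (-k * x) * (‖slWave σ ρ x‖ + ‖slWave σ (-ρ) x‖) with hE
  have hEc : ContinuousOn E (Set.Icc 0 Real.pi) :=
    ContinuousOn.mul (by fun_prop)
      ((slWave_continuousOn hσ ρ).norm.add (slWave_continuousOn hσ (-ρ)).norm)
  have hi : IntervalIntegrable (fun x => 2 * (0 + ‖σ x‖ + ‖σ x‖ ^ 2)) volume 0 Real.pi :=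
    (intervalIntegrable_coeff hσ 0).const_mul 2
  have hEc' := hEc
  rw [← Set.uIcc_of_le Real.pi_pos.le] at hEc'
  -- Both waves are damped by `exp(-|Im ρ| x)` before Grönwall is applied, so the remaining constant
  -- depends on `S` alone and not on `ρ`.
  have key := gronwall_integrable hEc (h := fun x => 2 * (0 + ‖σ x‖ + ‖σ x‖ ^ 2)) (c := 2)
    (fun x => by positivity) hi (fun y hy => by
      have hs := uIcc_subset_of_mem hy
      have hd : ∀ r : ℂ, 1 / 2 ≤ ‖r‖ → |r.im| = k → (∀ t, ‖slWave σ r t‖ + ‖slWave σ (-r) t‖ =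
          ‖slWave σ ρ t‖ + ‖slWave σ (-ρ) t‖) → Real.exp (-k * y) * ‖slWave σ r y‖ ≤
          1 + ∫ t in (0 : ℝ)..y, (0 + ‖σ t‖ + ‖σ t‖ ^ 2) * E t := by
        intro r hr hrk hsym
        have hr0 : r ≠ 0 := fun h => by simp [h] at hr; linarith
        have h1 := (slWave_isPrim hσ hr0).damped_le (slWaveRem_intervalIntegrable hσ r)
          ((abs_re_I_mul r).trans hrk.le) hy
        rw [slWave_zero hσ, norm_one] at h1
        refine h1.trans (add_le_add le_rfl ?_)
        refine intervalIntegral.integral_mono_on hy.1 ?_ ?_ fun t ht => ?_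
        · exact ((slWaveRem_intervalIntegrable hσ r).mono_set hs).norm.continuousOn_mul
            (by fun_prop)
        · exact ((intervalIntegrable_coeff hσ 0).mul_continuousOn hEc').mono_set hs
        · have h2 := slWaveRem_norm_le (σ := σ) hr t
          rw [hsym t] at h2
          simp only [hE]
          calc _ ≤ Real.exp (-k * t) * ((‖σ t‖ + ‖σ t‖ ^ 2) *
              (‖slWave σ ρ t‖ + ‖slWave σ (-ρ) t‖)) := by gcongr
            _ = _ := by ring
      have h1 := hd ρ hρ rfl fun t => rfl
      have h2 := hd (-ρ) (by rwa [norm_neg]) (by simp [k]) fun t => by rw [neg_neg, add_comm]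
      have h3 : ∫ t in (0 : ℝ)..y, 2 * (0 + ‖σ t‖ + ‖σ t‖ ^ 2) * E t =
          2 * ∫ t in (0 : ℝ)..y, (0 + ‖σ t‖ + ‖σ t‖ ^ 2) * E t := by
        rw [← intervalIntegral.integral_const_mul]
        congr 1; ext t; ring
      rw [h3]
      simp only [hE] at h1 h2 ⊢
      linarith) x hx
  have h1 : Real.exp (∫ t in (0 : ℝ)..x, 2 * (0 + ‖σ t‖ + ‖σ t‖ ^ 2)) ≤
      Real.exp (2 * (2 * S + S ^ 2)) := by
    gcongr
    refine (integral_mono_right (fun t => by positivity) hi hx).trans ?_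
    rw [intervalIntegral.integral_const_mul]
    have h2 := integral_coeff_le hσ 0 le_rfl
    have := l2norm_nonneg σ
    have : l2norm σ ^ 2 ≤ S ^ 2 := by gcongr
    linarith
  have hk : Real.exp (-k * x) * Real.exp (k * x) = 1 := by rw [← Real.exp_add]; simp
  have hp := Real.exp_pos (k * x)
  calc _ = E x * Real.exp (k * x) := by
        simp only [hE]
        linear_combination -(‖slWave σ ρ x‖ + ‖slWave σ (-ρ) x‖) * hk
    _ ≤ _ := by
        gcongr
        exact key.trans (by gcongr)

/-- The first term of the iteration series for `slWave`. -/
theorem isPrim_first_iterate {g : ℝ → ℂ} (hg : IntervalIntegrable g volume 0 Real.pi) (c : ℂ) :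
    IsPrim (fun x : ℝ => Complex.exp (-c * x) * ∫ t in (0 : ℝ)..x, Complex.exp (2 * c * t) * g t)
      fun x : ℝ => -c * (Complex.exp (-c * x) *
        ∫ t in (0 : ℝ)..x, Complex.exp (2 * c * t) * g t) + Complex.exp (c * x) * g x := by
  have h1 : IsPrim (fun x : ℝ => ∫ t in (0 : ℝ)..x, Complex.exp (2 * c * t) * g t)
      fun x : ℝ => Complex.exp (2 * c * x) * g x :=
    ⟨hg.continuousOn_mul (by fun_prop), fun x _ => by simp⟩
  refine ((isPrim_cexp (-c)).mul h1).congr_deriv fun x _ => ?_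
  have : Complex.exp (c * x) = Complex.exp (-c * x) * Complex.exp (2 * c * x) := by
    rw [← Complex.exp_add]; ring_nf
  rw [this]; ring

theorem first_iterate_norm_le {g : ℝ → ℂ} (hg : IntervalIntegrable g volume 0 Real.pi) {c : ℂ}
    {k : ℝ} (hc : |c.re| ≤ k) {x : ℝ} (hx : x ∈ Set.Icc 0 Real.pi) :
    Real.exp (-k * x) *
      ‖Complex.exp (-c * x) * ∫ t in (0 : ℝ)..x, Complex.exp (2 * c * t) * g t‖ ≤
      ∫ t in (0 : ℝ)..Real.pi, ‖g t‖ := by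
  have hc' : |(-c).re| ≤ k := by simpa using hc
  have hi : IntervalIntegrable (fun t : ℝ => Complex.exp (c * t) * g t) volume 0 Real.pi :=
    hg.continuousOn_mul (by fun_prop)
  have h := (isPrim_first_iterate hg c).damped_le hi hc' hx
  simp only [intervalIntegral.integral_same, mul_zero, norm_zero, zero_add] at h
  refine h.trans ((intervalIntegral.integral_mono_on hx.1 ?_
    (hg.mono_set (uIcc_subset_of_mem hx)).norm fun t ht => ?_).trans
    (integral_mono_right (fun _ => norm_nonneg _) hg.norm hx))
  · exact (hi.mono_set (uIcc_subset_of_mem hx)).norm.continuousOn_mul (by fun_prop)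
  · rw [norm_mul, ← mul_assoc]
    refine mul_le_of_le_one_left (norm_nonneg _) ?_
    calc _ ≤ Real.exp (-k * t) * Real.exp (k * t) := by
          gcongr
          exact norm_cexp_mul_le hc ht.1
      _ = 1 := by rw [← Real.exp_add]; simp

/-- The Riemann–Lebesgue lemma for smooth functions. -/
theorem first_iterate_norm_le_of_isPrim {g g' : ℝ → ℂ} (hg : IsPrim g g') {c : ℂ} (hc0 : c ≠ 0)
    {k M : ℝ} (hc : |c.re| ≤ k) (hM : ∀ x ∈ Set.Icc 0 Real.pi, ‖g x‖ ≤ M) {x : ℝ}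
    (hx : x ∈ Set.Icc 0 Real.pi) :
    Real.exp (-k * x) *
      ‖Complex.exp (-c * x) * ∫ t in (0 : ℝ)..x, Complex.exp (2 * c * t) * g t‖ ≤
      (2 * M + ∫ t in (0 : ℝ)..Real.pi, ‖g' t‖) / (2 * ‖c‖) := by
  have hc' : |(-c).re| ≤ k := by simpa using hc
  have h1 := ((isPrim_cexp (2 * c)).mul hg).2 x hx
  have hgi := intervalIntegrable_of_continuousOn hg.continuousOn
  have hs := uIcc_subset_of_mem hx
  have e1 : IntervalIntegrable (fun t : ℝ => Complex.exp (2 * c * t) * g t) volume 0 x :=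
    (hgi.mono_set hs).continuousOn_mul (by fun_prop)
  have e2 : IntervalIntegrable (fun t : ℝ => Complex.exp (2 * c * t) * g' t) volume 0 x :=
    (hg.1.mono_set hs).continuousOn_mul (by fun_prop)
  simp only [Complex.ofReal_zero, mul_zero, Complex.exp_zero, one_mul, mul_assoc (2 * c)] at h1
  rw [intervalIntegral.integral_add (e1.const_mul _) e2, intervalIntegral.integral_const_mul] at h1
  have hcx : Complex.exp (-c * x) * Complex.exp (2 * c * x) = Complex.exp (c * x) := by
    rw [← Complex.exp_add]; ring_nf
  have h2 : Complex.exp (-c * x) * ∫ t in (0 : ℝ)..x, Complex.exp (2 * c * t) * g t =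
      (Complex.exp (c * x) * g x - Complex.exp (-c * x) * g 0 -
        Complex.exp (-c * x) * ∫ t in (0 : ℝ)..x, Complex.exp (2 * c * t) * g' t) / (2 * c) := by
    rw [eq_div_iff (mul_ne_zero two_ne_zero hc0)]
    linear_combination -Complex.exp (-c * x) * h1 + g x * hcx
  have h3 := first_iterate_norm_le hg.1 hc hx
  rw [h2, norm_div, norm_mul, Complex.norm_two, ← mul_div_assoc]
  have hk : Real.exp (-k * x) * Real.exp (k * x) = 1 := by rw [← Real.exp_add]; simp
  gcongr
  calc _ ≤ Real.exp (-k * x) * (Real.exp (k * x) * M + Real.exp (k * x) * M +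
        ‖Complex.exp (-c * x) * ∫ t in (0 : ℝ)..x, Complex.exp (2 * c * t) * g' t‖) := by
        gcongr
        refine (norm_sub_le _ _).trans (add_le_add ((norm_sub_le _ _).trans ?_) le_rfl)
        rw [norm_mul, norm_mul]
        gcongr
        · exact norm_cexp_mul_le hc hx.1
        · exact hM x hx
        · exact norm_cexp_mul_le hc' hx.1
        · exact hM 0 mem_Icc_zero
    _ = 2 * M + Real.exp (-k * x) *
        ‖Complex.exp (-c * x) * ∫ t in (0 : ℝ)..x, Complex.exp (2 * c * t) * g' t‖ := by
        linear_combination (2 * M) * hk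
    _ ≤ _ := by gcongr

theorem exists_smooth_approx {σ : ℝ → ℂ} (hσ : MemL2 σ) {η : ℝ} (hη : 0 < η) :
    ∃ s s' : ℝ → ℂ, IsPrim s s' ∧ MemL2 s ∧ l2norm (fun x => σ x - s x) ≤ η := by
  obtain ⟨s, hs1, hs2, hs3⟩ := hσ.exist_eLpNorm_sub_le (by norm_num) (by norm_num) hη
  refine ⟨s, deriv s, IsPrim.of_hasDerivAt (fun x => (hs2.differentiable (by simp) x).hasDerivAt)
    (hs2.continuous_deriv (by simp)), hs2.continuous.memLp_of_hasCompactSupport hs1, ?_⟩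
  exact ENNReal.toReal_le_of_le_ofReal hη.le hs3

/-- The first iterate solves the wave equation with the companion replaced by its free value
`exp(iρx)`. Once it is subtracted, the remainder contains only the deviation of the companion and a
term of order `1/ρ`. -/
theorem slWave_dev_le {σ : ℝ → ℂ} (hσ : MemL2 σ) {S : ℝ} (hS : l2norm σ ≤ S) {ρ : ℂ}
    (hρ : 1 / 2 ≤ ‖ρ‖) {F : ℝ} (hF : ∀ x ∈ Set.Icc 0 Real.pi,
      Real.exp (-|ρ.im| * x) * ‖Complex.exp (-(Complex.I * ρ) * x) *
        ∫ t in (0 : ℝ)..x, Complex.exp (2 * (Complex.I * ρ) * t) * σ t‖ ≤ F)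
    {x : ℝ} (hx : x ∈ Set.Icc 0 Real.pi) :
    Real.exp (-|ρ.im| * x) * ‖slWave σ ρ x - Complex.exp (-(Complex.I * ρ) * x)‖ ≤
      F + Real.exp (2 * (2 * S + S ^ 2)) * S ^ 2 / ‖ρ‖ +
        ∫ t in (0 : ℝ)..x, ‖σ t‖ * (Real.exp (-|ρ.im| * t) *
          ‖slWave σ (-ρ) t - Complex.exp (Complex.I * ρ * t)‖) := by
  have hρ0 : ρ ≠ 0 := fun h => by simp [h] at hρ; linarith
  have hρp : 0 < ‖ρ‖ := norm_pos_iff.2 hρ0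
  set k := |ρ.im|
  set c := Complex.I * ρ with hc
  set C0 := Real.exp (2 * (2 * S + S ^ 2))
  have hs := uIcc_subset_of_mem hx
  have hck : |(-c).re| ≤ k := abs_re_I_mul ρ
  set P0 : ℝ → ℂ := fun x => Complex.exp (-c * x) *
    ∫ t in (0 : ℝ)..x, Complex.exp (2 * c * t) * σ t with hP0
  have h1 := ((slWave_isPrim hσ hρ0).sub (isPrim_cexp (-c))).sub
    (isPrim_first_iterate hσ.intervalIntegrable c)
  have h2 := h1.congr_deriv (g' := fun x => -c * (slWave σ ρ x - Complex.exp (-c * x) - P0 x) +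
    (slWaveRem σ ρ x - Complex.exp (c * x) * σ x)) fun t _ => by simp only [hP0, hc]; ring
  have hri : IntervalIntegrable (fun x : ℝ => slWaveRem σ ρ x - Complex.exp (c * x) * σ x)
      volume 0 Real.pi :=
    (slWaveRem_intervalIntegrable hσ ρ).sub (hσ.intervalIntegrable.continuousOn_mul (by fun_prop))
  have h3 := h2.damped_le hri hck hx
  simp only [slWave_zero hσ, Complex.ofReal_zero, mul_zero, Complex.exp_zero, sub_self,
    intervalIntegral.integral_same, norm_zero, zero_add] at h3
  have hwc : ContinuousOn (fun t : ℝ => Real.exp (-k * t) *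
      ‖slWave σ (-ρ) t - Complex.exp (c * t)‖) (Set.uIcc 0 Real.pi) := by
    rw [Set.uIcc_of_le Real.pi_pos.le]
    exact ContinuousOn.mul (by fun_prop)
      (((slWave_continuousOn hσ (-ρ)).sub (by fun_prop)).norm)
  have i1 : IntervalIntegrable (fun t : ℝ => ‖σ t‖ * (Real.exp (-k * t) *
      ‖slWave σ (-ρ) t - Complex.exp (c * t)‖)) volume 0 x :=
    (hσ.intervalIntegrable.norm.mul_continuousOn hwc).mono_set hs
  have i2 : IntervalIntegrable (fun t : ℝ => C0 / ‖ρ‖ * ‖σ t‖ ^ 2) volume 0 Real.pi :=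
    hσ.intervalIntegrable_norm_sq.const_mul _
  have h4 : ∫ t in (0 : ℝ)..x, Real.exp (-k * t) * ‖slWaveRem σ ρ t - Complex.exp (c * t) * σ t‖ ≤
      ∫ t in (0 : ℝ)..x, (‖σ t‖ * (Real.exp (-k * t) *
        ‖slWave σ (-ρ) t - Complex.exp (c * t)‖) + C0 / ‖ρ‖ * ‖σ t‖ ^ 2) := by
    refine intervalIntegral.integral_mono_on hx.1
      ((hri.mono_set hs).norm.continuousOn_mul (by fun_prop)) (i1.add (i2.mono_set hs))
      fun t ht => ?_
    have e : slWaveRem σ ρ t - Complex.exp (c * t) * σ t =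
        σ t * (slWave σ (-ρ) t - Complex.exp (c * t)) -
        Complex.I * σ t ^ 2 / (2 * ρ) * (slWave σ ρ t + slWave σ (-ρ) t) := by
      simp only [slWaveRem]; ring
    have hb := slWave_norm_le hσ hS hρ (x := t) ⟨ht.1, ht.2.trans hx.2⟩
    have hI : ‖Complex.I * σ t ^ 2 / (2 * ρ)‖ = ‖σ t‖ ^ 2 / (2 * ‖ρ‖) := by
      rw [norm_div, norm_mul, norm_mul, norm_pow, Complex.norm_I, one_mul, Complex.norm_two]
    have hk : Real.exp (-k * t) * Real.exp (k * t) = 1 := by rw [← Real.exp_add]; simp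
    calc _ ≤ Real.exp (-k * t) * (‖σ t‖ * ‖slWave σ (-ρ) t - Complex.exp (c * t)‖ +
          ‖σ t‖ ^ 2 / (2 * ‖ρ‖) * (2 * C0 * Real.exp (k * t))) := by
          gcongr
          rw [e]
          refine (norm_sub_le _ _).trans ?_
          rw [norm_mul, norm_mul, hI]
          gcongr
          exact (norm_add_le _ _).trans hb
      _ = ‖σ t‖ * (Real.exp (-k * t) * ‖slWave σ (-ρ) t - Complex.exp (c * t)‖) +
          C0 / ‖ρ‖ * ‖σ t‖ ^ 2 * (Real.exp (-k * t) * Real.exp (k * t)) := by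
          field_simp
      _ = _ := by rw [hk, mul_one]
  rw [intervalIntegral.integral_add i1 (i2.mono_set hs)] at h4
  have h5 := integral_mono_right (fun t => by positivity) i2 hx
  rw [intervalIntegral.integral_const_mul _ (fun t => ‖σ t‖ ^ 2),
    intervalIntegral.integral_const_mul _ (fun t => ‖σ t‖ ^ 2), integral_norm_sq_eq hσ] at h5
  rw [intervalIntegral.integral_const_mul _ (fun t => ‖σ t‖ ^ 2)] at h4
  have hn := l2norm_nonneg σ
  have h6 : C0 / ‖ρ‖ * l2norm σ ^ 2 ≤ C0 * S ^ 2 / ‖ρ‖ := by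
    rw [div_mul_eq_mul_div]
    gcongr
  have h7 := hF x hx
  have h8 : ‖slWave σ ρ x - Complex.exp (-c * x)‖ ≤
      ‖slWave σ ρ x - Complex.exp (-c * x) - P0 x‖ + ‖P0 x‖ := by
    simpa using norm_add_le (slWave σ ρ x - Complex.exp (-c * x) - P0 x) (P0 x)
  have h9 := mul_le_mul_of_nonneg_left h8 (Real.exp_pos (-k * x)).le
  rw [mul_add] at h9
  linarith

/-- Asymptotics of the waves as `ρ → ∞`, locally uniformly in the potential. -/
theorem slWave_asymptotics {σ : ℝ → ℂ} (hσ : MemL2 σ) {ε : ℝ} (hε : 0 < ε) :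
    ∃ η > 0, ∃ R ≥ 1, ∀ τ : ℝ → ℂ, MemL2 τ → l2norm (fun x => τ x - σ x) ≤ η → ∀ ρ : ℂ, R ≤ ‖ρ‖ →
      ∀ x ∈ Set.Icc 0 Real.pi, ‖slWave τ ρ x - Complex.exp (-(Complex.I * ρ) * x)‖ +
        ‖slWave τ (-ρ) x - Complex.exp (Complex.I * ρ * x)‖ ≤ ε * Real.exp (|ρ.im| * x) := by
  set S := l2norm σ + 1 with hSdef
  have hSpos : 0 < S := by have := l2norm_nonneg σ; positivity
  set G := Real.exp (2 * S) with hG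
  have hGpos : 0 < G := Real.exp_pos _
  set C0 := Real.exp (2 * (2 * S + S ^ 2))
  -- `G` bounds the Grönwall factor. The contribution `8ηG` of `τ - s` and the contribution of order
  -- `1/ρ` are each kept below `ε/2`.
  set η := min 1 (ε / (16 * G)) with hη
  have hηpos : 0 < η := by positivity
  have hη1 : 8 * η * G ≤ ε / 2 := by
    have : η ≤ ε / (16 * G) := min_le_right _ _
    rw [le_div_iff₀ (by positivity)] at this
    linarith
  obtain ⟨s, s', hs, hs2, hs3⟩ := exists_smooth_approx hσ hηpos
  obtain ⟨M, hM⟩ := isCompact_Icc.exists_bound_of_continuousOn hs.continuousOn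
  have hM0 : 0 ≤ M := (norm_nonneg _).trans (hM 0 mem_Icc_zero)
  set D := ∫ t in (0 : ℝ)..Real.pi, ‖s' t‖ with hD
  have hD0 : 0 ≤ D := intervalIntegral.integral_nonneg Real.pi_pos.le fun _ _ => norm_nonneg _
  set K := 2 * M + D + 2 * (C0 * S ^ 2) with hK
  have hK0 : 0 ≤ K := by positivity
  refine ⟨η, hηpos, max 1 (2 * K * G / ε), le_max_left _ _, fun τ hτ hτσ ρ hρ x hx => ?_⟩
  have hρ1 : 1 ≤ ‖ρ‖ := (le_max_left _ _).trans hρ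
  have hρp : 0 < ‖ρ‖ := by linarith
  have hKρ : K / ‖ρ‖ * G ≤ ε / 2 := by
    have := (le_max_right _ _).trans hρ
    rw [div_le_iff₀ hε] at this
    rw [div_mul_eq_mul_div, div_le_iff₀ hρp]
    linarith
  have hτS : l2norm τ ≤ S := by
    have h1 := l2norm_le_of_sub hσ hτ
    have h2 : η ≤ 1 := min_le_left _ _
    linarith
  have hts : MemL2 fun x => τ x - s x := hτ.sub hs2
  have hts2 : ∫ t in (0 : ℝ)..Real.pi, ‖τ t - s t‖ ≤ 4 * η := by
    have h1 := l2norm_add_le (hτ.sub hσ) (hσ.sub hs2)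
    simp only [Pi.sub_apply, sub_add_sub_cancel] at h1
    have h2 := integral_norm_le hts
    have h3 : l2norm (τ - σ) ≤ η := hτσ
    have h4 : l2norm (σ - s) ≤ η := hs3
    linarith
  set k := |ρ.im| with hk
  -- Riemann–Lebesgue uniformly in `τ`: the part `τ - s` is small in `L₁`, and the smooth `s`,
  -- chosen before `τ`, is integrated by parts.
  have hF : ∀ r : ℂ, ‖r‖ = ‖ρ‖ → |r.im| = k → ∀ x ∈ Set.Icc 0 Real.pi,
      Real.exp (-|r.im| * x) * ‖Complex.exp (-(Complex.I * r) * x) *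
        ∫ t in (0 : ℝ)..x, Complex.exp (2 * (Complex.I * r) * t) * τ t‖ ≤
      4 * η + (2 * M + D) / (2 * ‖ρ‖) := by
    intro r hr hrk x hx
    have hck : |(Complex.I * r).re| ≤ |r.im| := by simp
    have hc0 : Complex.I * r ≠ 0 := by
      rw [← norm_pos_iff, norm_mul, Complex.norm_I, one_mul, hr]; exact hρp
    have h1 := first_iterate_norm_le hts.intervalIntegrable hck hx
    have h2 := first_iterate_norm_le_of_isPrim hs hc0 hck hM hx
    rw [norm_mul Complex.I, Complex.norm_I, one_mul, hr] at h2
    have i1 : IntervalIntegrable (fun t : ℝ => Complex.exp (2 * (Complex.I * r) * t) *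
        (τ t - s t)) volume 0 x :=
      (hts.intervalIntegrable.mono_set (uIcc_subset_of_mem hx)).continuousOn_mul (by fun_prop)
    have i2 : IntervalIntegrable (fun t : ℝ => Complex.exp (2 * (Complex.I * r) * t) *
        s t) volume 0 x :=
      (hs2.intervalIntegrable.mono_set (uIcc_subset_of_mem hx)).continuousOn_mul (by fun_prop)
    have e : ∫ t in (0 : ℝ)..x, Complex.exp (2 * (Complex.I * r) * t) * τ t =
        (∫ t in (0 : ℝ)..x, Complex.exp (2 * (Complex.I * r) * t) * (τ t - s t)) +
        ∫ t in (0 : ℝ)..x, Complex.exp (2 * (Complex.I * r) * t) * s t := by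
      rw [← intervalIntegral.integral_add i1 i2]
      congr 1; ext t; ring
    rw [e, mul_add]
    refine (mul_le_mul_of_nonneg_left (norm_add_le _ _) (Real.exp_pos _).le).trans ?_
    rw [mul_add]
    linarith
  set E : ℝ → ℝ := fun x => Real.exp (-k * x) *
    (‖slWave τ ρ x - Complex.exp (-(Complex.I * ρ) * x)‖ +
      ‖slWave τ (-ρ) x - Complex.exp (Complex.I * ρ * x)‖) with hE
  have hc1 : ContinuousOn (fun x : ℝ => ‖slWave τ ρ x - Complex.exp (-(Complex.I * ρ) * x)‖)
    (Set.Icc 0 Real.pi) := ((slWave_continuousOn hτ ρ).sub (by fun_prop)).norm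
  have hc2 : ContinuousOn (fun x : ℝ => ‖slWave τ (-ρ) x - Complex.exp (Complex.I * ρ * x)‖)
    (Set.Icc 0 Real.pi) := ((slWave_continuousOn hτ (-ρ)).sub (by fun_prop)).norm
  have hexpc : ContinuousOn (fun x : ℝ => Real.exp (-k * x)) (Set.Icc 0 Real.pi) := by fun_prop
  have hEc : ContinuousOn E (Set.Icc 0 Real.pi) := hexpc.mul (hc1.add hc2)
  have key := gronwall_integrable hEc (h := fun x => ‖τ x‖) (c := 8 * η + K / ‖ρ‖)
    (fun x => norm_nonneg _) hτ.intervalIntegrable.norm (fun y hy => by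
      have hs := uIcc_subset_of_mem hy
      have h1 := slWave_dev_le hτ hτS (by linarith : 1 / 2 ≤ ‖ρ‖) (hF ρ rfl rfl) hy
      have h2 := slWave_dev_le hτ hτS (ρ := -ρ) (by rw [norm_neg]; linarith)
        (hF (-ρ) (norm_neg _) (by simp [hk])) hy
      simp only [Complex.neg_im, abs_neg, norm_neg, neg_neg, mul_neg] at h2
      have i1 : IntervalIntegrable (fun t : ℝ => ‖τ t‖ * (Real.exp (-k * t) *
          ‖slWave τ (-ρ) t - Complex.exp (Complex.I * ρ * t)‖)) volume 0 y := by
        refine (hτ.intervalIntegrable.norm.mul_continuousOn ?_).mono_set hs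
        rw [Set.uIcc_of_le Real.pi_pos.le]
        exact hexpc.mul hc2
      have i2 : IntervalIntegrable (fun t : ℝ => ‖τ t‖ * (Real.exp (-k * t) *
          ‖slWave τ ρ t - Complex.exp (-(Complex.I * ρ) * t)‖)) volume 0 y := by
        refine (hτ.intervalIntegrable.norm.mul_continuousOn ?_).mono_set hs
        rw [Set.uIcc_of_le Real.pi_pos.le]
        exact hexpc.mul hc1
      have e : ∫ t in (0 : ℝ)..y, ‖τ t‖ * E t =
          (∫ t in (0 : ℝ)..y, ‖τ t‖ * (Real.exp (-k * t) *
            ‖slWave τ (-ρ) t - Complex.exp (Complex.I * ρ * t)‖)) +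
          ∫ t in (0 : ℝ)..y, ‖τ t‖ * (Real.exp (-k * t) *
            ‖slWave τ ρ t - Complex.exp (-(Complex.I * ρ) * t)‖) := by
        rw [← intervalIntegral.integral_add i1 i2]
        congr 1; ext t; simp only [hE]; ring
      rw [e]
      have hKe : K / ‖ρ‖ = 2 * ((2 * M + D) / (2 * ‖ρ‖)) + 2 * (C0 * S ^ 2 / ‖ρ‖) := by
        rw [hK]; field_simp
      simp only [hE, hKe]
      simp only [← hk] at h1 h2
      linarith) x hx
  have hexp : Real.exp (∫ t in (0 : ℝ)..x, ‖τ t‖) ≤ G := by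
    rw [hG]
    gcongr
    refine (integral_mono_right (fun t => norm_nonneg _) hτ.intervalIntegrable.norm hx).trans ?_
    exact (integral_norm_le hτ).trans (by linarith)
  have h1 : E x ≤ ε := by
    refine key.trans ((mul_le_mul_of_nonneg_left hexp (by positivity)).trans ?_)
    rw [add_mul]
    linarith
  have hkk : Real.exp (-k * x) * Real.exp (k * x) = 1 := by rw [← Real.exp_add]; simp
  calc _ = E x * Real.exp (k * x) := by
        simp only [hE]
        linear_combination -(‖slWave τ ρ x - Complex.exp (-(Complex.I * ρ) * x)‖ +
          ‖slWave τ (-ρ) x - Complex.exp (Complex.I * ρ * x)‖) * hkk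
    _ ≤ _ := mul_le_mul_of_nonneg_right h1 (Real.exp_pos _).le

/-- Asymptotics of `φ` and `φ^{[1]}` as `ρ → ∞`, locally uniformly in the potential. -/
theorem slPhi_asymptotics {σ : ℝ → ℂ} (hσ : MemL2 σ) {ε : ℝ} (hε : 0 < ε) :
    ∃ η > 0, ∃ R ≥ 1, ∀ τ : ℝ → ℂ, MemL2 τ → l2norm (fun x => τ x - σ x) ≤ η → ∀ ρ : ℂ, R ≤ ‖ρ‖ →
      ∀ x ∈ Set.Icc 0 Real.pi,
        ‖slPhi τ x (ρ ^ 2) - Complex.cos (ρ * x)‖ ≤ ε * Real.exp (|ρ.im| * x) ∧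
        ‖slPhiQuasi τ x (ρ ^ 2) + ρ * Complex.sin (ρ * x)‖ ≤
          ε * ‖ρ‖ * Real.exp (|ρ.im| * x) := by
  obtain ⟨η, hη, R, hR, h⟩ := slWave_asymptotics hσ hε
  refine ⟨η, hη, R, hR, fun τ hτ hτσ ρ hρ x hx => ?_⟩
  have h1 := h τ hτ hτσ ρ hρ x hx
  have hρ0 : ρ ≠ 0 := by rw [← norm_pos_iff]; linarith
  set p := slWave τ ρ x - Complex.exp (-(Complex.I * ρ) * x) with hp
  set q := slWave τ (-ρ) x - Complex.exp (Complex.I * ρ * x) with hq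
  have n1 := norm_nonneg p
  have n2 := norm_nonneg q
  have ea : -(ρ * (x : ℂ)) * Complex.I = -(Complex.I * ρ) * x := by ring
  have eb : ρ * (x : ℂ) * Complex.I = Complex.I * ρ * x := by ring
  constructor
  · have e : slPhi τ x (ρ ^ 2) - Complex.cos (ρ * x) = (p + q) / 2 := by
      rw [slPhi_eq_wave, Complex.cos, ea, eb, hp, hq]; ring
    rw [e, norm_div, Complex.norm_two]
    have := norm_add_le p q
    linarith
  · have e : slPhiQuasi τ x (ρ ^ 2) + ρ * Complex.sin (ρ * x) = ρ * ((p - q) / (2 * Complex.I)) := by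
      rw [slPhiQuasi_eq_wave τ hρ0, Complex.sin, ea, eb, hp, hq]
      field_simp
      ring_nf
      simp only [Complex.I_sq]
      ring
    rw [e, norm_mul, norm_div, norm_mul, Complex.norm_two, Complex.norm_I, mul_one]
    have := norm_sub_le p q
    have h2 : ‖p - q‖ / 2 ≤ ε * Real.exp (|ρ.im| * x) := by linarith
    calc _ ≤ ‖ρ‖ * (ε * Real.exp (|ρ.im| * x)) := by gcongr
      _ = _ := by ring

/-! ### Bessel's inequality for partial Fourier integrals -/

/-- Partial Fourier integrals over `(0, x)` with even frequencies. -/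
noncomputable def oscInt (f : ℝ → ℂ) (n : ℤ) (x : ℝ) : ℂ :=
  ∫ t in (0 : ℝ)..x, Complex.exp (2 * (Complex.I * n) * t) * f t

theorem oscInt_isPrim {f : ℝ → ℂ} (hf : MemL2 f) (n : ℤ) :
    IsPrim (oscInt f n) fun x => Complex.exp (2 * (Complex.I * n) * x) * f x :=
  ⟨hf.intervalIntegrable.continuousOn_mul (by fun_prop), fun x _ => by simp [oscInt]⟩

/-- The exponentials `exp(2int)` are orthogonal on `(0, π)`, so these integrals are `π` times
Fourier coefficients and Parseval's identity applies; the factor `π` is rounded up to 4. -/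
theorem bessel_oscInt_pi {f : ℝ → ℂ} (hf : MemL2 f) (s : Finset ℤ) :
    ∑ n ∈ s, ‖oscInt f n Real.pi‖ ^ 2 ≤ 4 * l2norm f ^ 2 := by
  have hf' : MemLp f 2 (volume.restrict (Set.Ioc 0 Real.pi)) := by
    rwa [← Measure.restrict_congr_set Ioo_ae_eq_Ioc]
  have h := hasSum_sq_fourierCoeffOn Real.pi_pos hf'
  rw [integral_norm_sq_eq hf, sub_zero, smul_eq_mul] at h
  have hc : ∀ n : ℤ, ‖oscInt f n Real.pi‖ = Real.pi * ‖fourierCoeffOn Real.pi_pos f (-n)‖ := by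
    intro n
    rw [fourierCoeffOn_eq_integral, neg_neg, norm_smul, sub_zero,
      Real.norm_of_nonneg (by positivity), ← mul_assoc, mul_one_div_cancel Real.pi_pos.ne', one_mul,
      oscInt]
    congr 1
    refine intervalIntegral.integral_congr fun t _ => ?_
    rw [fourier_coe_apply, smul_eq_mul]
    congr 2
    have : (Real.pi : ℂ) ≠ 0 := by exact_mod_cast Real.pi_pos.ne'
    field_simp
  have h1 := sum_le_hasSum (s.map (Equiv.neg ℤ).toEmbedding) (fun _ _ => by positivity) h
  rw [Finset.sum_map] at h1
  simp only [Equiv.coe_toEmbedding, Equiv.neg_apply] at h1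
  calc _ = Real.pi ^ 2 * ∑ n ∈ s, ‖fourierCoeffOn Real.pi_pos f (-n)‖ ^ 2 := by
        rw [Finset.mul_sum]
        exact Finset.sum_congr rfl fun n _ => by rw [hc, mul_pow]
    _ ≤ Real.pi ^ 2 * (Real.pi⁻¹ * l2norm f ^ 2) := by gcongr
    _ = Real.pi * l2norm f ^ 2 := by
        have := Real.pi_pos.ne'
        field_simp
    _ ≤ _ := by gcongr; exact Real.pi_lt_four.le

/-- Bessel's inequality. -/
theorem bessel_oscInt {f : ℝ → ℂ} (hf : MemL2 f) (s : Finset ℤ) {x : ℝ}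
    (hx : x ∈ Set.Icc 0 Real.pi) :
    ∑ n ∈ s, ‖oscInt f n x‖ ^ 2 ≤ 4 * l2norm f ^ 2 := by
  -- Cutting `f` off at `x` turns the partial integral into a full one without increasing the norm,
  -- so the bound is uniform in `x`.
  have hg : MemL2 ((Set.Ioc 0 x).indicator f) := hf.indicator measurableSet_Ioc
  have h1 : l2norm ((Set.Ioc 0 x).indicator f) ≤ l2norm f :=
    ENNReal.toReal_mono hf.2.ne (eLpNorm_indicator_le f)
  have h2 : ∀ n : ℤ, oscInt f n x = oscInt ((Set.Ioc 0 x).indicator f) n Real.pi := by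
    intro n
    unfold oscInt
    rw [intervalIntegral.integral_of_le hx.1, intervalIntegral.integral_of_le Real.pi_pos.le,
      ← integral_indicator measurableSet_Ioc, ← integral_indicator measurableSet_Ioc]
    congr 1
    ext t
    by_cases ht : t ∈ Set.Ioc 0 x
    · have ht' : t ∈ Set.Ioc 0 Real.pi := ⟨ht.1, ht.2.trans hx.2⟩
      simp [Set.indicator_of_mem, ht, ht']
    · simp [ht, Set.indicator]
  calc _ = ∑ n ∈ s, ‖oscInt ((Set.Ioc 0 x).indicator f) n Real.pi‖ ^ 2 :=
        Finset.sum_congr rfl fun n _ => by rw [h2]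
    _ ≤ 4 * l2norm ((Set.Ioc 0 x).indicator f) ^ 2 := bessel_oscInt_pi hg s
    _ ≤ _ := by have := l2norm_nonneg ((Set.Ioc 0 x).indicator f); gcongr

/-- Weighted Cauchy–Schwarz for a weight that is merely integrable: the integral of `W (B g - m)²`
is nonnegative, and `m = ∫ W g` is the useful choice. -/
theorem sq_integral_weight_le {W g : ℝ → ℝ} {B : ℝ} (hB : 0 < B) (hW : ∀ x, 0 ≤ W x)
    (hWi : IntervalIntegrable W volume 0 Real.pi)
    (hWB : ∫ t in (0 : ℝ)..Real.pi, W t ≤ B) (hg : ContinuousOn g (Set.Icc 0 Real.pi)) :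
    (∫ t in (0 : ℝ)..Real.pi, W t * g t) ^ 2 ≤ B * ∫ t in (0 : ℝ)..Real.pi, W t * g t ^ 2 := by
  rw [← Set.uIcc_of_le Real.pi_pos.le] at hg
  have i1 : IntervalIntegrable (fun t => W t * g t) volume 0 Real.pi := hWi.mul_continuousOn hg
  have i2 : IntervalIntegrable (fun t => W t * g t ^ 2) volume 0 Real.pi :=
    hWi.mul_continuousOn (hg.pow 2)
  have key : ∀ m : ℝ, 0 ≤ B ^ 2 * (∫ t in (0 : ℝ)..Real.pi, W t * g t ^ 2) -
      2 * B * m * (∫ t in (0 : ℝ)..Real.pi, W t * g t) +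
      m ^ 2 * ∫ t in (0 : ℝ)..Real.pi, W t := by
    intro m
    have h0 : 0 ≤ ∫ t in (0 : ℝ)..Real.pi, W t * (B * g t - m) ^ 2 :=
      intervalIntegral.integral_nonneg Real.pi_pos.le fun t _ => mul_nonneg (hW t) (sq_nonneg _)
    have h1 : ∫ t in (0 : ℝ)..Real.pi, W t * (B * g t - m) ^ 2 =
        ∫ t in (0 : ℝ)..Real.pi,
          (B ^ 2 * (W t * g t ^ 2) - 2 * B * m * (W t * g t) + m ^ 2 * W t) := by
      congr 1; ext t; ring
    rw [h1, intervalIntegral.integral_add ((i2.const_mul _).sub (i1.const_mul _))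
      (hWi.const_mul _), intervalIntegral.integral_sub (i2.const_mul _) (i1.const_mul _),
      intervalIntegral.integral_const_mul, intervalIntegral.integral_const_mul,
      intervalIntegral.integral_const_mul] at h0
    exact h0
  have h1 := key (∫ t in (0 : ℝ)..Real.pi, W t * g t)
  set m := ∫ t in (0 : ℝ)..Real.pi, W t * g t
  set q := ∫ t in (0 : ℝ)..Real.pi, W t * g t ^ 2
  have h2 : 0 ≤ B * (B * q - m ^ 2) := by
    nlinarith [mul_le_mul_of_nonneg_left hWB (sq_nonneg m)]
  linarith [nonneg_of_mul_nonneg_right h2 hB]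

/-! ### Square summable differences of the waves of two problems -/

/-- The wave `slWave σ ρ` with the factor `exp (-i n x)` removed, for `ρ` close to `n`. -/
noncomputable def gaugedWave (σ : ℝ → ℂ) (n : ℤ) (ρ : ℂ) (x : ℝ) : ℂ :=
  Complex.exp (Complex.I * n * x) * slWave σ ρ x

theorem norm_exp_I_mul_int (n : ℤ) (x : ℝ) : ‖Complex.exp (Complex.I * n * x)‖ = 1 := by
  rw [Complex.norm_exp]; simp

theorem norm_exp_two_I_mul_int (n : ℤ) (x : ℝ) : ‖Complex.exp (2 * (Complex.I * n) * x)‖ = 1 := by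
  rw [Complex.norm_exp]; simp

theorem gaugedWave_norm (σ : ℝ → ℂ) (n : ℤ) (ρ : ℂ) (x : ℝ) :
    ‖gaugedWave σ n ρ x‖ = ‖slWave σ ρ x‖ := by
  rw [gaugedWave, norm_mul, norm_exp_I_mul_int, one_mul]

theorem exp_gauge_companion (σ : ℝ → ℂ) (n : ℤ) (ρ : ℂ) (x : ℝ) :
    Complex.exp (2 * (Complex.I * n) * x) * gaugedWave σ (-n) (-ρ) x =
      Complex.exp (Complex.I * n * x) * slWave σ (-ρ) x := by
  rw [gaugedWave, ← mul_assoc, ← Complex.exp_add]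
  push_cast
  ring_nf

/-- For `ρ` near `n` the diagonal coefficient `i(n - ρ)` is bounded. The oscillation is concentrated
in the factor `exp(2inx)` before the companion, the source of the Fourier integrals. -/
theorem gaugedWave_isPrim {σ : ℝ → ℂ} (hσ : MemL2 σ) (n : ℤ) {ρ : ℂ} (hρ : ρ ≠ 0) :
    IsPrim (gaugedWave σ n ρ) fun x => Complex.I * (n - ρ) * gaugedWave σ n ρ x +
      σ x * (Complex.exp (2 * (Complex.I * n) * x) * gaugedWave σ (-n) (-ρ) x) -
      Complex.I * σ x ^ 2 / (2 * ρ) * (gaugedWave σ n ρ x +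
        Complex.exp (2 * (Complex.I * n) * x) * gaugedWave σ (-n) (-ρ) x) := by
  refine ((isPrim_cexp (Complex.I * n)).mul (slWave_isPrim hσ hρ)).congr_deriv fun x _ => ?_
  rw [exp_gauge_companion]
  simp only [gaugedWave, slWaveRem]
  ring

section difference

variable {σ τ : ℝ → ℂ} {n : ℤ} {ρ ρ' : ℂ}

/-- The difference of the gauged waves of two problems. -/
noncomputable def waveDiff (σ τ : ℝ → ℂ) (n : ℤ) (ρ ρ' : ℂ) (x : ℝ) : ℂ :=
  gaugedWave τ n ρ' x - gaugedWave σ n ρ x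

/-- The derivative is grouped by the way it is estimated: the oscillating `τ - σ` by parts, the
terms linear in the differences by Grönwall, and the rest, of size `ρ' - ρ` or `(τ² - σ²)/n`,
directly. -/
theorem waveDiff_isPrim (hσ : MemL2 σ) (hτ : MemL2 τ) (hρ : ρ ≠ 0) (hρ' : ρ' ≠ 0) :
    IsPrim (waveDiff σ τ n ρ ρ') fun x =>
      (Complex.exp (2 * (Complex.I * n) * x) * (τ x - σ x)) * gaugedWave τ (-n) (-ρ') x +
      ((Complex.I * (n - ρ) * waveDiff σ τ n ρ ρ' x +
        σ x * (Complex.exp (2 * (Complex.I * n) * x) * waveDiff σ τ (-n) (-ρ) (-ρ') x) -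
        Complex.I * σ x ^ 2 / (2 * ρ) * (waveDiff σ τ n ρ ρ' x +
          Complex.exp (2 * (Complex.I * n) * x) * waveDiff σ τ (-n) (-ρ) (-ρ') x)) +
      (-(Complex.I * (ρ' - ρ)) * gaugedWave τ n ρ' x -
        Complex.I * (τ x ^ 2 / (2 * ρ') - σ x ^ 2 / (2 * ρ)) * (gaugedWave τ n ρ' x +
          Complex.exp (2 * (Complex.I * n) * x) * gaugedWave τ (-n) (-ρ') x))) := by
  refine ((gaugedWave_isPrim hτ n hρ').sub (gaugedWave_isPrim hσ n hρ)).congr_deriv fun x _ => ?_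
  simp only [waveDiff]
  ring

/-- Integration by parts in an oscillating integral. -/
theorem norm_integral_osc_mul_le {f g g' : ℝ → ℂ} (hf : MemL2 f) (hg : IsPrim g g') {W : ℝ → ℝ}
    {C : ℝ} (hC : 0 ≤ C) (hgC : ∀ x ∈ Set.Icc 0 Real.pi, ‖g x‖ ≤ C) (hW : ∀ x, 0 ≤ W x)
    (hWi : IntervalIntegrable W volume 0 Real.pi)
    (hgW : ∀ x ∈ Set.Icc 0 Real.pi, ‖g' x‖ ≤ C * W x) {x : ℝ} (hx : x ∈ Set.Icc 0 Real.pi) :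
    ‖∫ t in (0 : ℝ)..x, Complex.exp (2 * (Complex.I * n) * t) * f t * g t‖ ≤
      C * (‖oscInt f n x‖ + ∫ t in (0 : ℝ)..Real.pi, W t * ‖oscInt f n t‖) := by
  have hG := oscInt_isPrim hf n
  have h1 := (hG.mul hg).2 x hx
  have hs := uIcc_subset_of_mem hx
  have hgc := hg.continuousOn
  have hGc := hG.continuousOn
  rw [← Set.uIcc_of_le Real.pi_pos.le] at hgc hGc
  have h0 : oscInt f n 0 = 0 := by simp [oscInt]
  have i1 : IntervalIntegrable (fun t : ℝ => Complex.exp (2 * (Complex.I * n) * t) * f t * g t)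
    volume 0 x := (hG.1.mul_continuousOn hgc).mono_set hs
  have i2 : IntervalIntegrable (fun t => oscInt f n t * g' t) volume 0 x :=
    (hg.1.continuousOn_mul hGc).mono_set hs
  have i3 : IntervalIntegrable (fun t => C * (W t * ‖oscInt f n t‖)) volume 0 Real.pi :=
    (hWi.mul_continuousOn hGc.norm).const_mul C
  simp only [h0, zero_mul, zero_add] at h1
  rw [intervalIntegral.integral_add i1 i2] at h1
  have h2 : ‖∫ t in (0 : ℝ)..x, oscInt f n t * g' t‖ ≤
      ∫ t in (0 : ℝ)..Real.pi, C * (W t * ‖oscInt f n t‖) := by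
    refine (intervalIntegral.norm_integral_le_of_norm_le hx.1 (Eventually.of_forall fun t ht => ?_)
      (i3.mono_set hs)).trans (integral_mono_right
        (fun t => mul_nonneg hC (mul_nonneg (hW t) (norm_nonneg _))) i3 hx)
    rw [norm_mul]
    have := mul_le_mul_of_nonneg_left (hgW t ⟨ht.1.le, ht.2.trans hx.2⟩)
      (norm_nonneg (oscInt f n t))
    linarith
  rw [intervalIntegral.integral_const_mul] at h2
  have h3 : ∫ t in (0 : ℝ)..x, Complex.exp (2 * (Complex.I * n) * t) * f t * g t =
      oscInt f n x * g x - ∫ t in (0 : ℝ)..x, oscInt f n t * g' t := by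
    rw [h1]; ring
  rw [h3, mul_add]
  refine (norm_sub_le _ _).trans (add_le_add ?_ h2)
  rw [norm_mul, mul_comm]
  exact mul_le_mul_of_nonneg_right (hgC x hx) (norm_nonneg _)

end difference

theorem wave_coeff_norm_le {σ : ℂ} {ρ p q e κ : ℂ} (hρ : 1 / 2 ≤ ‖ρ‖) (hκ : ‖κ‖ ≤ 1 / 4)
    (he : ‖e‖ = 1) :
    ‖Complex.I * κ * p + σ * (e * q) - Complex.I * σ ^ 2 / (2 * ρ) * (p + e * q)‖ ≤
      (1 + ‖σ‖ + ‖σ‖ ^ 2) * (‖p‖ + ‖q‖) := by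
  have h1 : ‖Complex.I * σ ^ 2 / (2 * ρ)‖ ≤ ‖σ‖ ^ 2 := by
    rw [norm_div, norm_mul, norm_mul, norm_pow, Complex.norm_I, one_mul, Complex.norm_two]
    exact div_le_self (by positivity) (by linarith)
  have hp := norm_nonneg p
  have hq := norm_nonneg q
  have hs := norm_nonneg σ
  calc _ ≤ 1 / 4 * ‖p‖ + ‖σ‖ * ‖q‖ + ‖σ‖ ^ 2 * (‖p‖ + ‖q‖) := by
        refine (norm_sub_le _ _).trans (add_le_add ((norm_add_le _ _).trans ?_) ?_)
        · rw [norm_mul, norm_mul, norm_mul, norm_mul, Complex.norm_I, he, one_mul, one_mul]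
          gcongr
        · rw [norm_mul]
          gcongr
          refine (norm_add_le _ _).trans ?_
          rw [norm_mul, he, one_mul]
    _ ≤ _ := by nlinarith [mul_nonneg hs hp]

section

variable {σ τ : ℝ → ℂ} {n : ℤ} {ρ ρ' : ℂ} {S : ℝ}

theorem half_le_norm_of_near {n : ℤ} (hn : 1 ≤ |(n : ℝ)|) {ρ : ℂ} (hρ : ‖ρ - n‖ ≤ 1 / 4) :
    |(n : ℝ)| / 2 ≤ ‖ρ‖ ∧ 1 / 2 ≤ ‖ρ‖ ∧ |ρ.im| ≤ 1 / 4 := by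
  have h1 : ‖(n : ℂ)‖ = |(n : ℝ)| := by rw [Complex.norm_intCast]
  have h2 := norm_sub_norm_le (n : ℂ) ρ
  rw [norm_sub_rev] at h2
  have h3 := Complex.abs_im_le_norm (ρ - n)
  simp only [Complex.sub_im, Complex.intCast_im, sub_zero] at h3
  exact ⟨by linarith, by linarith, by linarith⟩

theorem slWave_norm_le_of_near (hσ : MemL2 σ) (hS : l2norm σ ≤ S) {n : ℤ} (hn : 1 ≤ |(n : ℝ)|)
    {ρ : ℂ} (hρ : ‖ρ - n‖ ≤ 1 / 4) {x : ℝ} (hx : x ∈ Set.Icc 0 Real.pi) :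
    ‖slWave σ ρ x‖ + ‖slWave σ (-ρ) x‖ ≤ 2 * Real.exp (2 * (2 * S + S ^ 2)) * Real.exp 1 := by
  obtain ⟨-, h2, h3⟩ := half_le_norm_of_near hn hρ
  refine (slWave_norm_le hσ hS h2 hx).trans ?_
  gcongr
  have h4 : x ≤ 4 := hx.2.trans Real.pi_lt_four.le
  have h5 := hx.1
  nlinarith [abs_nonneg ρ.im]

/-- One component of the system for the differences. -/
theorem waveDiff_le (hσ : MemL2 σ) (hτ : MemL2 τ) (hσS : l2norm σ ≤ S) (hτS : l2norm τ ≤ S)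
    (hn : 1 ≤ |(n : ℝ)|) (hρ : ‖ρ - n‖ ≤ 1 / 4) (hρ' : ‖ρ' - n‖ ≤ 1 / 4) {B : ℝ}
    (hB : B = 2 * Real.exp (2 * (2 * S + S ^ 2)) * Real.exp 1) {x : ℝ}
    (hx : x ∈ Set.Icc 0 Real.pi) :
    ‖waveDiff σ τ n ρ ρ' x‖ ≤
      B * (‖oscInt (fun x => τ x - σ x) n x‖ + ∫ t in (0 : ℝ)..Real.pi,
        (1 + ‖τ t‖ + ‖τ t‖ ^ 2) * ‖oscInt (fun x => τ x - σ x) n t‖) +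
      B * ((4 + 2 * S ^ 2) * ‖ρ' - ρ‖ + 2 * S * (l2norm (fun x => τ x - σ x) / |(n : ℝ)|)) +
      ∫ t in (0 : ℝ)..x, (1 + ‖σ t‖ + ‖σ t‖ ^ 2) *
        (‖waveDiff σ τ n ρ ρ' t‖ + ‖waveDiff σ τ (-n) (-ρ) (-ρ') t‖) := by
  obtain ⟨ha, hb, hc⟩ := half_le_norm_of_near hn hρ
  obtain ⟨ha', hb', hc'⟩ := half_le_norm_of_near hn hρ'
  have hρ0 : ρ ≠ 0 := by rw [← norm_pos_iff]; linarith
  have hρ'0 : ρ' ≠ 0 := by rw [← norm_pos_iff]; linarith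
  have hS0 : 0 ≤ S := (l2norm_nonneg σ).trans hσS
  have hBpos : 0 < B := by rw [hB]; positivity
  have hd : MemL2 fun x => τ x - σ x := hτ.sub hσ
  have hs := uIcc_subset_of_mem hx
  have hD := waveDiff_isPrim (n := n) hσ hτ hρ0 hρ'0
  have hDc := waveDiff_isPrim (n := -n) hσ hτ (neg_ne_zero.2 hρ0) (neg_ne_zero.2 hρ'0)
  have hbd : ∀ x ∈ Set.Icc 0 Real.pi, ‖gaugedWave τ n ρ' x‖ + ‖gaugedWave τ (-n) (-ρ') x‖ ≤ B :=
    fun x hx => by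
      rw [gaugedWave_norm, gaugedWave_norm, hB]
      exact slWave_norm_le_of_near hτ hτS hn hρ' hx
  have hg := gaugedWave_isPrim hτ (-n) (neg_ne_zero.2 hρ'0)
  -- the oscillating term
  have hosc := norm_integral_osc_mul_le (n := n) hd hg (C := B) hBpos.le
    (fun x hx => by linarith [hbd x hx, norm_nonneg (gaugedWave τ n ρ' x)])
    (W := fun t => 1 + ‖τ t‖ + ‖τ t‖ ^ 2) (fun t => by positivity) (intervalIntegrable_coeff hτ 1)
    (fun t ht => by
      have h1 := wave_coeff_norm_le (σ := τ t) (ρ := -ρ') (p := gaugedWave τ (-n) (-ρ') t)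
        (q := gaugedWave τ n ρ' t) (e := Complex.exp (2 * (Complex.I * ((-n : ℤ) : ℂ)) * t))
        (κ := ((-n : ℤ) : ℂ) - -ρ') (by rwa [norm_neg]) (by
          have : ((-n : ℤ) : ℂ) - -ρ' = ρ' - n := by push_cast; ring
          rwa [this]) (norm_exp_two_I_mul_int _ _)
      rw [neg_neg, neg_neg]
      refine h1.trans ?_
      rw [mul_comm B]
      gcongr
      rw [add_comm]
      exact hbd t ht) hx
  set r1 : ℝ → ℂ := fun x => (Complex.exp (2 * (Complex.I * n) * x) * (τ x - σ x)) *
    gaugedWave τ (-n) (-ρ') x with hr1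
  set r2 : ℝ → ℂ := fun x => Complex.I * (n - ρ) * waveDiff σ τ n ρ ρ' x +
        σ x * (Complex.exp (2 * (Complex.I * n) * x) * waveDiff σ τ (-n) (-ρ) (-ρ') x) -
        Complex.I * σ x ^ 2 / (2 * ρ) * (waveDiff σ τ n ρ ρ' x +
          Complex.exp (2 * (Complex.I * n) * x) * waveDiff σ τ (-n) (-ρ) (-ρ') x) with hr2
  set r3 : ℝ → ℂ := fun x => -(Complex.I * (ρ' - ρ)) * gaugedWave τ n ρ' x -
        Complex.I * (τ x ^ 2 / (2 * ρ') - σ x ^ 2 / (2 * ρ)) * (gaugedWave τ n ρ' x +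
          Complex.exp (2 * (Complex.I * n) * x) * gaugedWave τ (-n) (-ρ') x) with hr3
  have i1 : IntervalIntegrable r1 volume 0 Real.pi := by
    have := hg.continuousOn
    rw [← Set.uIcc_of_le Real.pi_pos.le] at this
    exact (oscInt_isPrim hd n).1.mul_continuousOn this
  have i23 : IntervalIntegrable (fun x => r2 x + r3 x) volume 0 Real.pi := by
    refine (hD.1.sub i1).congr fun t _ => ?_
    simp only [hr1, hr2, hr3]; ring
  set E : ℝ → ℝ := fun t => ‖waveDiff σ τ n ρ ρ' t‖ + ‖waveDiff σ τ (-n) (-ρ) (-ρ') t‖ with hE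
  have iE : IntervalIntegrable (fun t => (1 + ‖σ t‖ + ‖σ t‖ ^ 2) * E t) volume 0 Real.pi := by
    have : ContinuousOn E (Set.Icc 0 Real.pi) := hD.continuousOn.norm.add hDc.continuousOn.norm
    rw [← Set.uIcc_of_le Real.pi_pos.le] at this
    exact (intervalIntegrable_coeff hσ 1).mul_continuousOn this
  set w : ℝ → ℝ := fun t => B * (‖ρ' - ρ‖ * (1 + 2 * ‖σ t‖ ^ 2) + ‖τ t ^ 2 - σ t ^ 2‖ / |(n : ℝ)|)
    with hw
  have iw1 : IntervalIntegrable (fun t => ‖ρ' - ρ‖ * (1 + 2 * ‖σ t‖ ^ 2)) volume 0 Real.pi :=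
    ((continuous_const.intervalIntegrable _ _).add
      (hσ.intervalIntegrable_norm_sq.const_mul 2)).const_mul _
  have iw2 : IntervalIntegrable (fun t => ‖τ t ^ 2 - σ t ^ 2‖ / |(n : ℝ)|) volume 0 Real.pi :=
    (hτ.intervalIntegrable_sq.sub hσ.intervalIntegrable_sq).norm.div_const _
  have iw : IntervalIntegrable w volume 0 Real.pi := (iw1.add iw2).const_mul B
  have hw0 : ∀ t, 0 ≤ w t := fun t => by positivity
  have h23 : ∀ t ∈ Set.Icc 0 Real.pi, ‖r2 t + r3 t‖ ≤ (1 + ‖σ t‖ + ‖σ t‖ ^ 2) * E t + w t := by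
    intro t ht
    refine (norm_add_le _ _).trans (add_le_add ?_ ?_)
    · exact wave_coeff_norm_le hb (by rwa [norm_sub_rev]) (norm_exp_two_I_mul_int _ _)
    -- This splitting puts `1/ρ'` on `τ² - σ²`, as summability in `n` requires; the other term
    -- already contains `ρ' - ρ`.
    · have e1 : τ t ^ 2 / (2 * ρ') - σ t ^ 2 / (2 * ρ) =
          (τ t ^ 2 - σ t ^ 2) / (2 * ρ') - σ t ^ 2 * (ρ' - ρ) / (2 * ρ * ρ') := by
        field_simp
        ring
      have e2 : ‖τ t ^ 2 / (2 * ρ') - σ t ^ 2 / (2 * ρ)‖ ≤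
          ‖τ t ^ 2 - σ t ^ 2‖ / |(n : ℝ)| + 2 * ‖σ t‖ ^ 2 * ‖ρ' - ρ‖ := by
        rw [e1]
        refine (norm_sub_le _ _).trans (add_le_add ?_ ?_)
        · rw [norm_div, norm_mul, Complex.norm_two]
          gcongr
          linarith
        · rw [norm_div, norm_mul, norm_mul, norm_mul, norm_pow, Complex.norm_two,
            div_le_iff₀ (by positivity)]
          have h3 : 1 / 2 ≤ 2 * ‖ρ‖ * ‖ρ'‖ := by nlinarith
          have h4 : 0 ≤ ‖σ t‖ ^ 2 * ‖ρ' - ρ‖ := by positivity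
          nlinarith
      have hb1 := hbd t ht
      have n1 := norm_nonneg (gaugedWave τ n ρ' t)
      have n2 := norm_nonneg (gaugedWave τ (-n) (-ρ') t)
      have e3 : ‖gaugedWave τ n ρ' t + Complex.exp (2 * (Complex.I * n) * t) *
          gaugedWave τ (-n) (-ρ') t‖ ≤ B := by
        refine (norm_add_le _ _).trans ?_
        rwa [norm_mul, norm_exp_two_I_mul_int, one_mul]
      simp only [hr3, hw]
      calc _ ≤ ‖ρ' - ρ‖ * B + (‖τ t ^ 2 - σ t ^ 2‖ / |(n : ℝ)| +
            2 * ‖σ t‖ ^ 2 * ‖ρ' - ρ‖) * B := by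
            refine (norm_sub_le _ _).trans (add_le_add ?_ ?_)
            · rw [norm_mul, norm_neg, norm_mul, Complex.norm_I, one_mul]
              gcongr
              linarith
            · rw [norm_mul, norm_mul, Complex.norm_I, one_mul]
              gcongr
        _ = _ := by ring
  have h0 : waveDiff σ τ n ρ ρ' 0 = 0 := by
    simp [waveDiff, gaugedWave, slWave_zero hσ, slWave_zero hτ]
  have h1 := hD.2 x hx
  rw [h0, zero_add] at h1
  have h2 : waveDiff σ τ n ρ ρ' x =
      (∫ t in (0 : ℝ)..x, r1 t) + ∫ t in (0 : ℝ)..x, (r2 t + r3 t) := by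
    rw [← intervalIntegral.integral_add (i1.mono_set hs) (i23.mono_set hs)]
    exact h1
  have h3 : ‖∫ t in (0 : ℝ)..x, (r2 t + r3 t)‖ ≤
      ∫ t in (0 : ℝ)..x, ((1 + ‖σ t‖ + ‖σ t‖ ^ 2) * E t + w t) :=
    intervalIntegral.norm_integral_le_of_norm_le hx.1 (Eventually.of_forall fun t ht =>
      h23 t ⟨ht.1.le, ht.2.trans hx.2⟩) ((iE.add iw).mono_set hs)
  rw [intervalIntegral.integral_add (iE.mono_set hs) (iw.mono_set hs)] at h3
  have h4 := integral_mono_right hw0 iw hx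
  have h5 : ∫ t in (0 : ℝ)..Real.pi, w t ≤
      B * ((4 + 2 * S ^ 2) * ‖ρ' - ρ‖ + 2 * S * (l2norm (fun x => τ x - σ x) / |(n : ℝ)|)) := by
    simp only [hw]
    rw [intervalIntegral.integral_const_mul, intervalIntegral.integral_add iw1 iw2,
      intervalIntegral.integral_const_mul, intervalIntegral.integral_div,
      intervalIntegral.integral_add (continuous_const.intervalIntegrable _ _)
        (hσ.intervalIntegrable_norm_sq.const_mul 2), intervalIntegral.integral_const_mul,
      integral_norm_sq_eq hσ, intervalIntegral.integral_const, smul_eq_mul, sub_zero, mul_one]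
    have h6 := integral_norm_sq_sub_sq_le hτ hσ
    have h7 : l2norm σ ^ 2 ≤ S ^ 2 := by have := l2norm_nonneg σ; gcongr
    have h8 := l2norm_nonneg (fun x => τ x - σ x)
    have h9 : l2norm (fun x => τ x - σ x) * (l2norm τ + l2norm σ) ≤
      2 * S * l2norm (fun x => τ x - σ x) := by nlinarith
    refine mul_le_mul_of_nonneg_left (add_le_add ?_ ?_) hBpos.le
    · rw [mul_comm]
      gcongr
      exact Real.pi_lt_four.le
    · rw [← mul_div_assoc]
      gcongr
      exact h6.trans h9
  rw [h2]
  refine (norm_add_le _ _).trans ?_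
  linarith

end

/-- The weight used to sum oscillating integrals. -/
noncomputable def oscWeight (σ τ : ℝ → ℂ) (t : ℝ) : ℝ :=
  (1 + ‖σ t‖ + ‖σ t‖ ^ 2) + (1 + ‖τ t‖ + ‖τ t‖ ^ 2)

/-- The square summable majorant of the difference of two solutions. -/
noncomputable def oscMajorant (σ τ : ℝ → ℂ) (k : ℕ) (x : ℝ) : ℝ :=
  (‖oscInt (fun x => τ x - σ x) k x‖ + ‖oscInt (fun x => τ x - σ x) (-k) x‖) +
    (∫ t in (0 : ℝ)..Real.pi, oscWeight σ τ t *
      (‖oscInt (fun x => τ x - σ x) k t‖ + ‖oscInt (fun x => τ x - σ x) (-k) t‖)) +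
    l2norm (fun x => τ x - σ x) / k

section

variable {σ τ : ℝ → ℂ} {S : ℝ}

theorem oscWeight_nonneg (t : ℝ) : 0 ≤ oscWeight σ τ t := by unfold oscWeight; positivity

theorem oscWeight_intervalIntegrable (hσ : MemL2 σ) (hτ : MemL2 τ) :
    IntervalIntegrable (oscWeight σ τ) volume 0 Real.pi :=
  (intervalIntegrable_coeff hσ 1).add (intervalIntegrable_coeff hτ 1)

theorem integral_coeff_one_le (hσ : MemL2 σ) (hσS : l2norm σ ≤ S) :
    ∫ t in (0 : ℝ)..Real.pi, (1 + ‖σ t‖ + ‖σ t‖ ^ 2) ≤ 4 + 2 * S + S ^ 2 := by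
  have h1 := integral_coeff_le hσ 1 zero_le_one
  have h2 : l2norm σ ^ 2 ≤ S ^ 2 := by have := l2norm_nonneg σ; gcongr
  linarith

theorem integral_oscWeight_le (hσ : MemL2 σ) (hτ : MemL2 τ) (hσS : l2norm σ ≤ S)
    (hτS : l2norm τ ≤ S) :
    ∫ t in (0 : ℝ)..Real.pi, oscWeight σ τ t ≤ 2 * (4 + 2 * S + S ^ 2) := by
  unfold oscWeight
  rw [intervalIntegral.integral_add (intervalIntegrable_coeff hσ 1) (intervalIntegrable_coeff hτ 1)]
  linarith [integral_coeff_one_le hσ hσS, integral_coeff_one_le hτ hτS]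

theorem oscPair_continuousOn {f : ℝ → ℂ} (hf : MemL2 f) (k : ℕ) :
    ContinuousOn (fun t => ‖oscInt f k t‖ + ‖oscInt f (-k) t‖) (Set.Icc 0 Real.pi) :=
  (oscInt_isPrim hf _).continuousOn.norm.add (oscInt_isPrim hf _).continuousOn.norm

theorem oscMajorant_continuousOn (hσ : MemL2 σ) (hτ : MemL2 τ) (k : ℕ) :
    ContinuousOn (oscMajorant σ τ k) (Set.Icc 0 Real.pi) :=
  ((oscPair_continuousOn (hτ.sub hσ) k).add continuousOn_const).add continuousOn_const

theorem oscMajorant_nonneg (k : ℕ) (x : ℝ) : 0 ≤ oscMajorant σ τ k x := by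
  have h1 : 0 ≤ ∫ t in (0 : ℝ)..Real.pi, oscWeight σ τ t *
      (‖oscInt (fun x => τ x - σ x) k t‖ + ‖oscInt (fun x => τ x - σ x) (-k) t‖) :=
    intervalIntegral.integral_nonneg Real.pi_pos.le fun t _ =>
      mul_nonneg (oscWeight_nonneg t) (by positivity)
  have h2 := l2norm_nonneg (fun x => τ x - σ x)
  unfold oscMajorant
  positivity

theorem sum_oscPair_sq_le {f : ℝ → ℂ} (hf : MemL2 f) (s : Finset ℕ) {x : ℝ}
    (hx : x ∈ Set.Icc 0 Real.pi) :
    ∑ k ∈ s, (‖oscInt f k x‖ + ‖oscInt f (-k) x‖) ^ 2 ≤ 16 * l2norm f ^ 2 := by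
  have h1 := bessel_oscInt hf (s.map Nat.castEmbedding) hx
  have h2 := bessel_oscInt hf ((s.map Nat.castEmbedding).map (Equiv.neg ℤ).toEmbedding) hx
  simp only [Finset.sum_map, Nat.castEmbedding_apply, Equiv.coe_toEmbedding,
    Equiv.neg_apply] at h1 h2
  calc _ ≤ ∑ k ∈ s, (2 * ‖oscInt f k x‖ ^ 2 + 2 * ‖oscInt f (-k) x‖ ^ 2) :=
        Finset.sum_le_sum fun k _ => by
          nlinarith [sq_nonneg (‖oscInt f k x‖ - ‖oscInt f (-k) x‖)]
    _ ≤ _ := by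
        rw [Finset.sum_add_distrib, ← Finset.mul_sum, ← Finset.mul_sum]
        linarith

/-- Three sources of summability: Bessel's inequality at `x`; Bessel's inequality at every `t`,
integrated against the weight after Cauchy–Schwarz; and convergence of the series of `1/k²`. -/
theorem sum_oscMajorant_sq_le (hσ : MemL2 σ) (hτ : MemL2 τ) (hσS : l2norm σ ≤ S)
    (hτS : l2norm τ ≤ S) (s : Finset ℕ) {x : ℝ} (hx : x ∈ Set.Icc 0 Real.pi) :
    ∑ k ∈ s, oscMajorant σ τ k x ^ 2 ≤
      3 * (16 + 16 * (2 * (4 + 2 * S + S ^ 2)) ^ 2 + ∑' k : ℕ, 1 / (k : ℝ) ^ 2) *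
        l2norm (fun x => τ x - σ x) ^ 2 := by
  set f : ℝ → ℂ := fun x => τ x - σ x with hf
  have hfm : MemL2 f := hτ.sub hσ
  have hS0 : 0 ≤ S := (l2norm_nonneg σ).trans hσS
  set w := 2 * (4 + 2 * S + S ^ 2) with hw
  have hwpos : 0 < w := by positivity
  have hWi := oscWeight_intervalIntegrable hσ hτ
  have hWw := integral_oscWeight_le hσ hτ hσS hτS
  set g : ℕ → ℝ → ℝ := fun k t => ‖oscInt f k t‖ + ‖oscInt f (-k) t‖ with hg
  have hgc : ∀ k, ContinuousOn (g k) (Set.Icc 0 Real.pi) := oscPair_continuousOn hfm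
  have h2 : ∑ k ∈ s, (∫ t in (0 : ℝ)..Real.pi, oscWeight σ τ t * g k t) ^ 2 ≤
      16 * w ^ 2 * l2norm f ^ 2 := by
    have hi : ∀ k ∈ s, IntervalIntegrable (fun t => oscWeight σ τ t * g k t ^ 2)
        volume 0 Real.pi := fun k _ => by
      have := (hgc k).pow 2
      rw [← Set.uIcc_of_le Real.pi_pos.le] at this
      exact hWi.mul_continuousOn this
    calc _ ≤ ∑ k ∈ s, w * ∫ t in (0 : ℝ)..Real.pi, oscWeight σ τ t * g k t ^ 2 :=
          Finset.sum_le_sum fun k _ => sq_integral_weight_le hwpos oscWeight_nonneg hWi hWw (hgc k)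
      _ = w * ∫ t in (0 : ℝ)..Real.pi, ∑ k ∈ s, oscWeight σ τ t * g k t ^ 2 := by
          rw [← Finset.mul_sum, intervalIntegral.integral_finsetSum hi]
      _ ≤ w * ∫ t in (0 : ℝ)..Real.pi, oscWeight σ τ t * (16 * l2norm f ^ 2) := by
          refine mul_le_mul_of_nonneg_left ?_ hwpos.le
          refine intervalIntegral.integral_mono_on Real.pi_pos.le
            (by simpa only [Finset.sum_fn] using IntervalIntegrable.sum s hi) (hWi.mul_const _) fun t ht => ?_
          rw [← Finset.mul_sum]
          exact mul_le_mul_of_nonneg_left (sum_oscPair_sq_le hfm s ht) (oscWeight_nonneg t)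
      _ ≤ w * (w * (16 * l2norm f ^ 2)) := by
          rw [intervalIntegral.integral_mul_const]
          gcongr
      _ = _ := by ring
  -- The index `k = 0` is harmless: both sides use the convention that division by zero gives zero.
  have h3 : ∑ k ∈ s, (l2norm f / k) ^ 2 ≤ (∑' k : ℕ, 1 / (k : ℝ) ^ 2) * l2norm f ^ 2 := by
    calc _ = (∑ k ∈ s, 1 / (k : ℝ) ^ 2) * l2norm f ^ 2 := by
          rw [Finset.sum_mul]
          exact Finset.sum_congr rfl fun k _ => by rw [div_pow]; ring
      _ ≤ _ := by
          gcongr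
          exact (Real.summable_one_div_nat_pow.2 one_lt_two).sum_le_tsum _
            fun _ _ => by positivity
  calc _ ≤ ∑ k ∈ s, 3 * (g k x ^ 2 + (∫ t in (0 : ℝ)..Real.pi, oscWeight σ τ t * g k t) ^ 2 +
        (l2norm f / k) ^ 2) := Finset.sum_le_sum fun k _ => by
        simp only [oscMajorant, ← hf]
        set a := g k x with ha
        set b := ∫ t in (0 : ℝ)..Real.pi, oscWeight σ τ t * g k t with hb
        set c := l2norm f / k
        change (a + b + c) ^ 2 ≤ _
        nlinarith [sq_nonneg (a - b), sq_nonneg (b - c), sq_nonneg (a - c)]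
    _ ≤ 3 * (16 * l2norm f ^ 2 + 16 * w ^ 2 * l2norm f ^ 2 +
        (∑' k : ℕ, 1 / (k : ℝ) ^ 2) * l2norm f ^ 2) := by
        rw [← Finset.mul_sum, Finset.sum_add_distrib, Finset.sum_add_distrib]
        gcongr
        exact sum_oscPair_sq_le hfm s hx
    _ = _ := by ring

/-- The bound for one wave involves its companion, so the bounds for both signs are added and
Grönwall closes the system. -/
theorem waveDiff_pair_le (hσ : MemL2 σ) (hτ : MemL2 τ) (hσS : l2norm σ ≤ S) (hτS : l2norm τ ≤ S)
    {k : ℕ} (hk : 1 ≤ k) {ρ ρ' : ℂ} (hρ : ‖ρ - k‖ ≤ 1 / 4) (hρ' : ‖ρ' - k‖ ≤ 1 / 4) {B w : ℝ}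
    (hB : B = 2 * Real.exp (2 * (2 * S + S ^ 2)) * Real.exp 1 * (1 + 2 * (4 + 2 * S ^ 2) + 4 * S))
    (hw : w = 4 + 2 * S + S ^ 2) {x : ℝ} (hx : x ∈ Set.Icc 0 Real.pi) :
    ‖waveDiff σ τ k ρ ρ' x‖ + ‖waveDiff σ τ (-k) (-ρ) (-ρ') x‖ ≤
      B * (1 + (2 + 2 * w) * Real.exp (2 * w)) * (oscMajorant σ τ k x + ‖ρ' - ρ‖) := by
  have hS0 : 0 ≤ S := (l2norm_nonneg σ).trans hσS
  have hkr : (1 : ℝ) ≤ k := by exact_mod_cast hk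
  have habs : |((k : ℤ) : ℝ)| = k := by simp
  have habs' : |((-k : ℤ) : ℝ)| = k := by simp
  have hρ0 : ρ ≠ 0 := by
    have := (half_le_norm_of_near (n := k) (by rw [habs]; exact hkr) (by simpa using hρ)).2.1
    rw [← norm_pos_iff]; linarith
  have hρ'0 : ρ' ≠ 0 := by
    have := (half_le_norm_of_near (n := k) (by rw [habs]; exact hkr) (by simpa using hρ')).2.1
    rw [← norm_pos_iff]; linarith
  have hneg : ∀ r : ℂ, ‖r - k‖ ≤ 1 / 4 → ‖-r - ((-k : ℤ) : ℂ)‖ ≤ 1 / 4 := fun r hr => by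
    have : -r - ((-k : ℤ) : ℂ) = -(r - k) := by push_cast; ring
    rwa [this, norm_neg]
  set f : ℝ → ℂ := fun x => τ x - σ x with hf
  have hfm : MemL2 f := hτ.sub hσ
  set E : ℝ → ℝ := fun x => ‖waveDiff σ τ k ρ ρ' x‖ + ‖waveDiff σ τ (-k) (-ρ) (-ρ') x‖ with hE
  have hEc : ContinuousOn E (Set.Icc 0 Real.pi) :=
    (waveDiff_isPrim hσ hτ hρ0 hρ'0).continuousOn.norm.add
      (waveDiff_isPrim hσ hτ (neg_ne_zero.2 hρ0) (neg_ne_zero.2 hρ'0)).continuousOn.norm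
  set g : ℝ → ℝ := fun t => ‖oscInt f k t‖ + ‖oscInt f (-k) t‖ with hg
  have hgc : ContinuousOn g (Set.Icc 0 Real.pi) := oscPair_continuousOn hfm k
  have hg0 : ∀ t, 0 ≤ g t := fun t => by positivity
  have hgc' := hgc
  have hEc' := hEc
  rw [← Set.uIcc_of_le Real.pi_pos.le] at hgc' hEc'
  have iσ := intervalIntegrable_coeff hσ 1
  have iτ := intervalIntegrable_coeff hτ 1
  have iWg : IntervalIntegrable (fun t => oscWeight σ τ t * g t) volume 0 Real.pi :=
    (oscWeight_intervalIntegrable hσ hτ).mul_continuousOn hgc'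
  set J := ∫ t in (0 : ℝ)..Real.pi, oscWeight σ τ t * g t with hJ
  have hJ0 : 0 ≤ J := intervalIntegral.integral_nonneg Real.pi_pos.le fun t _ =>
    mul_nonneg (oscWeight_nonneg t) (hg0 t)
  have hJσ : ∫ t in (0 : ℝ)..Real.pi, (1 + ‖σ t‖ + ‖σ t‖ ^ 2) * g t ≤ J := by
    refine intervalIntegral.integral_mono_on Real.pi_pos.le (iσ.mul_continuousOn hgc') iWg
      fun t _ => mul_le_mul_of_nonneg_right ?_ (hg0 t)
    have : 0 ≤ 1 + ‖τ t‖ + ‖τ t‖ ^ 2 := by positivity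
    simp only [oscWeight]; linarith
  have hJτ : ∫ t in (0 : ℝ)..Real.pi, (1 + ‖τ t‖ + ‖τ t‖ ^ 2) * g t ≤ J := by
    refine intervalIntegral.integral_mono_on Real.pi_pos.le (iτ.mul_continuousOn hgc') iWg
      fun t _ => mul_le_mul_of_nonneg_right ?_ (hg0 t)
    have : 0 ≤ 1 + ‖σ t‖ + ‖σ t‖ ^ 2 := by positivity
    simp only [oscWeight]; linarith
  set B0 := 2 * Real.exp (2 * (2 * S + S ^ 2)) * Real.exp 1 with hB0
  have hB0pos : 0 < B0 := by positivity
  have hBpos : 0 < B := by rw [hB]; positivity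
  set q := l2norm f / k with hq
  have hq0 : 0 ≤ q := div_nonneg (l2norm_nonneg f) (by positivity)
  set d := ‖ρ' - ρ‖ with hd
  have hd0 : 0 ≤ d := norm_nonneg _
  set K := B * (J + q + d) with hK
  have hK0 : 0 ≤ K := by positivity
  -- The free term keeps `g` pointwise: Bessel's inequality sums `g x ^ 2` over `k` for each fixed
  -- `x`, not the squares of suprema over `x`.
  have key := gronwall_integrable_free (F := fun t => B * g t + K)
    (h := fun t => 2 * (1 + ‖σ t‖ + ‖σ t‖ ^ 2)) hEc ((continuousOn_const.mul hgc).add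
      continuousOn_const) (fun t _ => by have := hg0 t; positivity) (fun t => by positivity)
    (iσ.const_mul 2) (fun y hy => by
      have h1 := waveDiff_le (n := k) hσ hτ hσS hτS (by rw [habs]; exact hkr) (by simpa using hρ)
        (by simpa using hρ') hB0 hy
      have h2 := waveDiff_le (n := -k) (ρ := -ρ) (ρ' := -ρ') hσ hτ hσS hτS
        (by rw [habs']; exact hkr) (hneg ρ hρ) (hneg ρ' hρ') hB0 hy
      have hdd : ‖-ρ' - -ρ‖ = d := by rw [hd, ← norm_neg (ρ' - ρ)]; congr 1; ring
      rw [habs] at h1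
      simp only [neg_neg, habs', hdd] at h2
      have e1 : ∫ t in (0 : ℝ)..Real.pi, (1 + ‖τ t‖ + ‖τ t‖ ^ 2) * g t =
          (∫ t in (0 : ℝ)..Real.pi, (1 + ‖τ t‖ + ‖τ t‖ ^ 2) * ‖oscInt f k t‖) +
          ∫ t in (0 : ℝ)..Real.pi, (1 + ‖τ t‖ + ‖τ t‖ ^ 2) * ‖oscInt f (-k) t‖ := by
        have c1 := (oscInt_isPrim hfm k).continuousOn.norm
        have c2 := (oscInt_isPrim hfm (-k)).continuousOn.norm
        rw [← Set.uIcc_of_le Real.pi_pos.le] at c1 c2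
        rw [← intervalIntegral.integral_add (iτ.mul_continuousOn c1) (iτ.mul_continuousOn c2)]
        congr 1; ext t; ring
      have e2 : ∫ t in (0 : ℝ)..y, 2 * (1 + ‖σ t‖ + ‖σ t‖ ^ 2) * E t =
          2 * ∫ t in (0 : ℝ)..y, (1 + ‖σ t‖ + ‖σ t‖ ^ 2) * E t := by
        rw [← intervalIntegral.integral_const_mul]
        congr 1; ext t; ring
      have e3 : ∫ t in (0 : ℝ)..y, (1 + ‖σ t‖ + ‖σ t‖ ^ 2) *
          (‖waveDiff σ τ (-k) (-ρ) (-ρ') t‖ + ‖waveDiff σ τ k ρ ρ' t‖) =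
          ∫ t in (0 : ℝ)..y, (1 + ‖σ t‖ + ‖σ t‖ ^ 2) * E t := by
        congr 1; ext t; simp only [hE]; ring
      rw [e2]
      rw [e3] at h2
      have h3 : B0 * (g y + ∫ t in (0 : ℝ)..Real.pi, (1 + ‖τ t‖ + ‖τ t‖ ^ 2) * g t) +
          2 * (B0 * ((4 + 2 * S ^ 2) * d + 2 * S * q)) ≤ B * g y + K := by
        have hgy := hg0 y
        have : B0 * (g y + ∫ t in (0 : ℝ)..Real.pi, (1 + ‖τ t‖ + ‖τ t‖ ^ 2) * g t) ≤
            B0 * (g y + J) := by gcongr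
        refine (add_le_add this le_rfl).trans ?_
        rw [hK, hB]
        have p1 : 0 ≤ B0 * (2 * (4 + 2 * S ^ 2) + 4 * S) * (g y + J) := by positivity
        have p2 : 0 ≤ B0 * (1 + 4 * S) * d := by positivity
        have p3 : 0 ≤ B0 * (1 + 2 * (4 + 2 * S ^ 2)) * q := by positivity
        linarith
      rw [e1] at h3
      simp only [hE, hg] at h3 ⊢
      linarith) x hx
  refine key.trans ?_
  have hwσ := integral_coeff_one_le hσ hσS
  rw [← hw] at hwσ
  have hwpos : 0 < w := by rw [hw]; positivity
  have e4 : ∫ t in (0 : ℝ)..Real.pi, 2 * (1 + ‖σ t‖ + ‖σ t‖ ^ 2) * (B * g t + K) ≤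
      2 * B * J + 2 * K * w := by
    have : ∫ t in (0 : ℝ)..Real.pi, 2 * (1 + ‖σ t‖ + ‖σ t‖ ^ 2) * (B * g t + K) =
        2 * B * (∫ t in (0 : ℝ)..Real.pi, (1 + ‖σ t‖ + ‖σ t‖ ^ 2) * g t) +
        2 * K * ∫ t in (0 : ℝ)..Real.pi, (1 + ‖σ t‖ + ‖σ t‖ ^ 2) := by
      rw [← intervalIntegral.integral_const_mul, ← intervalIntegral.integral_const_mul,
        ← intervalIntegral.integral_add ((iσ.mul_continuousOn hgc').const_mul _) (iσ.const_mul _)]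
      congr 1; ext t; ring
    rw [this]
    gcongr
  have e5 : Real.exp (∫ t in (0 : ℝ)..Real.pi, 2 * (1 + ‖σ t‖ + ‖σ t‖ ^ 2)) ≤
      Real.exp (2 * w) := by
    rw [intervalIntegral.integral_const_mul]
    gcongr
  set X := Real.exp (2 * w) with hX
  have hXpos : 0 < X := Real.exp_pos _
  have e6 := mul_le_mul e4 e5 (Real.exp_pos _).le (by positivity)
  refine (add_le_add le_rfl e6).trans ?_
  have e7 : oscMajorant σ τ k x = g x + J + q := rfl
  rw [e7, hK]
  have hgx := hg0 x
  have p1 : 0 ≤ B * (2 + 2 * w) * X * g x := by positivity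
  have p2 : 0 ≤ B * 2 * X * (q + d) := by positivity
  linarith

/-- The difference of the solutions of two problems near the points `ρ = k` is square summable
in `k`, with a norm controlled by the difference of the potentials. -/
theorem slPhi_sub_near (S : ℝ) (hS : 0 ≤ S) : ∃ C > 0, ∀ σ τ : ℝ → ℂ, MemL2 σ → MemL2 τ →
    l2norm σ ≤ S → l2norm τ ≤ S →
    (∀ s : Finset ℕ, ∀ x ∈ Set.Icc 0 Real.pi, ∑ k ∈ s, oscMajorant σ τ k x ^ 2 ≤
      C * l2norm (fun x => τ x - σ x) ^ 2) ∧
    ∀ k : ℕ, 1 ≤ k → ∀ ρ ρ' : ℂ, ‖ρ - k‖ ≤ 1 / 4 → ‖ρ' - k‖ ≤ 1 / 4 → ∀ x ∈ Set.Icc 0 Real.pi,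
      ‖slPhi τ x (ρ' ^ 2) - slPhi σ x (ρ ^ 2)‖ ≤ C * (oscMajorant σ τ k x + ‖ρ' - ρ‖) ∧
      ‖slPhiQuasi τ x (ρ' ^ 2) / ρ' - slPhiQuasi σ x (ρ ^ 2) / ρ‖ ≤
        C * (oscMajorant σ τ k x + ‖ρ' - ρ‖) ∧
      ‖slPhi σ x (ρ ^ 2)‖ ≤ C := by
  set C1 := 3 * (16 + 16 * (2 * (4 + 2 * S + S ^ 2)) ^ 2 + ∑' k : ℕ, 1 / (k : ℝ) ^ 2)
  set B := 2 * Real.exp (2 * (2 * S + S ^ 2)) * Real.exp 1 * (1 + 2 * (4 + 2 * S ^ 2) + 4 * S)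
    with hB
  set w := 4 + 2 * S + S ^ 2 with hw
  set C2 := B * (1 + (2 + 2 * w) * Real.exp (2 * w)) with hC2
  set C3 := 2 * Real.exp (2 * (2 * S + S ^ 2)) * Real.exp 1 with hC3
  have hz : 0 ≤ ∑' k : ℕ, 1 / (k : ℝ) ^ 2 := tsum_nonneg fun _ => by positivity
  have p1 : 0 < C1 := by positivity
  have p2 : 0 < C2 := by positivity
  have p3 : 0 < C3 := by positivity
  refine ⟨C1 + C2 + C3, by positivity, fun σ τ hσ hτ hσS hτS => ⟨fun s x hx => ?_, ?_⟩⟩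
  · refine (sum_oscMajorant_sq_le hσ hτ hσS hτS s hx).trans ?_
    gcongr
    linarith
  · intro k hk ρ ρ' hρ hρ' x hx
    have hkr : (1 : ℝ) ≤ k := by exact_mod_cast hk
    have habs : |((k : ℤ) : ℝ)| = k := by simp
    have h0 : ∀ r : ℂ, ‖r - k‖ ≤ 1 / 4 → r ≠ 0 := fun r hr => by
      have := (half_le_norm_of_near (n := k) (by rw [habs]; exact hkr) (by simpa using hr)).2.1
      rw [← norm_pos_iff]; linarith
    have h1 := waveDiff_pair_le hσ hτ hσS hτS hk hρ hρ' hB hw hx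
    rw [← hC2] at h1
    have h2 : C2 * (oscMajorant σ τ k x + ‖ρ' - ρ‖) ≤
        (C1 + C2 + C3) * (oscMajorant σ τ k x + ‖ρ' - ρ‖) := by
      refine mul_le_mul_of_nonneg_right (by linarith) ?_
      exact add_nonneg (oscMajorant_nonneg k x) (norm_nonneg _)
    have hd : ∀ (n : ℤ) (r r' : ℂ), ‖waveDiff σ τ n r r' x‖ = ‖slWave τ r' x - slWave σ r x‖ := by
      intro n r r'
      rw [waveDiff, gaugedWave, gaugedWave, ← mul_sub, norm_mul, norm_exp_I_mul_int, one_mul]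
    rw [hd, hd] at h1
    set p := slWave τ ρ' x - slWave σ ρ x with hp
    set q := slWave τ (-ρ') x - slWave σ (-ρ) x with hq
    have n1 := norm_nonneg p
    have n2 := norm_nonneg q
    refine ⟨?_, ?_, ?_⟩
    · have e : slPhi τ x (ρ' ^ 2) - slPhi σ x (ρ ^ 2) = (p + q) / 2 := by
        rw [slPhi_eq_wave, slPhi_eq_wave σ, hp, hq]; ring
      rw [e, norm_div, Complex.norm_two]
      have := norm_add_le p q
      linarith
    · have e : slPhiQuasi τ x (ρ' ^ 2) / ρ' - slPhiQuasi σ x (ρ ^ 2) / ρ =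
          (p - q) / (2 * Complex.I) := by
        rw [slPhiQuasi_eq_wave τ (h0 ρ' hρ'), slPhiQuasi_eq_wave σ (h0 ρ hρ),
          mul_div_cancel_left₀ _ (h0 ρ' hρ'), mul_div_cancel_left₀ _ (h0 ρ hρ), hp, hq]
        ring
      rw [e, norm_div, norm_mul, Complex.norm_two, Complex.norm_I, mul_one]
      have := norm_sub_le p q
      linarith
    · have h3 := slWave_norm_le_of_near (n := k) (ρ := ρ) hσ hσS (by rw [habs]; exact hkr)
        (by simpa using hρ) hx
      rw [← hC3] at h3
      rw [slPhi_eq_wave, norm_div, Complex.norm_two]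
      have := norm_add_le (slWave σ ρ x) (slWave σ (-ρ) x)
      linarith

end

/-! ### Localisation of the large zeros of `Δ` -/

/-- With `w = exp(2πiρ)` one has `|sin πρ| = exp(π Im ρ) |1 - w| / 2`. If `|w - 1| < 4r ≤ 1/2`, then
`|log w| < 6r`; but `log w` is `2πi` times the difference of `ρ` and an integer, so its modulus is
at least `2πr`. -/
theorem norm_sin_lower_im {r : ℝ} (hr : 0 < r) (hr' : r ≤ 1 / 8) {ρ : ℂ}
    (h : ∀ k : ℤ, r ≤ ‖ρ - k‖) :
    2 * r * Real.exp (ρ.im * Real.pi) ≤ ‖Complex.sin (ρ * Real.pi)‖ := by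
  set w := Complex.exp (2 * Real.pi * Complex.I * ρ) with hw
  have key : 4 * r ≤ ‖1 - w‖ := by
    by_contra hlt
    push Not at hlt
    set z := w - 1 with hz
    have hzn : ‖z‖ < 4 * r := by rwa [hz, norm_sub_rev]
    have h1 := Complex.norm_log_one_add_half_le_self (z := z) (by linarith)
    have hz1 : 1 + z = w := by rw [hz]; ring
    have hw0 : w ≠ 0 := Complex.exp_ne_zero _
    rw [hz1] at h1
    obtain ⟨n, hn⟩ := Complex.exp_eq_exp_iff_exists_int.1
      ((Complex.exp_log hw0).trans hw)
    have h2 : Complex.log w = 2 * Real.pi * Complex.I * (ρ - (-n : ℤ)) := by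
      rw [hn]; push_cast; ring
    have h3 := h (-n)
    rw [h2, norm_mul, norm_mul, norm_mul, Complex.norm_I, Complex.norm_two, Complex.norm_real,
      Real.norm_of_nonneg Real.pi_pos.le, mul_one] at h1
    nlinarith [Real.pi_gt_three]
  have e : Complex.sin (ρ * Real.pi) =
      Complex.exp (-(ρ * Real.pi) * Complex.I) * ((1 - w) * (Complex.I / 2)) := by
    have : Complex.exp (ρ * Real.pi * Complex.I) =
        Complex.exp (-(ρ * Real.pi) * Complex.I) * w := by
      rw [hw, ← Complex.exp_add]; ring_nf
    rw [Complex.sin, this]; ring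
  have e2 : ‖Complex.exp (-(ρ * Real.pi) * Complex.I)‖ = Real.exp (ρ.im * Real.pi) := by
    rw [Complex.norm_exp]; simp
  rw [e, norm_mul, norm_mul, e2, norm_div, Complex.norm_I, Complex.norm_two]
  have := Real.exp_pos (ρ.im * Real.pi)
  nlinarith

/-- The sine is large away from its zeros. -/
theorem norm_sin_lower {r : ℝ} (hr : 0 < r) (hr' : r ≤ 1 / 8) {ρ : ℂ} (h : ∀ k : ℤ, r ≤ ‖ρ - k‖) :
    2 * r * Real.exp (|ρ.im| * Real.pi) ≤ ‖Complex.sin (ρ * Real.pi)‖ := by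
  rcases le_total 0 ρ.im with him | him
  · rw [abs_of_nonneg him]
    exact norm_sin_lower_im hr hr' h
  · have := norm_sin_lower_im hr hr' (ρ := -ρ) fun k => by
      have h1 := h (-k)
      have : -ρ - k = -(ρ - ((-k : ℤ) : ℂ)) := by push_cast; ring
      rwa [this, norm_neg]
    rw [neg_mul, Complex.sin_neg, norm_neg] at this
    rwa [abs_of_nonpos him]

theorem norm_cos_mul_le (ρ : ℂ) {x : ℝ} (hx : 0 ≤ x) :
    ‖Complex.cos (ρ * x)‖ ≤ Real.exp (|ρ.im| * x) := by
  have h1 : ∀ c : ℂ, |c.re| ≤ |ρ.im| → ‖Complex.exp (c * x)‖ ≤ Real.exp (|ρ.im| * x) :=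
    fun c hc => norm_cexp_mul_le hc hx
  have ea : -(ρ * (x : ℂ)) * Complex.I = -(Complex.I * ρ) * x := by ring
  have eb : ρ * (x : ℂ) * Complex.I = Complex.I * ρ * x := by ring
  rw [Complex.cos, ea, eb, norm_div, Complex.norm_two]
  have h2 := h1 (Complex.I * ρ) (by simp)
  have h3 := h1 (-(Complex.I * ρ)) (by simp)
  have := norm_add_le (Complex.exp (Complex.I * ρ * x)) (Complex.exp (-(Complex.I * ρ) * x))
  linarith

theorem norm_cos_sub_cos_le {ρ : ℂ} {k : ℕ} (hρ : ‖ρ - k‖ ≤ 1 / 100) {x : ℝ}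
    (hx : x ∈ Set.Icc 0 Real.pi) : ‖Complex.cos (ρ * x) - Complex.cos (k * x)‖ ≤ 8 / 100 := by
  have h1 : ‖Complex.I * (ρ - k) * x‖ ≤ 4 / 100 := by
    rw [norm_mul, norm_mul, Complex.norm_I, one_mul, Complex.norm_real, Real.norm_of_nonneg hx.1]
    have : x ≤ 4 := hx.2.trans Real.pi_lt_four.le
    calc _ ≤ 1 / 100 * (4 : ℝ) := by have := hx.1; gcongr
      _ = _ := by norm_num
  have key : ∀ s : ℂ, s = 1 ∨ s = -1 →
      ‖Complex.exp (s * (ρ * x * Complex.I)) - Complex.exp (s * (k * x * Complex.I))‖ ≤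
        8 / 100 := by
    intro s hs
    have e : Complex.exp (s * (ρ * x * Complex.I)) - Complex.exp (s * (k * x * Complex.I)) =
        Complex.exp (s * (k * x * Complex.I)) *
          (Complex.exp (s * (Complex.I * (ρ - k) * x)) - 1) := by
      rw [mul_sub, mul_one, ← Complex.exp_add]
      ring_nf
    have hn : ‖s * (Complex.I * (ρ - k) * x)‖ ≤ 4 / 100 := by
      rcases hs with rfl | rfl
      · rwa [one_mul]
      · rwa [neg_one_mul, norm_neg]
    have h2 := Complex.norm_exp_sub_one_le (x := s * (Complex.I * (ρ - k) * x)) (by linarith)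
    have h3 : ‖Complex.exp (s * (k * x * Complex.I))‖ = 1 := by
      rw [Complex.norm_exp]
      rcases hs with rfl | rfl <;> simp
    rw [e, norm_mul, h3, one_mul]
    linarith
  have h2 := key 1 (Or.inl rfl)
  have h3 := key (-1) (Or.inr rfl)
  rw [one_mul, one_mul] at h2
  rw [neg_one_mul, neg_one_mul, ← neg_mul, ← neg_mul (k * x : ℂ)] at h3
  have e : Complex.cos (ρ * x) - Complex.cos (k * x) =
      ((Complex.exp (ρ * x * Complex.I) - Complex.exp (k * x * Complex.I)) +
      (Complex.exp (-(ρ * x) * Complex.I) - Complex.exp (-(k * x) * Complex.I))) / 2 := by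
    rw [Complex.cos, Complex.cos]; ring
  rw [e, norm_div, Complex.norm_two]
  linarith [norm_add_le (Complex.exp (ρ * x * Complex.I) - Complex.exp (k * x * Complex.I))
    (Complex.exp (-(ρ * x) * Complex.I) - Complex.exp (-(k * x) * Complex.I))]

theorem integral_cos_nat_mul_sq {k : ℕ} (hk : 1 ≤ k) :
    ∫ x in (0 : ℝ)..Real.pi, Complex.cos (k * x) * Complex.cos (k * x) = (Real.pi / 2 : ℝ) := by
  have h1 : ∀ x : ℝ, Complex.cos (k * x) * Complex.cos (k * x) =
      ((Real.cos (k * x) ^ 2 : ℝ) : ℂ) := by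
    intro x; push_cast; ring
  have hk0 : (k : ℝ) ≠ 0 := by positivity
  simp only [h1]
  rw [intervalIntegral.integral_ofReal, intervalIntegral.integral_comp_mul_left
    (fun x => Real.cos x ^ 2) hk0, integral_cos_sq, Real.sin_nat_mul_pi]
  simp only [mul_zero, Real.sin_zero, sub_zero, zero_add, smul_eq_mul]
  field_simp

/-- A minimum modulus principle: existence of a zero inside a disc. -/
theorem exists_zero_mem_ball {f : ℂ → ℂ} (hf : Differentiable ℂ f) {c : ℂ} {r m : ℝ} (hr : 0 < r)
    (hc : ‖f c‖ < m) (hm : ∀ z ∈ Metric.sphere c r, m ≤ ‖f z‖) :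
    ∃ z ∈ Metric.ball c r, f z = 0 := by
  by_contra hcon
  push Not at hcon
  have hm0 : 0 < m := (norm_nonneg _).trans_lt hc
  have hne : ∀ z ∈ Metric.closedBall c r, f z ≠ 0 := by
    intro z hz h0
    rcases (Metric.mem_closedBall.1 hz).lt_or_eq with h | h
    · exact hcon z h h0
    · have := hm z h
      rw [h0, norm_zero] at this
      linarith
  -- Without zeros, the maximum modulus principle would apply to `1/f`.
  have hd : DiffContOnCl ℂ (fun z => (f z)⁻¹) (Metric.ball c r) := by
    refine (hf.diffContOnCl).inv fun z hz => hne z ?_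
    rwa [closure_ball c hr.ne'] at hz
  have h := Complex.norm_le_of_forall_mem_frontier_norm_le Metric.isBounded_ball hd (C := m⁻¹)
    (fun z hz => by
      rw [frontier_ball c hr.ne'] at hz
      rw [norm_inv]
      exact inv_anti₀ hm0 (hm z hz)) (subset_closure (Metric.mem_ball_self hr))
  rw [norm_inv] at h
  have hc0 : 0 < ‖f c‖ := norm_pos_iff.2 (hne c (Metric.mem_closedBall_self hr.le))
  exact absurd hc (not_lt.2 ((inv_le_inv₀ hc0 hm0).1 h))

/-- Control of the large zeros of the characteristic function: they lie near the squares of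
integers, and there is at least one near each of them. -/
structure TailControl (σ : ℝ → ℂ) (H : ℂ) (R : ℝ) : Prop where
  near : ∀ ρ : ℂ, R ≤ ‖ρ‖ → slCharFun σ H (ρ ^ 2) = 0 → ∃ k : ℤ, ‖ρ - k‖ < 1 / 100
  exists_zero : ∀ k : ℕ, R + 1 ≤ k → ∃ ρ : ℂ, ‖ρ - k‖ < 1 / 100 ∧ slCharFun σ H (ρ ^ 2) = 0
  integral : ∀ k : ℕ, R + 1 ≤ k → ∀ ρ ρ' : ℂ, ‖ρ - k‖ ≤ 1 / 100 → ‖ρ' - k‖ ≤ 1 / 100 →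
    1 / 2 ≤ ‖∫ x in (0 : ℝ)..Real.pi, slPhi σ x (ρ ^ 2) * slPhi σ x (ρ' ^ 2)‖

/-- Let `X = exp(π|Im ρ|)`. The error in `Δ(ρ²) ≈ -ρ sin πρ` is at most `|ρ|X/500`, while `|ρ sin
πρ| ≥ |ρ|X/50` at distance `1/100` or more from the integers. The surplus `9|ρ|X/500` excludes zeros
there, and since it exceeds the value at the centre `k` it forces a zero inside the disc. The
integrals are compared with that of `cos² kx`, which is `π/2`. -/
theorem TailControl.of_asymptotics {σ : ℝ → ℂ} (hσ : MemL2 σ) {H : ℂ} {R : ℝ} (hR : 1 ≤ R)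
    (hHR : 2000 * ‖H‖ ≤ R) (h : ∀ ρ : ℂ, R ≤ ‖ρ‖ → ∀ x ∈ Set.Icc 0 Real.pi,
        ‖slPhi σ x (ρ ^ 2) - Complex.cos (ρ * x)‖ ≤ 1 / 1000 * Real.exp (|ρ.im| * x) ∧
        ‖slPhiQuasi σ x (ρ ^ 2) + ρ * Complex.sin (ρ * x)‖ ≤
          1 / 1000 * ‖ρ‖ * Real.exp (|ρ.im| * x)) : TailControl σ H R := by
  have key : ∀ ρ : ℂ, R ≤ ‖ρ‖ → ‖slCharFun σ H (ρ ^ 2) + ρ * Complex.sin (ρ * Real.pi)‖ ≤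
      1 / 500 * ‖ρ‖ * Real.exp (|ρ.im| * Real.pi) := by
    intro ρ hρ
    obtain ⟨h1, h2⟩ := h ρ hρ Real.pi mem_Icc_pi
    have h3 := norm_cos_mul_le ρ Real.pi_pos.le
    set X := Real.exp (|ρ.im| * Real.pi)
    have hX : 0 < X := Real.exp_pos _
    have h4 : ‖slPhi σ Real.pi (ρ ^ 2)‖ ≤ 2 * X := by
      have := norm_add_le (slPhi σ Real.pi (ρ ^ 2) - Complex.cos (ρ * Real.pi))
        (Complex.cos (ρ * Real.pi))
      rw [sub_add_cancel] at this
      linarith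
    have e : slCharFun σ H (ρ ^ 2) + ρ * Complex.sin (ρ * Real.pi) =
        (slPhiQuasi σ Real.pi (ρ ^ 2) + ρ * Complex.sin (ρ * Real.pi)) +
        H * slPhi σ Real.pi (ρ ^ 2) := by
      unfold slCharFun; ring
    rw [e]
    refine (norm_add_le _ _).trans ?_
    rw [norm_mul]
    have h5 : ‖H‖ * ‖slPhi σ Real.pi (ρ ^ 2)‖ ≤ ‖ρ‖ / 2000 * (2 * X) :=
      mul_le_mul (by linarith) h4 (norm_nonneg _) (by positivity)
    linarith
  have hbig : ∀ ρ : ℂ, R ≤ ‖ρ‖ → (∀ k : ℤ, 1 / 100 ≤ ‖ρ - k‖) →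
      9 / 500 * ‖ρ‖ ≤ ‖slCharFun σ H (ρ ^ 2)‖ := by
    intro ρ hρ hk
    have h1 := key ρ hρ
    have h2 := norm_sin_lower (by norm_num) (by norm_num) hk
    set X := Real.exp (|ρ.im| * Real.pi)
    have hX : 1 ≤ X := Real.one_le_exp (by positivity)
    have h3 := norm_sub_le (slCharFun σ H (ρ ^ 2) + ρ * Complex.sin (ρ * Real.pi))
      (slCharFun σ H (ρ ^ 2))
    rw [add_sub_cancel_left, norm_mul] at h3
    have h4 := mul_le_mul_of_nonneg_left h2 (norm_nonneg ρ)
    have h5 : ‖ρ‖ * 1 ≤ ‖ρ‖ * X := mul_le_mul_of_nonneg_left hX (norm_nonneg ρ)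
    linarith
  refine ⟨fun ρ hρ h0 => ?_, fun k hk => ?_, fun k hk ρ ρ' hρ hρ' => ?_⟩
  · by_contra hcon
    push Not at hcon
    have := hbig ρ hρ hcon
    rw [h0, norm_zero] at this
    linarith
  · have hd : Differentiable ℂ fun ρ : ℂ => slCharFun σ H (ρ ^ 2) :=
      (slCharFun_differentiable hσ H).comp (differentiable_id.pow 2)
    have hk0 : (0 : ℝ) ≤ k := Nat.cast_nonneg k
    obtain ⟨z, hz, hz0⟩ := exists_zero_mem_ball hd (c := k) (r := 1 / 100)
      (m := 9 / 500 * (k - 1 / 100)) (by norm_num) (by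
        have h1 := key k (by rw [Complex.norm_natCast]; linarith)
        have h2 : Complex.sin ((k : ℂ) * Real.pi) = 0 := Complex.sin_nat_mul_pi k
        simp only [h2, mul_zero, add_zero, Complex.natCast_im, abs_zero, zero_mul, Real.exp_zero,
          mul_one, Complex.norm_natCast] at h1
        linarith) (fun z hz => by
        rw [mem_sphere_iff_norm] at hz
        have h1 : (k : ℝ) - 1 / 100 ≤ ‖z‖ := by
          have := norm_sub_norm_le (k : ℂ) z
          rw [norm_sub_rev, hz, Complex.norm_natCast] at this
          linarith
        have h2 := hbig z (by linarith) fun j => by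
          by_cases hj : j = k
          · rw [hj]; exact_mod_cast hz.ge
          · have h3 : (1 : ℝ) ≤ ‖((k : ℤ) : ℂ) - j‖ := by
              rw [← Int.cast_sub, Complex.norm_intCast]
              exact_mod_cast Int.one_le_abs (sub_ne_zero.2 (Ne.symm hj))
            have h4 := norm_sub_le (z - (j : ℂ)) (z - (k : ℂ))
            have e : z - (j : ℂ) - (z - (k : ℂ)) = ((k : ℤ) : ℂ) - j := by push_cast; ring
            rw [e, hz] at h4
            linarith
        linarith)
    exact ⟨z, mem_ball_iff_norm.1 hz, hz0⟩
  · have hk1 : 1 ≤ k := by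
      have : (1 : ℝ) ≤ k := by linarith
      exact_mod_cast this
    have hdev : ∀ r : ℂ, ‖r - k‖ ≤ 1 / 100 → ∀ x ∈ Set.Icc 0 Real.pi,
        ‖slPhi σ x (r ^ 2) - Complex.cos (k * x)‖ ≤ 1 / 10 := by
      intro r hr x hx
      have h1 : (k : ℝ) - 1 / 100 ≤ ‖r‖ := by
        have := norm_sub_norm_le (k : ℂ) r
        rw [norm_sub_rev, Complex.norm_natCast] at this
        linarith
      have h2 := (h r (by linarith) x hx).1
      have h3 := norm_cos_sub_cos_le hr hx
      have him : |r.im| ≤ 1 / 100 := by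
        have := Complex.abs_im_le_norm (r - k)
        simp only [Complex.sub_im, Complex.natCast_im, sub_zero] at this
        linarith
      have h4 : Real.exp (|r.im| * x) ≤ 3 := by
        have h5 : |r.im| * x ≤ 1 := by
          have : x ≤ 4 := hx.2.trans Real.pi_lt_four.le
          nlinarith [abs_nonneg r.im, hx.1]
        have h6 := Real.exp_le_exp.2 h5
        have := Real.exp_one_lt_d9
        linarith
      have h5 := norm_add_le (slPhi σ x (r ^ 2) - Complex.cos (r * x))
        (Complex.cos (r * x) - Complex.cos (k * x))
      rw [sub_add_sub_cancel] at h5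
      linarith
    have hcc : Continuous fun x : ℝ => Complex.cos (k * x) := by fun_prop
    have hsub : (∫ x in (0 : ℝ)..Real.pi, slPhi σ x (ρ ^ 2) * slPhi σ x (ρ' ^ 2)) -
        (Real.pi / 2 : ℝ) = ∫ x in (0 : ℝ)..Real.pi, (slPhi σ x (ρ ^ 2) * slPhi σ x (ρ' ^ 2) -
          Complex.cos (k * x) * Complex.cos (k * x)) := by
      rw [intervalIntegral.integral_sub (intervalIntegrable_of_continuousOn
        ((slPhi_continuousOn hσ _).fun_mul (slPhi_continuousOn hσ _)))
        ((hcc.fun_mul hcc).intervalIntegrable _ _), integral_cos_nat_mul_sq hk1]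
    -- `21/100 = (1/10)² + 2 · (1/10)`, since both factors are within `1/10` of a cosine of modulus
    -- at most one. The total loss `4 · 21/100` leaves more than `1/2` of `π/2`.
    have hb := norm_integral_le_four_mul (B := 21 / 100) (f := fun x =>
      slPhi σ x (ρ ^ 2) * slPhi σ x (ρ' ^ 2) - Complex.cos (k * x) * Complex.cos (k * x))
      fun x hx => by
        set c := Complex.cos (k * x)
        have hc : ‖c‖ ≤ 1 := by
          have := norm_cos_mul_le k hx.1
          simpa using this
        have a1 := hdev ρ hρ x hx
        have a2 := hdev ρ' hρ' x hx
        have e : slPhi σ x (ρ ^ 2) * slPhi σ x (ρ' ^ 2) - c * c =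
            (slPhi σ x (ρ ^ 2) - c) * (slPhi σ x (ρ' ^ 2) - c) +
            c * (slPhi σ x (ρ' ^ 2) - c) + c * (slPhi σ x (ρ ^ 2) - c) := by ring
        rw [e]
        refine norm_add₃_le.trans ?_
        rw [norm_mul, norm_mul, norm_mul]
        have b1 := mul_le_mul a1 a2 (norm_nonneg _) (by norm_num)
        have b2 := mul_le_mul hc a2 (norm_nonneg _) (by norm_num)
        have b3 := mul_le_mul hc a1 (norm_nonneg _) (by norm_num)
        linarith
    rw [← hsub] at hb
    have h6 := norm_sub_norm_le ((Real.pi / 2 : ℝ) : ℂ)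
      (∫ x in (0 : ℝ)..Real.pi, slPhi σ x (ρ ^ 2) * slPhi σ x (ρ' ^ 2))
    rw [norm_sub_rev, Complex.norm_real, Real.norm_of_nonneg (by positivity)] at h6
    linarith [Real.pi_gt_three]

theorem tailControl_locally_uniform {σ : ℝ → ℂ} (hσ : MemL2 σ) (H : ℂ) :
    ∃ η > 0, ∃ R ≥ 1, ∀ (τ : ℝ → ℂ) (H' : ℂ), MemL2 τ → l2norm (fun x => τ x - σ x) ≤ η →
      ‖H' - H‖ ≤ η → TailControl τ H' R := by
  obtain ⟨η, hη, R, hR, h⟩ := slPhi_asymptotics hσ (ε := 1 / 1000) (by norm_num)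
  -- The cap 1 gives `‖H'‖ ≤ ‖H‖ + 1`, so a single radius satisfies `2000 ‖H'‖ ≤ R` for all nearby
  -- problems.
  refine ⟨min η 1, by positivity, max R (2000 * (‖H‖ + 1)), hR.trans (le_max_left _ _),
    fun τ H' hτ hτσ hH => ?_⟩
  refine TailControl.of_asymptotics hτ (hR.trans (le_max_left _ _)) ?_ fun ρ hρ =>
    h τ hτ (hτσ.trans (min_le_left _ _)) ρ ((le_max_left _ _).trans hρ)
  refine le_trans ?_ (le_max_right _ _)
  have h1 := norm_sub_norm_le H' H
  have h2 := hH.trans (min_le_right _ _)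
  linarith

/-! ### Matching of ordered sequences and the discs around large integers -/

/-- A matching of two sequences ordered by modulus, compatible with the order of the moduli of the
first one, permutes the indices inside the groups of equal modulus. -/
theorem exists_perm_of_matching {lam mu : ℕ → ℂ} (hlam : Monotone fun n => ‖lam n‖)
    (hmu : Monotone fun n => ‖mu n‖) {U : ℕ → Set ℂ} (hex : ∀ n, ∃ m, mu m ∈ U n)
    (huniq : ∀ n m m', mu m ∈ U n → mu m' ∈ U n → m = m') (hcover : ∀ m, ∃ n, mu m ∈ U n)
    (hdisj : ∀ n n' z, z ∈ U n → z ∈ U n' → n = n')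
    (horder : ∀ n n', ‖lam n‖ < ‖lam n'‖ → ∀ z ∈ U n, ∀ w ∈ U n', ‖z‖ < ‖w‖) :
    ∃ p : Equiv.Perm ℕ, (∀ n, mu (p n) ∈ U n) ∧ ∀ n, ‖lam (p n)‖ = ‖lam n‖ := by
  choose f hf using hex
  have hbij : Function.Bijective f := by
    refine ⟨fun n n' h => hdisj n n' _ (hf n) (h ▸ hf n'), fun m => ?_⟩
    obtain ⟨n, hn⟩ := hcover m
    exact ⟨n, huniq n _ _ (hf n) hn⟩
  let p : Equiv.Perm ℕ := Equiv.ofBijective f hbij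
  have hp : ∀ n, mu (p n) ∈ U n := hf
  have hlt : ∀ a b, ‖lam a‖ < ‖lam b‖ → p a < p b := by
    intro a b hab
    by_contra hcon
    have h1 := hmu (not_lt.1 hcon)
    exact absurd (horder a b hab _ (hp a) _ (hp b)) (not_lt.2 h1)
  refine ⟨p, hp, fun n => le_antisymm (not_lt.1 fun h => ?_) (not_lt.1 fun h => ?_)⟩
  -- Pigeonhole: if the moduli differed, `p⁻¹` in this case and `p` in the next one would map the `p
  -- n + 1` indices up to `p n` injectively into the `p n` indices below it.
  · have hmaps : ∀ j ∈ Finset.range (p n + 1), p.symm j ∈ Finset.range (p n) := by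
      intro j hj
      rw [Finset.mem_range] at *
      have h1 : ‖lam (p.symm j)‖ ≤ ‖lam n‖ := by
        by_contra hcon
        have := hlt _ _ (not_le.1 hcon)
        rw [Equiv.apply_symm_apply] at this
        omega
      by_contra hcon
      exact absurd (hlam (not_lt.1 hcon)) (not_le.2 (h1.trans_lt h))
    have := Finset.card_le_card_of_injOn _ hmaps p.symm.injective.injOn
    simp at this
  · have hmaps : ∀ j ∈ Finset.range (p n + 1), p j ∈ Finset.range (p n) := by
      intro j hj
      rw [Finset.mem_range] at *
      exact hlt j n ((hlam (by omega : j ≤ p n)).trans_lt h)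
    have := Finset.card_le_card_of_injOn _ hmaps p.injective.injOn
    simp at this

/-- The image under `ρ ↦ ρ²` of a small disc around `k`. -/
def sqDisc (k : ℕ) : Set ℂ := {z | ∃ ρ : ℂ, ‖ρ - k‖ < 1 / 100 ∧ z = ρ ^ 2}

theorem norm_of_mem_sqDisc {k : ℕ} (hk : 1 ≤ k) {z : ℂ} (hz : z ∈ sqDisc k) :
    ((k : ℝ) - 1 / 100) ^ 2 < ‖z‖ ∧ ‖z‖ < ((k : ℝ) + 1 / 100) ^ 2 := by
  obtain ⟨ρ, hρ, rfl⟩ := hz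
  have hk' : (1 : ℝ) ≤ k := by exact_mod_cast hk
  have h1 := norm_sub_norm_le (k : ℂ) ρ
  have h2 := norm_sub_norm_le ρ (k : ℂ)
  rw [norm_sub_rev] at h1
  rw [Complex.norm_natCast] at h1 h2
  rw [norm_pow]
  constructor <;> gcongr <;> linarith

namespace TailControl

variable {σ : ℝ → ℂ} {H : ℂ} {R : ℝ}

/-- A root `ρ` with `‖ρ‖ > K - 99/100` lies within `1/100` of an integer, whose modulus exceeds `K -
1` and hence is at least `K`. Replacing `ρ` by `-ρ` makes that integer nonnegative. -/
theorem head_or_tail (h : TailControl σ H R) {K : ℕ} (hK : R + 2 ≤ K) {z : ℂ}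
    (hz : slCharFun σ H z = 0) :
    ‖z‖ ≤ ((K : ℝ) - 99 / 100) ^ 2 ∨ ∃ k, K ≤ k ∧ z ∈ sqDisc k := by
  obtain ⟨ρ, rfl⟩ : ∃ ρ, z = ρ ^ 2 := by
    obtain ⟨ρ, hρ⟩ := IsAlgClosed.exists_pow_nat_eq z (n := 2) two_pos
    exact ⟨ρ, hρ.symm⟩
  rcases le_or_gt ‖ρ‖ ((K : ℝ) - 99 / 100) with hle | hlt
  · left
    rw [norm_pow]
    gcongr
  · right
    obtain ⟨k, hk⟩ := h.near ρ (by linarith) hz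
    have h1 := norm_sub_norm_le ρ (k : ℂ)
    rw [Complex.norm_intCast] at h1
    have h2 : ((K : ℤ) : ℝ) - 1 < ((|k| : ℤ) : ℝ) := by push_cast; linarith
    have h3 : (K : ℤ) - 1 < |k| := by exact_mod_cast h2
    refine ⟨k.natAbs, by rw [Int.abs_eq_natAbs] at h3; omega, ?_⟩
    have hcast : ((k.natAbs : ℕ) : ℂ) = ((|k| : ℤ) : ℂ) := by
      rw [Int.abs_eq_natAbs]; simp
    rcases le_total 0 k with h0 | h0
    · refine ⟨ρ, ?_, rfl⟩
      rw [hcast, abs_of_nonneg h0]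
      exact hk
    · have e : -ρ - ((-k : ℤ) : ℂ) = -(ρ - k) := by push_cast; ring
      refine ⟨-ρ, ?_, (neg_sq ρ).symm⟩
      rw [hcast, abs_of_nonpos h0, e, norm_neg]
      exact hk

theorem exists_zero_sqDisc (h : TailControl σ H R) {k : ℕ} (hk : R + 1 ≤ k) :
    ∃ z ∈ sqDisc k, slCharFun σ H z = 0 := by
  obtain ⟨ρ, hρ, h0⟩ := h.exists_zero k hk
  exact ⟨_, ⟨ρ, hρ, rfl⟩, h0⟩

/-- At two zeros the right-hand side of `integral_phi_mul_phi` vanishes, while its integral is at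
least `1/2` in modulus. -/
theorem unique_sqDisc (hσ : MemL2 σ) (h : TailControl σ H R) {k : ℕ} (hk : R + 1 ≤ k) {z z' : ℂ}
    (hz : z ∈ sqDisc k) (hz' : z' ∈ sqDisc k) (h0 : slCharFun σ H z = 0)
    (h0' : slCharFun σ H z' = 0) : z = z' := by
  obtain ⟨ρ, hρ, rfl⟩ := hz
  obtain ⟨ρ', hρ', rfl⟩ := hz'
  have h1 := h.integral k hk ρ ρ' hρ.le hρ'.le
  have h2 := integral_phi_mul_phi hσ h0' (ρ ^ 2)
  rw [h0, mul_zero] at h2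
  rcases mul_eq_zero.1 h2 with h3 | h3
  · exact sub_eq_zero.1 h3
  · rw [h3, norm_zero] at h1
    norm_num at h1

end TailControl

/-! ### Perturbation of finitely many simple zeros -/

theorem eventually_ne_zero_of_simple {f : ℂ → ℂ} {z : ℂ} (h : analyticOrderAt f z = 1) :
    ∀ᶠ w in 𝓝[≠] z, f w ≠ 0 := by
  have han : AnalyticAt ℂ f z := by
    by_contra hcon
    rw [analyticOrderAt_of_not_analyticAt hcon] at h
    exact zero_ne_one h
  rcases han.eventually_eq_zero_or_eventually_ne_zero with h1 | h1
  · rw [analyticOrderAt_eq_top.2 h1] at h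
    exact absurd h (by decide)
  · exact h1

section convergence

variable {σ : ℝ → ℂ} {σN : ℕ → ℝ → ℂ} {H : ℂ} {HN : ℕ → ℂ}

theorem eventually_l2norm_le (hσ : MemL2 σ) (hσN : ∀ N, MemL2 (σN N))
    (hlim : Tendsto (fun N => l2norm fun x => σN N x - σ x) atTop (𝓝 0)) :
    ∀ᶠ N in atTop, l2norm (σN N) ≤ l2norm σ + 1 := by
  filter_upwards [hlim.eventually (gt_mem_nhds one_pos)] with N hN
  linarith [l2norm_le_of_sub hσ (hσN N)]

theorem eventually_norm_le (hH : Tendsto HN atTop (𝓝 H)) :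
    ∀ᶠ N in atTop, ‖HN N‖ ≤ ‖H‖ + 1 :=
  (hH.norm.eventually (gt_mem_nhds (lt_add_one ‖H‖))).mono fun _ h => h.le

theorem slCharFun_eventually_close (hσ : MemL2 σ) (hσN : ∀ N, MemL2 (σN N))
    (hlim : Tendsto (fun N => l2norm fun x => σN N x - σ x) atTop (𝓝 0))
    (hH : Tendsto HN atTop (𝓝 H)) (R : ℝ) {ε : ℝ} (hε : 0 < ε) :
    ∀ᶠ N in atTop, ∀ z : ℂ, ‖z‖ ≤ R → ‖slCharFun (σN N) (HN N) z - slCharFun σ H z‖ < ε := by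
  have hS0 : 0 ≤ l2norm σ + 1 + ‖H‖ := by have := l2norm_nonneg σ; positivity
  obtain ⟨C, hC, h⟩ := slCharFun_sub_le (l2norm σ + 1 + ‖H‖) R hS0
  have hlim2 : Tendsto (fun N => C * ((l2norm fun x => σN N x - σ x) + ‖HN N - H‖)) atTop
      (𝓝 0) := by
    have h1 : Tendsto (fun N => ‖HN N - H‖) atTop (𝓝 0) :=
      tendsto_iff_norm_sub_tendsto_zero.1 hH
    simpa using (hlim.add h1).const_mul C
  filter_upwards [hlim2.eventually (gt_mem_nhds hε), eventually_l2norm_le hσ hσN hlim,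
    eventually_norm_le hH] with N h1 h2 h3 z hz
  have h4 := h σ (σN N) hσ (hσN N) (by linarith [norm_nonneg H]) (by linarith [norm_nonneg H]) H
    (HN N) z z (by linarith [l2norm_nonneg σ]) hz hz
  simp only [sub_self, norm_zero, add_zero] at h4
  exact h4.trans_lt h1

theorem eventually_ne_zero_on_compact (hσ : MemL2 σ) (hσN : ∀ N, MemL2 (σN N))
    (hlim : Tendsto (fun N => l2norm fun x => σN N x - σ x) atTop (𝓝 0))
    (hH : Tendsto HN atTop (𝓝 H)) {X : Set ℂ} (hX : IsCompact X)
    (hne : ∀ z ∈ X, slCharFun σ H z ≠ 0) :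
    ∃ m > 0, (∀ z ∈ X, m ≤ ‖slCharFun σ H z‖) ∧
      ∀ᶠ N in atTop, ∀ z ∈ X, m / 2 ≤ ‖slCharFun (σN N) (HN N) z‖ := by
  obtain ⟨m, hm, hmle⟩ : ∃ m > 0, ∀ z ∈ X, m ≤ ‖slCharFun σ H z‖ := by
    rcases X.eq_empty_or_nonempty with rfl | hne'
    · exact ⟨1, one_pos, by simp⟩
    · obtain ⟨z, hz, hzmin⟩ := hX.exists_isMinOn hne'
        (slCharFun_differentiable hσ H).continuous.norm.continuousOn
      exact ⟨_, norm_pos_iff.2 (hne z hz), fun w hw => hzmin hw⟩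
  refine ⟨m, hm, hmle, ?_⟩
  obtain ⟨R, hR⟩ := hX.isBounded.exists_norm_le
  filter_upwards [slCharFun_eventually_close hσ hσN hlim hH R (half_pos hm)] with N hN z hz
  have h1 := hN z (hR z hz)
  have h2 := hmle z hz
  have h3 := norm_sub_norm_le (slCharFun σ H z) (slCharFun (σN N) (HN N) z)
  rw [norm_sub_rev] at h3
  linarith

/-- On a small circle the perturbed function stays above `m/2` in modulus, and at the centre it
drops below `m/2`, so it vanishes inside. This plays the role of Hurwitz's theorem. -/
theorem eventually_exists_zero_near (hσ : MemL2 σ) (hσN : ∀ N, MemL2 (σN N))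
    (hlim : Tendsto (fun N => l2norm fun x => σN N x - σ x) atTop (𝓝 0))
    (hH : Tendsto HN atTop (𝓝 H)) {z : ℂ} (h0 : slCharFun σ H z = 0)
    (hz : analyticOrderAt (slCharFun σ H) z = 1) {e : ℝ} (he : 0 < e) :
    ∀ᶠ N in atTop, ∃ w ∈ Metric.ball z e, slCharFun (σN N) (HN N) w = 0 := by
  obtain ⟨d, hd, hdne⟩ := Metric.mem_nhdsWithin_iff.1 (eventually_ne_zero_of_simple hz)
  set r := min (e / 2) (d / 2) with hr
  have hrpos : 0 < r := by positivity
  have hre : r < e := (min_le_left _ _).trans_lt (by linarith)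
  have hrd : r < d := (min_le_right _ _).trans_lt (by linarith)
  obtain ⟨m, hm, -, hev⟩ := eventually_ne_zero_on_compact (X := Metric.sphere z r) hσ hσN hlim hH
    (isCompact_sphere z r) (fun w hw => hdne ⟨by
      rw [Metric.mem_ball, Metric.mem_sphere.1 hw]; exact hrd, Metric.ne_of_mem_sphere hw hrpos.ne'⟩)
  filter_upwards [hev, slCharFun_eventually_close hσ hσN hlim hH ‖z‖ (half_pos hm)] with N h1 h2
  have h3 := h2 z le_rfl
  rw [h0, sub_zero] at h3
  obtain ⟨w, hw, hw0⟩ := exists_zero_mem_ball (slCharFun_differentiable (hσN N) (HN N)) hrpos h3 h1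
  exact ⟨w, Metric.ball_subset_ball hre.le hw, hw0⟩

theorem eventually_tailControl (hσ : MemL2 σ) (hσN : ∀ N, MemL2 (σN N))
    (hlim : Tendsto (fun N => l2norm fun x => σN N x - σ x) atTop (𝓝 0))
    (hH : Tendsto HN atTop (𝓝 H)) : ∃ R ≥ 1, TailControl σ H R ∧
      ∀ᶠ N in atTop, TailControl (σN N) (HN N) R := by
  obtain ⟨η, hη, R, hR, h⟩ := tailControl_locally_uniform hσ H
  refine ⟨R, hR, h σ H hσ (by simp [l2norm, hη.le]) (by simp [hη.le]), ?_⟩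
  filter_upwards [hlim.eventually (gt_mem_nhds hη),
    (tendsto_iff_norm_sub_tendsto_zero.1 hH).eventually (gt_mem_nhds hη)] with N h1 h2
  exact h _ _ (hσN N) h1.le h2.le

/-- Uniqueness of the zeros near a simple zero, locally uniformly in the problem. -/
theorem eventually_unique_zero_near (hσ : MemL2 σ) (hσN : ∀ N, MemL2 (σN N))
    (hlim : Tendsto (fun N => l2norm fun x => σN N x - σ x) atTop (𝓝 0)) {z : ℂ}
    (h0 : slCharFun σ H z = 0) (hz : analyticOrderAt (slCharFun σ H) z = 1) :
    ∃ e₀ > 0, ∀ᶠ N in atTop, ∀ w ∈ Metric.ball z e₀, ∀ w' ∈ Metric.ball z e₀,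
      slCharFun (σN N) (HN N) w = 0 → slCharFun (σN N) (HN N) w' = 0 → w = w' := by
  obtain ⟨C, hC, h⟩ := integral_phi_mul_sub_le (l2norm σ + 1) (‖z‖ + 1)
    (by have := l2norm_nonneg σ; positivity)
  have hI := integral_phi_sq_ne_zero hσ h0 hz
  set I := ∫ x in (0 : ℝ)..Real.pi, slPhi σ x z ^ 2 with hIdef
  have hIpos : 0 < ‖I‖ := norm_pos_iff.2 hI
  -- The change of the potential costs less than `‖I‖/2` and each of the two spectral parameters
  -- less than `‖I‖/4`, so the perturbed integral cannot vanish.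
  refine ⟨min 1 (‖I‖ / (4 * C)), by positivity, ?_⟩
  have hlim2 : Tendsto (fun N => C * (l2norm fun x => σN N x - σ x)) atTop (𝓝 0) := by
    simpa using hlim.const_mul C
  filter_upwards [hlim2.eventually (gt_mem_nhds (half_pos hIpos)),
    eventually_l2norm_le hσ hσN hlim] with N h1 h2 w hw w' hw' hw0 hw0'
  rw [mem_ball_iff_norm] at hw hw'
  have hb : ∀ v : ℂ, ‖v - z‖ < min 1 (‖I‖ / (4 * C)) → ‖v‖ ≤ ‖z‖ + 1 ∧ C * ‖v - z‖ < ‖I‖ / 4 := by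
    intro v hv
    constructor
    · linarith [norm_sub_norm_le v z, hv.trans_le (min_le_left _ _)]
    · have := hv.trans_le (min_le_right _ _)
      rw [lt_div_iff₀ (by positivity)] at this
      linarith
  obtain ⟨a1, a2⟩ := hb w hw
  obtain ⟨b1, b2⟩ := hb w' hw'
  have h3 := h σ (σN N) hσ (hσN N) (by linarith) h2 z w z w' (by linarith) a1 (by linarith) b1
  have hI2 : ∫ x in (0 : ℝ)..Real.pi, slPhi σ x z * slPhi σ x z = I := by
    rw [hIdef]; congr 1; ext x; ring
  rw [hI2] at h3
  have h4 := integral_phi_mul_phi (hσN N) hw0' w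
  rw [hw0, mul_zero] at h4
  rcases mul_eq_zero.1 h4 with h5 | h5
  · exact sub_eq_zero.1 h5
  · rw [h5, zero_sub, norm_neg] at h3
    nlinarith

end convergence

namespace IsSLSpectralData

variable {σ : ℝ → ℂ} {H : ℂ} {lam rho alpha : ℕ → ℂ}

theorem slCharFun_eq_zero (hd : IsSLSpectralData σ H lam rho alpha) (hσ : MemL2 σ) (n : ℕ) :
    slCharFun σ H (lam n) = 0 := by
  have h : lam n ∈ Set.range lam := ⟨n, rfl⟩
  rw [hd.range_eq] at h
  exact (isSLEigenvalue_iff hσ).1 h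

theorem exists_eq (hd : IsSLSpectralData σ H lam rho alpha) (hσ : MemL2 σ) {z : ℂ}
    (hz : slCharFun σ H z = 0) : ∃ n, lam n = z := by
  have h : z ∈ Set.range lam := by
    rw [hd.range_eq]
    exact (isSLEigenvalue_iff hσ).2 hz
  exact h

/-- An accumulation point of eigenvalues would itself be an eigenvalue, because zero sets are
closed, but simple zeros are isolated. -/
theorem finite_norm_le (hd : IsSLSpectralData σ H lam rho alpha) (hσ : MemL2 σ) (r : ℝ) :
    {n | ‖lam n‖ ≤ r}.Finite := by
  by_contra hinf
  have hinf' : (lam '' {n | ‖lam n‖ ≤ r}).Infinite :=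
    Set.Infinite.image hd.injective.injOn hinf
  obtain ⟨z, -, hz⟩ := hinf'.exists_accPt_of_subset_isCompact
    (isCompact_closedBall (0 : ℂ) r) (by
      rintro _ ⟨n, hn, rfl⟩
      simpa using hn)
  rw [accPt_iff_frequently_nhdsNE] at hz
  have hfreq : ∃ᶠ w in 𝓝[≠] z, slCharFun σ H w = 0 := hz.mono (by
    rintro _ ⟨n, -, rfl⟩
    exact hd.slCharFun_eq_zero hσ n)
  have h0 : slCharFun σ H z = 0 := by
    have hcl : IsClosed {w | slCharFun σ H w = 0} :=
      isClosed_eq (slCharFun_differentiable hσ H).continuous continuous_const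
    exact hcl.closure_subset (mem_closure_iff_frequently.2 (hfreq.filter_mono nhdsWithin_le_nhds))
  obtain ⟨n, rfl⟩ := hd.exists_eq hσ h0
  exact hfreq (eventually_ne_zero_of_simple (hd.simple n))

end IsSLSpectralData

theorem eq_of_mem_sqDisc {j k : ℕ} (hj : 1 ≤ j) (hk : 1 ≤ k) {z : ℂ} (hz : z ∈ sqDisc j)
    (hz' : z ∈ sqDisc k) : j = k := by
  have key : ∀ {j k : ℕ}, 1 ≤ j → 1 ≤ k → z ∈ sqDisc j → z ∈ sqDisc k → ¬ j < k := by
    intro j k hj hk hz hz' hlt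
    have h1 := (norm_of_mem_sqDisc hj hz).2
    have h2 := (norm_of_mem_sqDisc hk hz').1
    have h3 : (j : ℝ) + 1 ≤ k := by exact_mod_cast hlt
    have h4 : (0 : ℝ) ≤ j := Nat.cast_nonneg j
    have h5 : ((j : ℝ) + 1 / 100) ^ 2 ≤ ((k : ℝ) - 1 / 100) ^ 2 := by gcongr; linarith
    linarith
  exact le_antisymm (not_lt.1 (key hk hj hz' hz)) (not_lt.1 (key hj hk hz hz'))

/-- A radius separating finitely many distinct points and their moduli. -/
theorem exists_separating_radius {lam : ℕ → ℂ} (hinj : Function.Injective lam) (head : Finset ℕ)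
    {e₀ : ℕ → ℝ} (he₀ : ∀ n ∈ head, 0 < e₀ n) :
    ∃ e > 0, e ≤ 1 / 4 ∧ (∀ m ∈ head, ∀ n ∈ head, m ≠ n → 2 * e ≤ ‖lam m - lam n‖) ∧
      (∀ m ∈ head, ∀ n ∈ head, ‖lam m‖ < ‖lam n‖ → ‖lam m‖ + 2 * e ≤ ‖lam n‖) ∧
      ∀ n ∈ head, e ≤ e₀ n := by
  have small : ∀ d : ℝ, 0 < d → ∀ᶠ e in 𝓝[>] (0 : ℝ), e ≤ d := fun d hd =>
    nhdsWithin_le_nhds (Iic_mem_nhds hd)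
  have h1 : ∀ᶠ e in 𝓝[>] (0 : ℝ), ∀ m ∈ head, ∀ n ∈ head, m ≠ n → 2 * e ≤ ‖lam m - lam n‖ := by
    refine (Finset.eventually_all head).2 fun m _ => (Finset.eventually_all head).2 fun n _ => ?_
    by_cases hmn : m = n
    · exact Eventually.of_forall fun _ h => absurd hmn h
    · have h : 0 < ‖lam m - lam n‖ := norm_pos_iff.2 (sub_ne_zero.2 (hinj.ne hmn))
      filter_upwards [small _ (half_pos h)] with e he _
      linarith
  have h2 : ∀ᶠ e in 𝓝[>] (0 : ℝ), ∀ m ∈ head, ∀ n ∈ head, ‖lam m‖ < ‖lam n‖ →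
      ‖lam m‖ + 2 * e ≤ ‖lam n‖ := by
    refine (Finset.eventually_all head).2 fun m _ => (Finset.eventually_all head).2 fun n _ => ?_
    by_cases hmn : ‖lam m‖ < ‖lam n‖
    · filter_upwards [small _ (half_pos (sub_pos.2 hmn))] with e he _
      linarith
    · exact Eventually.of_forall fun _ h => absurd h hmn
  have h3 : ∀ᶠ e in 𝓝[>] (0 : ℝ), ∀ n ∈ head, e ≤ e₀ n :=
    (Finset.eventually_all head).2 fun n hn => small _ (he₀ n hn)
  obtain ⟨e, ⟨he1, he2, he3⟩, he4, he5⟩ := ((h1.and (h2.and h3)).and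
    ((small (1 / 4) (by norm_num)).and self_mem_nhdsWithin)).exists
  exact ⟨e, he5, he4, he1, he2, he3⟩

/-! ### Matching of the eigenvalues of the approximating problems -/

section convergence

variable {σ : ℝ → ℂ} {σN : ℕ → ℝ → ℂ} {H : ℂ} {HN : ℕ → ℂ} {lam rho alpha : ℕ → ℂ}
  {lamN rhoN alphaN : ℕ → ℕ → ℂ}

/-- The eigenvalues of the approximating problems are matched with those of the limit problem:
finitely many converge, and the other ones stay in the same small region. -/
theorem exists_matching (hσ : MemL2 σ) (hσN : ∀ N, MemL2 (σN N))
    (hlim : Tendsto (fun N => l2norm fun x => σN N x - σ x) atTop (𝓝 0))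
    (hH : Tendsto HN atTop (𝓝 H)) (hd : IsSLSpectralData σ H lam rho alpha)
    (hdN : ∀ N, IsSLSpectralData (σN N) (HN N) (lamN N) (rhoN N) (alphaN N)) :
    ∃ (p : ℕ → Equiv.Perm ℕ) (head : Finset ℕ) (κ : ℕ → ℕ) (R : ℝ), 1 ≤ R ∧
      (∀ N n, ‖lam (p N n)‖ = ‖lam n‖) ∧
      (∀ n ∈ head, Tendsto (fun N => lamN N (p N n)) atTop (𝓝 (lam n))) ∧
      (∀ n ∉ head, R + 1 ≤ κ n ∧ lam n ∈ sqDisc (κ n)) ∧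
      (∀ n ∉ head, ∀ m ∉ head, κ n = κ m → n = m) ∧ TailControl σ H R ∧
      (∀ᶠ N in atTop, TailControl (σN N) (HN N) R ∧
        ∀ n ∉ head, lamN N (p N n) ∈ sqDisc (κ n)) ∧
      ∀ᶠ N in atTop, IsSLReal (σN N) (HN N) → ∀ n ∈ head, (lam n).im = 0 →
        (lamN N (p N n)).im = 0 := by
  obtain ⟨R, hR, hTC, hTCN⟩ := eventually_tailControl hσ hσN hlim hH
  -- The head consists of the eigenvalues of modulus at most `(K - 99/100)²`; the tail lies beyond
  -- `(K - 1/100)²`. The gap leaves room for balls of radius at most `1/4` around the head, so the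
  -- two kinds of regions cannot overlap or exchange their order.
  obtain ⟨K, hK⟩ := exists_nat_ge (R + 2)
  have hK3 : (3 : ℝ) ≤ K := by linarith
  have hzero := hd.slCharFun_eq_zero hσ
  have hfin := hd.finite_norm_le hσ (((K : ℝ) - 99 / 100) ^ 2)
  set head : Finset ℕ := hfin.toFinset with hhead
  have hmem : ∀ n, n ∈ head ↔ ‖lam n‖ ≤ ((K : ℝ) - 99 / 100) ^ 2 := by simp [hhead]
  have hκex : ∀ n, ∃ k, n ∉ head → K ≤ k ∧ lam n ∈ sqDisc k := by
    intro n
    rcases hTC.head_or_tail hK (hzero n) with h | ⟨k, hk⟩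
    · exact ⟨0, fun h' => absurd ((hmem n).2 h) h'⟩
    · exact ⟨k, fun _ => hk⟩
  choose κ hκ using hκex
  have hcastK : ∀ {k : ℕ}, K ≤ k → (K : ℝ) ≤ k := fun h => by exact_mod_cast h
  have hK1 : 1 ≤ K := by exact_mod_cast (by linarith : (1 : ℝ) ≤ K)
  have hRk : ∀ {k : ℕ}, K ≤ k → R + 1 ≤ k := fun h => by linarith [hcastK h]
  have hκinj : ∀ n ∉ head, ∀ m ∉ head, κ n = κ m → n = m := fun n hn m hm h =>
    hd.injective (hTC.unique_sqDisc hσ (hRk (hκ n hn).1) (hκ n hn).2 (h ▸ (hκ m hm).2)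
      (hzero n) (hzero m))
  have hκsurj : ∀ k, K ≤ k → ∃ n ∉ head, κ n = k := by
    intro k hk
    obtain ⟨z, hz, hz0⟩ := hTC.exists_zero_sqDisc (hRk hk)
    obtain ⟨n, rfl⟩ := hd.exists_eq hσ hz0
    have hn : n ∉ head := by
      rw [hmem, not_le]
      refine lt_of_le_of_lt ?_ (norm_of_mem_sqDisc (hK1.trans hk) hz).1
      have := hcastK hk
      gcongr <;> linarith
    exact ⟨n, hn, eq_of_mem_sqDisc (hK1.trans (hκ n hn).1) (hK1.trans hk) (hκ n hn).2 hz⟩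
  have he₀ex : ∀ n, ∃ e₀ > 0, ∀ᶠ N in atTop, ∀ w ∈ Metric.ball (lam n) e₀,
      ∀ w' ∈ Metric.ball (lam n) e₀, slCharFun (σN N) (HN N) w = 0 →
        slCharFun (σN N) (HN N) w' = 0 → w = w' := fun n =>
    eventually_unique_zero_near hσ hσN hlim (hzero n) (hd.simple n)
  choose e₀ he₀ huniq using he₀ex
  obtain ⟨e, he, he4, hsep, hord, hee₀⟩ :=
    exists_separating_radius hd.injective head fun n _ => he₀ n
  set U : ℕ → Set ℂ := fun n => if n ∈ head then Metric.ball (lam n) e else sqDisc (κ n) with hU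
  have hUh : ∀ {n}, n ∈ head → U n = Metric.ball (lam n) e := fun h => if_pos h
  have hUt : ∀ {n}, n ∉ head → U n = sqDisc (κ n) := fun h => if_neg h
  have hheadnorm : ∀ {n z}, n ∈ head → z ∈ U n → ‖z‖ < ((K : ℝ) - 1 / 100) ^ 2 := by
    intro n z hn hz
    rw [hUh hn, mem_ball_iff_norm] at hz
    have h1 := (hmem n).1 hn
    have h2 := norm_sub_norm_le z (lam n)
    nlinarith
  have htailnorm : ∀ {n z}, n ∉ head → z ∈ U n → ((K : ℝ) - 1 / 100) ^ 2 < ‖z‖ := by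
    intro n z hn hz
    rw [hUt hn] at hz
    refine lt_of_le_of_lt ?_ (norm_of_mem_sqDisc (hK1.trans (hκ n hn).1) hz).1
    have := hcastK (hκ n hn).1
    gcongr
    linarith
  have hdisj : ∀ n n' z, z ∈ U n → z ∈ U n' → n = n' := by
    intro n n' z hz hz'
    by_cases hn : n ∈ head <;> by_cases hn' : n' ∈ head
    · by_contra hne
      have h1 := hsep n hn n' hn' hne
      rw [hUh hn, mem_ball_iff_norm'] at hz
      rw [hUh hn', mem_ball_iff_norm] at hz'
      have h2 := norm_add_le (lam n - z) (z - lam n')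
      rw [sub_add_sub_cancel] at h2
      linarith
    · exact absurd (hheadnorm hn hz) (not_lt.2 (htailnorm hn' hz').le)
    · exact absurd (hheadnorm hn' hz') (not_lt.2 (htailnorm hn hz).le)
    · rw [hUt hn] at hz
      rw [hUt hn'] at hz'
      exact hκinj n hn n' hn' (eq_of_mem_sqDisc (hK1.trans (hκ n hn).1)
        (hK1.trans (hκ n' hn').1) hz hz')
  have horder : ∀ n n', ‖lam n‖ < ‖lam n'‖ → ∀ z ∈ U n, ∀ w ∈ U n', ‖z‖ < ‖w‖ := by
    intro n n' hlt z hz w hw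
    by_cases hn : n ∈ head <;> by_cases hn' : n' ∈ head
    · have h1 := hord n hn n' hn' hlt
      rw [hUh hn, mem_ball_iff_norm] at hz
      rw [hUh hn', mem_ball_iff_norm'] at hw
      have h2 := norm_sub_norm_le z (lam n)
      have h3 := norm_sub_norm_le (lam n') w
      linarith
    · exact (hheadnorm hn hz).trans (htailnorm hn' hw)
    · exact absurd ((hmem n).2 (hlt.le.trans ((hmem n').1 hn'))) hn
    · rw [hUt hn] at hz
      rw [hUt hn'] at hw
      obtain ⟨hk, hkn⟩ := hκ n hn
      obtain ⟨hk', hkn'⟩ := hκ n' hn'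
      have hκlt : κ n < κ n' := by
        rcases lt_trichotomy (κ n) (κ n') with h | h | h
        · exact h
        · rw [hκinj n hn n' hn' h] at hlt
          exact absurd hlt (lt_irrefl _)
        · have h1 := (norm_of_mem_sqDisc (hK1.trans hk') hkn').2
          have h2 := (norm_of_mem_sqDisc (hK1.trans hk) hkn).1
          have h3 : (κ n' : ℝ) + 1 ≤ κ n := by exact_mod_cast h
          have h4 := hcastK hk'
          have h5 : ((κ n' : ℝ) + 1 / 100) ^ 2 ≤ ((κ n : ℝ) - 1 / 100) ^ 2 := by gcongr; linarith
          linarith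
      have h1 := (norm_of_mem_sqDisc (hK1.trans hk) hz).2
      have h2 := (norm_of_mem_sqDisc (hK1.trans hk') hw).1
      have h3 : (κ n : ℝ) + 1 ≤ κ n' := by exact_mod_cast hκlt
      have h4 := hcastK hk
      have h5 : ((κ n : ℝ) + 1 / 100) ^ 2 ≤ ((κ n' : ℝ) - 1 / 100) ^ 2 := by gcongr; linarith
      linarith
  have huniqU : ∀ᶠ N in atTop, ∀ n ∈ head, ∀ w ∈ U n, ∀ w' ∈ U n,
      slCharFun (σN N) (HN N) w = 0 → slCharFun (σN N) (HN N) w' = 0 → w = w' := by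
    refine (Finset.eventually_all head).2 fun n hn => ?_
    filter_upwards [huniq n] with N hN w hw w' hw'
    rw [hUh hn] at hw hw'
    exact hN w (Metric.ball_subset_ball (hee₀ n hn) hw) w'
      (Metric.ball_subset_ball (hee₀ n hn) hw')
  have hcoverX : ∀ᶠ N in atTop, ∀ z, ‖z‖ ≤ ((K : ℝ) - 99 / 100) ^ 2 →
      slCharFun (σN N) (HN N) z = 0 → ∃ n, z ∈ U n := by
    -- The limit function has no zero on this compact set, so for large `N` no small zero of the
    -- perturbed function escapes the balls.
    set X : Set ℂ := Metric.closedBall 0 (((K : ℝ) - 99 / 100) ^ 2) \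
      ⋃ n ∈ head, Metric.ball (lam n) e with hX
    have hXc : IsCompact X := (isCompact_closedBall _ _).diff
      (isOpen_biUnion fun _ _ => Metric.isOpen_ball)
    have hXne : ∀ z ∈ X, slCharFun σ H z ≠ 0 := by
      intro z hz h0
      obtain ⟨n, rfl⟩ := hd.exists_eq hσ h0
      refine hz.2 (Set.mem_biUnion (x := n) ?_ (Metric.mem_ball_self he))
      exact (hmem n).2 (by simpa using hz.1)
    obtain ⟨m, hm, -, hev⟩ := eventually_ne_zero_on_compact hσ hσN hlim hH hXc hXne
    filter_upwards [hev] with N hN z hz h0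
    by_contra hcon
    push Not at hcon
    have hzX : z ∈ X := by
      refine ⟨by simpa using hz, fun hz' => ?_⟩
      obtain ⟨n, hn, hzn⟩ := Set.mem_iUnion₂.1 hz'
      exact hcon n ((hUh hn).symm ▸ hzn)
    have := hN z hzX
    rw [h0, norm_zero] at this
    linarith
  have hnear : ∀ e' > 0, ∀ᶠ N in atTop, ∀ n ∈ head, ∃ w ∈ Metric.ball (lam n) e',
      slCharFun (σN N) (HN N) w = 0 := fun e' he' =>
    (Finset.eventually_all head).2 fun n _ =>
      eventually_exists_zero_near hσ hσN hlim hH (hzero n) (hd.simple n) he'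
  have hgood : ∀ᶠ N in atTop, ∃ p : Equiv.Perm ℕ, (∀ n, lamN N (p n) ∈ U n) ∧
      ∀ n, ‖lam (p n)‖ = ‖lam n‖ := by
    filter_upwards [huniqU, hcoverX, hnear e he, hTCN] with N h1 h2 h3 h4
    have hzeroN := (hdN N).slCharFun_eq_zero (hσN N)
    refine exists_perm_of_matching hd.monotone_norm (hdN N).monotone_norm ?_ ?_ ?_ hdisj horder
    · intro n
      by_cases hn : n ∈ head
      · obtain ⟨w, hw, hw0⟩ := h3 n hn
        obtain ⟨m, rfl⟩ := (hdN N).exists_eq (hσN N) hw0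
        exact ⟨m, by rw [hUh hn]; exact hw⟩
      · obtain ⟨w, hw, hw0⟩ := h4.exists_zero_sqDisc (hRk (hκ n hn).1)
        obtain ⟨m, rfl⟩ := (hdN N).exists_eq (hσN N) hw0
        exact ⟨m, by rw [hUt hn]; exact hw⟩
    · intro n m m' hm hm'
      refine (hdN N).injective ?_
      by_cases hn : n ∈ head
      · exact h1 n hn _ hm _ hm' (hzeroN m) (hzeroN m')
      · rw [hUt hn] at hm hm'
        exact h4.unique_sqDisc (hσN N) (hRk (hκ n hn).1) hm hm' (hzeroN m) (hzeroN m')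
    · intro m
      rcases h4.head_or_tail hK (hzeroN m) with h | ⟨k, hk, hmk⟩
      · exact h2 _ h (hzeroN m)
      · obtain ⟨n, hn, rfl⟩ := hκsurj k hk
        exact ⟨n, by rw [hUt hn]; exact hmk⟩
  -- The moduli must be preserved for every `N`, whereas a matching is known only for large `N`; the
  -- identity serves wherever none exists.
  have hpex : ∀ N, ∃ p : Equiv.Perm ℕ, (∀ n, ‖lam (p n)‖ = ‖lam n‖) ∧
      ((∃ p' : Equiv.Perm ℕ, (∀ n, lamN N (p' n) ∈ U n) ∧ ∀ n, ‖lam (p' n)‖ = ‖lam n‖) →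
        ∀ n, lamN N (p n) ∈ U n) := by
    intro N
    by_cases h : ∃ p' : Equiv.Perm ℕ, (∀ n, lamN N (p' n) ∈ U n) ∧ ∀ n, ‖lam (p' n)‖ = ‖lam n‖
    · obtain ⟨p', h1, h2⟩ := h
      exact ⟨p', h2, fun _ => h1⟩
    · exact ⟨1, fun n => rfl, fun h' => absurd h' h⟩
  choose p hpn hpU' using hpex
  have hpU : ∀ᶠ N in atTop, ∀ n, lamN N (p N n) ∈ U n := hgood.mono fun N h => hpU' N h
  refine ⟨p, head, κ, R, hR, hpn, fun n hn => ?_, fun n hn => ⟨hRk (hκ n hn).1, (hκ n hn).2⟩,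
    hκinj, hTC, ?_, ?_⟩
  · rw [Metric.tendsto_nhds]
    intro e' he'
    filter_upwards [hpU, huniqU, hnear (min e e') (lt_min he he')] with N h1 h2 h3
    obtain ⟨w, hw, hw0⟩ := h3 n hn
    have hwU : w ∈ U n := by
      rw [hUh hn]
      exact Metric.ball_subset_ball (min_le_left _ _) hw
    rw [h2 n hn _ (h1 n) w hwU ((hdN N).slCharFun_eq_zero (hσN N) _) hw0]
    exact Metric.ball_subset_ball (min_le_right _ _) hw
  · filter_upwards [hpU, hTCN] with N h1 h2
    exact ⟨h2, fun n hn => by have := h1 n; rwa [hUt hn] at this⟩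
  · filter_upwards [hpU, huniqU] with N h1 h2 hreal n hn him
    have h0 := (hdN N).slCharFun_eq_zero (hσN N) (p N n)
    rw [← Complex.conj_eq_iff_im]
    -- The conjugate is another zero in the same ball, whose centre is real; uniqueness makes the
    -- zero real.
    refine h2 n hn _ ?_ _ (h1 n) ?_ h0
    · have h3 := h1 n
      rw [hUh hn, mem_ball_iff_norm] at h3 ⊢
      have e1 : (starRingEnd ℂ) (lamN N (p N n)) - lam n =
          (starRingEnd ℂ) (lamN N (p N n) - lam n) := by
        rw [map_sub, Complex.conj_eq_iff_im.2 him]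
      rw [e1, Complex.norm_conj]
      exact h3
    · rw [slCharFun_conj (hσN N) hreal, h0, map_zero]

end convergence

/-! ### Quantitative stability of the tails of the spectral data -/

/-- Cauchy–Schwarz, read off from the nonnegative integral of the squared deviation of `f` from its
mean. -/
theorem sq_intervalIntegral_le {f : ℝ → ℝ} (hf : ContinuousOn f (Set.Icc 0 Real.pi)) :
    (∫ x in (0 : ℝ)..Real.pi, f x) ^ 2 ≤ Real.pi * ∫ x in (0 : ℝ)..Real.pi, f x ^ 2 := by
  have hpi := Real.pi_pos
  rw [← Set.uIcc_of_le hpi.le] at hf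
  have i1 := hf.intervalIntegrable (μ := volume)
  have i2 : IntervalIntegrable (fun x => f x ^ 2) volume 0 Real.pi :=
    ContinuousOn.intervalIntegrable (hf.pow 2)
  set I := ∫ x in (0 : ℝ)..Real.pi, f x with hI
  have h : 0 ≤ ∫ x in (0 : ℝ)..Real.pi, (f x - I / Real.pi) ^ 2 :=
    intervalIntegral.integral_nonneg hpi.le fun x _ => sq_nonneg _
  have e : ∀ x, (f x - I / Real.pi) ^ 2 =
      f x ^ 2 - 2 * (I / Real.pi) * f x + (I / Real.pi) ^ 2 := fun x => by ring
  simp_rw [e] at h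
  rw [intervalIntegral.integral_add (i2.sub (i1.const_mul _)) intervalIntegrable_const,
    intervalIntegral.integral_sub i2 (i1.const_mul _), intervalIntegral.integral_const_mul,
    intervalIntegral.integral_const, ← hI, smul_eq_mul, sub_zero] at h
  have e2 : Real.pi * (I / Real.pi) = I := by field_simp
  have e3 : Real.pi * ((∫ x in (0 : ℝ)..Real.pi, f x ^ 2) - 2 * (I / Real.pi) * I +
      Real.pi * (I / Real.pi) ^ 2) = Real.pi * (∫ x in (0 : ℝ)..Real.pi, f x ^ 2) - I ^ 2 := by
    linear_combination (-2 * I + Real.pi * (I / Real.pi) + I) * e2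
  have := mul_nonneg hpi.le h
  rw [e3] at this
  linarith

theorem norm_inv_sub_inv_le {I J : ℂ} (hI : 1 / 2 ≤ ‖I‖) (hJ : 1 / 2 ≤ ‖J‖) :
    ‖J⁻¹ - I⁻¹‖ ≤ 4 * ‖J - I‖ := by
  have hI0 : I ≠ 0 := norm_pos_iff.1 (by linarith)
  have hJ0 : J ≠ 0 := norm_pos_iff.1 (by linarith)
  rw [inv_sub_inv hJ0 hI0, norm_div, norm_mul, norm_sub_rev, div_le_iff₀ (by positivity)]
  have h1 : (1 : ℝ) / 2 * (1 / 2) ≤ ‖J‖ * ‖I‖ := mul_le_mul hJ hI (by norm_num) (norm_nonneg _)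
  have h2 := mul_le_mul_of_nonneg_left h1 (norm_nonneg (J - I))
  linarith

set_option maxHeartbeats 800000 in
/-- Stability of one eigenvalue and its weight number near `k²`. -/
theorem spectral_gap_le (S h : ℝ) (hS : 0 ≤ S) (hh : 0 ≤ h) : ∃ C > 0, ∀ σ τ : ℝ → ℂ,
    MemL2 σ → MemL2 τ → l2norm σ ≤ S → l2norm τ ≤ S → ∀ (H H' : ℂ) (R : ℝ), ‖H‖ ≤ h → 1 ≤ R →
    TailControl σ H R → TailControl τ H' R →
    (∀ s : Finset ℕ, ∀ x ∈ Set.Icc 0 Real.pi, ∑ k ∈ s, oscMajorant σ τ k x ^ 2 ≤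
      C * l2norm (fun x => τ x - σ x) ^ 2) ∧
    ∀ (k : ℕ) (ρ ρ' : ℂ), R + 1 ≤ k → ‖ρ - k‖ ≤ 1 / 100 → ‖ρ' - k‖ ≤ 1 / 100 →
      slCharFun σ H (ρ ^ 2) = 0 → slCharFun τ H' (ρ' ^ 2) = 0 →
      ‖ρ' - ρ‖ + ‖(∫ x in (0 : ℝ)..Real.pi, slPhi τ x (ρ' ^ 2) ^ 2)⁻¹ -
        (∫ x in (0 : ℝ)..Real.pi, slPhi σ x (ρ ^ 2) ^ 2)⁻¹‖ ≤
      C * (oscMajorant σ τ k Real.pi + (∫ x in (0 : ℝ)..Real.pi, oscMajorant σ τ k x) +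
        ‖H' - H‖ / k) := by
  obtain ⟨C, hC, hnear⟩ := slPhi_sub_near S hS
  set B := 2 * C * (2 * C + h * C + C) with hB
  have hBpos : 0 < B := by positivity
  set A := B + 8 * C * C * (1 + 4 * B) with hA
  have hApos : 0 < A := by positivity
  refine ⟨C + A, by positivity, fun σ τ hσ hτ hσS hτS H H' R hHh hR hTC hTC' => ?_⟩
  obtain ⟨hsum, hpt⟩ := hnear σ τ hσ hτ hσS hτS
  refine ⟨fun s x hx => (hsum s x hx).trans ?_, fun k ρ ρ' hk hρ hρ' h0 h0' => ?_⟩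
  · gcongr
    linarith
  have hk2 : (2 : ℝ) ≤ k := by linarith
  have hk1 : 1 ≤ k := by exact_mod_cast (by linarith : (1 : ℝ) ≤ k)
  have hρ4 : ‖ρ - k‖ ≤ 1 / 4 := by linarith
  have hρ4' : ‖ρ' - k‖ ≤ 1 / 4 := by linarith
  set T := oscMajorant σ τ k with hT
  have hT0 : ∀ x, 0 ≤ T x := oscMajorant_nonneg k
  set δ := ‖H' - H‖ with hδ
  have hδ0 : 0 ≤ δ := norm_nonneg _
  have hnρ' : ‖ρ'‖ ≤ 2 * k := by
    have := norm_sub_norm_le ρ' (k : ℂ)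
    rw [Complex.norm_natCast] at this
    linarith
  have hρ'0 : ρ' ≠ 0 := by
    rintro rfl
    rw [zero_sub, norm_neg, Complex.norm_natCast] at hρ'
    linarith
  obtain ⟨a1, a2, -⟩ := hpt k hk1 ρ' ρ' hρ4' hρ4' Real.pi mem_Icc_pi
  rw [sub_self, norm_zero, add_zero] at a1 a2
  have a3 : ‖slPhi τ Real.pi (ρ' ^ 2)‖ ≤ C :=
    ((hnear τ τ hτ hτ hτS hτS).2 k hk1 ρ' ρ' hρ4' hρ4' Real.pi mem_Icc_pi).2.2
  have a4 : ‖slPhi σ Real.pi (ρ ^ 2)‖ ≤ C := (hpt k hk1 ρ ρ' hρ4 hρ4' Real.pi mem_Icc_pi).2.2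
  -- At an eigenvalue of the second problem, `Δ` of the first is a difference of characteristic
  -- functions; only the quasi-derivative brings a factor `k`.
  have hchar : ‖slCharFun σ H (ρ' ^ 2)‖ ≤ 2 * k * (C * T Real.pi) + h * (C * T Real.pi) + δ * C := by
    have e : slCharFun σ H (ρ' ^ 2) =
        -(ρ' * (slPhiQuasi τ Real.pi (ρ' ^ 2) / ρ' - slPhiQuasi σ Real.pi (ρ' ^ 2) / ρ')) -
        H * (slPhi τ Real.pi (ρ' ^ 2) - slPhi σ Real.pi (ρ' ^ 2)) -
        (H' - H) * slPhi τ Real.pi (ρ' ^ 2) := by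
      have e1 : ρ' * (slPhiQuasi τ Real.pi (ρ' ^ 2) / ρ' - slPhiQuasi σ Real.pi (ρ' ^ 2) / ρ') =
          slPhiQuasi τ Real.pi (ρ' ^ 2) - slPhiQuasi σ Real.pi (ρ' ^ 2) := by field_simp
      rw [e1]
      unfold slCharFun at *
      linear_combination h0'
    rw [e]
    refine (norm_sub_le _ _).trans (add_le_add ((norm_sub_le _ _).trans (add_le_add ?_ ?_)) ?_)
    · rw [norm_neg, norm_mul]
      exact mul_le_mul hnρ' a2 (norm_nonneg _) (by positivity)
    · rw [norm_mul]
      exact mul_le_mul hHh a1 (norm_nonneg _) hh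
    · rw [norm_mul]
      exact mul_le_mul_of_nonneg_left a3 hδ0
  -- In `integral_phi_mul_phi` the left side is at least `|ρ' - ρ| k / 2`, because `|ρ' + ρ| ≥ k`.
  -- The right side is of order `k T(π) + δ`, so dividing by `k` leaves a square summable bound.
  have hgap : ‖ρ' - ρ‖ ≤ B * (T Real.pi + δ / k) := by
    have h1 := integral_phi_mul_phi hσ h0 (ρ' ^ 2)
    have h2 := hTC.integral k hk ρ' ρ hρ' hρ
    have h3 := congrArg norm h1
    rw [norm_mul, norm_mul, norm_neg] at h3
    have h4 : ‖ρ' ^ 2 - ρ ^ 2‖ * (1 / 2) ≤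
        C * (2 * k * (C * T Real.pi) + h * (C * T Real.pi) + δ * C) :=
      (mul_le_mul_of_nonneg_left h2 (norm_nonneg _)).trans
        (h3.le.trans (mul_le_mul a4 hchar (norm_nonneg _) hC.le))
    have h5 : (k : ℝ) ≤ ‖ρ' + ρ‖ := by
      have := norm_sub_norm_le (2 * k : ℂ) (2 * k - (ρ' + ρ))
      have e1 : (2 * k : ℂ) - (2 * k - (ρ' + ρ)) = ρ' + ρ := by ring
      have e2 : (2 * k : ℂ) - (ρ' + ρ) = -((ρ' - k) + (ρ - k)) := by ring
      have e3 : ‖(2 * k : ℂ)‖ = 2 * k := by rw [norm_mul, Complex.norm_natCast]; norm_num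
      rw [e1, e2, e3, norm_neg] at this
      have := norm_add_le (ρ' - k) (ρ - k)
      linarith
    have e4 : ρ' ^ 2 - ρ ^ 2 = (ρ' - ρ) * (ρ' + ρ) := by ring
    rw [e4, norm_mul] at h4
    have h6 : ‖ρ' - ρ‖ * k ≤ ‖ρ' - ρ‖ * ‖ρ' + ρ‖ := mul_le_mul_of_nonneg_left h5 (norm_nonneg _)
    have hkpos : (0 : ℝ) < k := by linarith
    have h7 : ‖ρ' - ρ‖ * k ≤ B * (T Real.pi + δ / k) * k := by
      have e5 : B * (T Real.pi + δ / k) * k = B * (T Real.pi * k + δ) := by field_simp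
      rw [e5, hB]
      have p1 : T Real.pi * h ≤ T Real.pi * h * k := by
        have := mul_nonneg (hT0 Real.pi) hh
        nlinarith
      have p2 : 0 ≤ C * C * (T Real.pi * k) := by have := hT0 Real.pi; positivity
      have p3 : 0 ≤ C * C * δ := by positivity
      have p4 : 0 ≤ C * C * (h * δ) := by positivity
      have p5 := mul_le_mul_of_nonneg_left p1 (by positivity : 0 ≤ C * C)
      nlinarith
    exact le_of_mul_le_mul_right h7 hkpos
  set D := B * (T Real.pi + δ / k) with hD
  have hD0 : 0 ≤ D := by have := hT0 Real.pi; positivity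
  have hTc : ContinuousOn T (Set.Icc 0 Real.pi) := oscMajorant_continuousOn hσ hτ k
  have hTi : IntervalIntegrable T volume 0 Real.pi := by
    rw [← Set.uIcc_of_le Real.pi_pos.le] at hTc
    exact hTc.intervalIntegrable
  have hint : ‖(∫ x in (0 : ℝ)..Real.pi, slPhi τ x (ρ' ^ 2) ^ 2) -
      ∫ x in (0 : ℝ)..Real.pi, slPhi σ x (ρ ^ 2) ^ 2‖ ≤
      2 * C * C * ((∫ x in (0 : ℝ)..Real.pi, T x) + 4 * D) := by
    have hi : ∀ {υ : ℝ → ℂ} (μ : ℂ), MemL2 υ →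
        IntervalIntegrable (fun x => slPhi υ x μ ^ 2) volume 0 Real.pi := fun μ hυ =>
      intervalIntegrable_of_continuousOn ((slPhi_continuousOn hυ μ).pow 2)
    rw [← intervalIntegral.integral_sub (hi _ hτ) (hi _ hσ)]
    refine (intervalIntegral.norm_integral_le_of_norm_le (g := fun x => 2 * C * C * (T x + D))
      Real.pi_pos.le ?_ ((hTi.add intervalIntegrable_const).const_mul _)).trans ?_
    · refine Eventually.of_forall fun x hx => ?_
      have hx' : x ∈ Set.Icc 0 Real.pi := ⟨hx.1.le, hx.2⟩
      obtain ⟨b1, -, b2⟩ := hpt k hk1 ρ ρ' hρ4 hρ4' x hx'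
      have b3 : ‖slPhi τ x (ρ' ^ 2)‖ ≤ C :=
        ((hnear τ τ hτ hτ hτS hτS).2 k hk1 ρ' ρ' hρ4' hρ4' x hx').2.2
      have e : slPhi τ x (ρ' ^ 2) ^ 2 - slPhi σ x (ρ ^ 2) ^ 2 =
          (slPhi τ x (ρ' ^ 2) - slPhi σ x (ρ ^ 2)) *
          (slPhi τ x (ρ' ^ 2) + slPhi σ x (ρ ^ 2)) := by ring
      have b4 : ‖slPhi τ x (ρ' ^ 2) + slPhi σ x (ρ ^ 2)‖ ≤ 2 * C :=
        (norm_add_le _ _).trans (by linarith)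
      have b5 : ‖slPhi τ x (ρ' ^ 2) - slPhi σ x (ρ ^ 2)‖ ≤ C * (T x + D) :=
        b1.trans (mul_le_mul_of_nonneg_left (by linarith) hC.le)
      rw [e, norm_mul]
      refine (mul_le_mul b5 b4 (norm_nonneg _) ((norm_nonneg _).trans b5)).trans (le_of_eq ?_)
      ring
    · rw [intervalIntegral.integral_const_mul, intervalIntegral.integral_add hTi
        intervalIntegrable_const, intervalIntegral.integral_const, smul_eq_mul, sub_zero]
      have := Real.pi_lt_four
      gcongr
  have hlow : ∀ {υ : ℝ → ℂ} {G r : ℂ}, TailControl υ G R → ‖r - k‖ ≤ 1 / 100 →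
      1 / 2 ≤ ‖∫ x in (0 : ℝ)..Real.pi, slPhi υ x (r ^ 2) ^ 2‖ := by
    intro υ G r hT hr
    have := hT.integral k hk r r hr hr
    simpa only [← pow_two] using this
  have l1 := hlow hTC hρ
  have l2 := hlow hTC' hρ'
  set I := ∫ x in (0 : ℝ)..Real.pi, slPhi σ x (ρ ^ 2) ^ 2
  set J := ∫ x in (0 : ℝ)..Real.pi, slPhi τ x (ρ' ^ 2) ^ 2
  have hinv : ‖J⁻¹ - I⁻¹‖ ≤ 4 * ‖J - I‖ := norm_inv_sub_inv_le l1 l2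
  set Q := ∫ x in (0 : ℝ)..Real.pi, T x
  have hQ : 0 ≤ Q := intervalIntegral.integral_nonneg Real.pi_pos.le fun x _ => hT0 x
  have hDA : ‖ρ' - ρ‖ + ‖J⁻¹ - I⁻¹‖ ≤ A * (T Real.pi + Q + δ / k) := by
    have h1 : 0 ≤ C * C * B * Q := by positivity
    have h2 : 0 ≤ B * Q := by positivity
    have h3 : 0 ≤ C * C * (T Real.pi + δ / k) := by have := hT0 Real.pi; positivity
    have e : A * (T Real.pi + Q + δ / k) = D + 8 * C * C * (Q + 4 * D) + B * Q +
        32 * (C * C * B * Q) + 8 * (C * C * (T Real.pi + δ / k)) := by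
      rw [hA, hD]; ring
    rw [e]
    have h4 := mul_le_mul_of_nonneg_left hint (by norm_num : (0 : ℝ) ≤ 4)
    linarith
  refine hDA.trans (mul_le_mul_of_nonneg_right (by linarith) ?_)
  have := hT0 Real.pi
  positivity

/-- Stability of the tails of the spectral data. -/
theorem sum_spectral_gap_le (S h : ℝ) (hS : 0 ≤ S) (hh : 0 ≤ h) : ∃ C > 0, ∀ σ τ : ℝ → ℂ,
    MemL2 σ → MemL2 τ → l2norm σ ≤ S → l2norm τ ≤ S → ∀ (H H' : ℂ) (R : ℝ), ‖H‖ ≤ h → 1 ≤ R →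
    TailControl σ H R → TailControl τ H' R → ∀ (s : Finset ℕ) (κ : ℕ → ℕ) (r r' : ℕ → ℂ),
    Set.InjOn κ s → (∀ n ∈ s, R + 1 ≤ κ n ∧ ‖r n - κ n‖ ≤ 1 / 100 ∧ ‖r' n - κ n‖ ≤ 1 / 100 ∧
      slCharFun σ H (r n ^ 2) = 0 ∧ slCharFun τ H' (r' n ^ 2) = 0) →
    ∑ n ∈ s, (‖r' n - r n‖ + ‖(∫ x in (0 : ℝ)..Real.pi, slPhi τ x (r' n ^ 2) ^ 2)⁻¹ -
        (∫ x in (0 : ℝ)..Real.pi, slPhi σ x (r n ^ 2) ^ 2)⁻¹‖) ^ 2 ≤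
      C * (l2norm (fun x => τ x - σ x) ^ 2 + ‖H' - H‖ ^ 2) := by
  obtain ⟨C, hC, hgap⟩ := spectral_gap_le S h hS hh
  set Z := ∑' k : ℕ, 1 / (k : ℝ) ^ 2 with hZ
  have hZs : Summable fun k : ℕ => 1 / (k : ℝ) ^ 2 := Real.summable_one_div_nat_pow.2 one_lt_two
  have hZ0 : 0 ≤ Z := tsum_nonneg fun k => by positivity
  -- `17 = 1 + 16`: the values at `π` count once, and the integrals over `(0, π)` lose `π² ≤ 16`.
  -- `Z` sums the terms `|H' - H|² / k²`, and 3 comes from squaring a sum of three terms.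
  refine ⟨3 * C ^ 2 * (17 * C + Z), by positivity,
    fun σ τ hσ hτ hσS hτS H H' R hHh hR hTC hTC' s κ r r' hκ hs => ?_⟩
  obtain ⟨hsum, hpt⟩ := hgap σ τ hσ hτ hσS hτS H H' R hHh hR hTC hTC'
  set T := oscMajorant σ τ with hT
  set L := l2norm (fun x => τ x - σ x) with hL
  set δ := ‖H' - H‖ with hδ
  set Q : ℕ → ℝ := fun k => ∫ x in (0 : ℝ)..Real.pi, T k x with hQ
  have h1 : ∀ n ∈ s, (‖r' n - r n‖ + ‖(∫ x in (0 : ℝ)..Real.pi, slPhi τ x (r' n ^ 2) ^ 2)⁻¹ -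
      (∫ x in (0 : ℝ)..Real.pi, slPhi σ x (r n ^ 2) ^ 2)⁻¹‖) ^ 2 ≤
      3 * C ^ 2 * (T (κ n) Real.pi ^ 2 + Q (κ n) ^ 2 + δ ^ 2 * (1 / (κ n : ℝ) ^ 2)) := by
    intro n hn
    obtain ⟨g1, g2, g3, g4, g5⟩ := hs n hn
    have g6 := hpt (κ n) (r n) (r' n) g1 g2 g3 g4 g5
    refine (pow_le_pow_left₀ (by positivity) g6 2).trans ?_
    rw [mul_pow, mul_comm (3 : ℝ), mul_assoc]
    refine mul_le_mul_of_nonneg_left ?_ (by positivity)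
    have e : δ ^ 2 * (1 / (κ n : ℝ) ^ 2) = (δ / κ n) ^ 2 := by
      rw [div_pow, mul_one_div]
    rw [e]
    change (T (κ n) Real.pi + Q (κ n) + δ / κ n) ^ 2 ≤ _
    nlinarith [sq_nonneg (T (κ n) Real.pi - Q (κ n)), sq_nonneg (T (κ n) Real.pi - δ / κ n),
      sq_nonneg (Q (κ n) - δ / κ n)]
  refine (Finset.sum_le_sum h1).trans ?_
  have e1 : ∑ n ∈ s, 3 * C ^ 2 * (T (κ n) Real.pi ^ 2 + Q (κ n) ^ 2 +
      δ ^ 2 * (1 / (κ n : ℝ) ^ 2)) = 3 * C ^ 2 * (∑ k ∈ s.image κ, T k Real.pi ^ 2 +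
      ∑ k ∈ s.image κ, Q k ^ 2 + δ ^ 2 * ∑ k ∈ s.image κ, 1 / (k : ℝ) ^ 2) := by
    rw [Finset.sum_image hκ, Finset.sum_image hκ, Finset.sum_image hκ, Finset.mul_sum s _ (δ ^ 2),
      ← Finset.sum_add_distrib, ← Finset.sum_add_distrib, ← Finset.mul_sum]
  rw [e1, mul_assoc (3 * C ^ 2)]
  refine mul_le_mul_of_nonneg_left ?_ (by positivity)
  have b1 := hsum (s.image κ) Real.pi mem_Icc_pi
  have b2 : ∑ k ∈ s.image κ, Q k ^ 2 ≤ 16 * (C * L ^ 2) := by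
    have hTc : ∀ k, ContinuousOn (T k) (Set.Icc 0 Real.pi) := oscMajorant_continuousOn hσ hτ
    have hTi : ∀ k ∈ s.image κ, IntervalIntegrable (fun x => T k x ^ 2) volume 0 Real.pi := by
      intro k _
      have := (hTc k).pow 2
      rw [← Set.uIcc_of_le Real.pi_pos.le] at this
      exact this.intervalIntegrable
    refine (Finset.sum_le_sum fun k _ => sq_intervalIntegral_le (hTc k)).trans ?_
    rw [← Finset.mul_sum, ← intervalIntegral.integral_finsetSum hTi]
    have h2 : ∫ x in (0 : ℝ)..Real.pi, ∑ k ∈ s.image κ, T k x ^ 2 ≤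
        ∫ _ in (0 : ℝ)..Real.pi, C * L ^ 2 := by
      refine intervalIntegral.integral_mono_on Real.pi_pos.le ?_ intervalIntegrable_const
        fun x hx => hsum _ x hx
      have := IntervalIntegrable.sum (s.image κ) hTi
      simpa only [Finset.sum_fn] using this
    rw [intervalIntegral.integral_const, smul_eq_mul, sub_zero] at h2
    refine (mul_le_mul_of_nonneg_left h2 Real.pi_pos.le).trans ?_
    rw [← mul_assoc]
    have := Real.pi_lt_four
    have := Real.pi_pos
    gcongr
    nlinarith
  have b3 : ∑ k ∈ s.image κ, 1 / (k : ℝ) ^ 2 ≤ Z :=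
    hZs.sum_le_tsum _ fun k _ => by positivity
  have b4 := mul_le_mul_of_nonneg_left b3 (sq_nonneg δ)
  have b5 : 0 ≤ C * δ ^ 2 := by positivity
  have b6 : 0 ≤ Z * L ^ 2 := by positivity
  have b7 : 0 ≤ C * L ^ 2 := by positivity
  change ∑ k ∈ s.image κ, T k Real.pi ^ 2 ≤ C * L ^ 2 at b1
  nlinarith

/-! ### Branches of the square root -/

/-- `|r - ρ|² ≤ |r - ρ| |r + ρ| = |r² - ρ²|`; this covers `ρ = 0` too. -/
theorem tendsto_of_sq_tendsto_of_le {r : ℕ → ℂ} {ρ : ℂ}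
    (h : Tendsto (fun N => r N ^ 2) atTop (𝓝 (ρ ^ 2)))
    (hle : ∀ᶠ N in atTop, ‖r N - ρ‖ ≤ ‖r N + ρ‖) : Tendsto r atTop (𝓝 ρ) := by
  rw [Metric.tendsto_nhds]
  intro e he
  filter_upwards [hle, (Metric.tendsto_nhds.1 h) (e ^ 2) (by positivity)] with N h1 h2
  rw [dist_eq_norm] at *
  have e1 : r N ^ 2 - ρ ^ 2 = (r N - ρ) * (r N + ρ) := by ring
  rw [e1, norm_mul] at h2
  refine lt_of_pow_lt_pow_left₀ 2 he.le (lt_of_le_of_lt ?_ h2)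
  rw [pow_two]
  exact mul_le_mul_of_nonneg_left h1 (norm_nonneg _)

/-- The bound `|r + ρ| ≥ Re ρ > 0` keeps `r` away from the wrong root `-ρ`. -/
theorem tendsto_of_sq_tendsto_of_re_pos {r : ℕ → ℂ} {ρ : ℂ}
    (h : Tendsto (fun N => r N ^ 2) atTop (𝓝 (ρ ^ 2))) (hρ : 0 < ρ.re) (hr : ∀ N, 0 ≤ (r N).re) :
    Tendsto r atTop (𝓝 ρ) := by
  rw [Metric.tendsto_nhds]
  intro e he
  filter_upwards [(Metric.tendsto_nhds.1 h) (e * ρ.re) (by positivity)] with N h2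
  rw [dist_eq_norm] at *
  have e1 : r N ^ 2 - ρ ^ 2 = (r N - ρ) * (r N + ρ) := by ring
  rw [e1, norm_mul] at h2
  have h3 : ρ.re ≤ ‖r N + ρ‖ := by
    have := Complex.re_le_norm (r N + ρ)
    rw [Complex.add_re] at this
    linarith [hr N]
  exact lt_of_mul_lt_mul_right
    ((mul_le_mul_of_nonneg_left h3 (norm_nonneg _)).trans_lt h2) hρ.le

theorem norm_sub_le_norm_add_of_inner_nonneg {a b : ℂ} (h : 0 ≤ a.re * b.re + a.im * b.im) :
    ‖a - b‖ ≤ ‖a + b‖ := by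
  refine le_of_sq_le_sq ?_ (norm_nonneg _)
  rw [← Complex.normSq_eq_norm_sq, ← Complex.normSq_eq_norm_sq, Complex.normSq_apply,
    Complex.normSq_apply]
  simp only [Complex.sub_re, Complex.sub_im, Complex.add_re, Complex.add_im]
  linarith

theorem re_nonneg_of_arg {z : ℂ} (h : z.arg ∈ Set.Ico (-(Real.pi / 2)) (Real.pi / 2)) :
    0 ≤ z.re :=
  Complex.abs_arg_le_pi_div_two_iff.1 (abs_le.2 ⟨h.1, h.2.le⟩)

theorem im_nonpos_of_arg {z : ℂ} (h : z.arg ∈ Set.Ico (-(Real.pi / 2)) (Real.pi / 2))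
    (h0 : z.re = 0) : z.im ≤ 0 := by
  by_contra hcon
  exact h.2.ne (Complex.arg_eq_pi_div_two_iff.2 ⟨h0, not_le.1 hcon⟩)

/-- The square root of a real number lies on one of two half-axes at a right angle. -/
theorem inner_nonneg_of_sq_im {a b : ℂ}
    (ha : a.arg ∈ Set.Ico (-(Real.pi / 2)) (Real.pi / 2))
    (hb : b.arg ∈ Set.Ico (-(Real.pi / 2)) (Real.pi / 2)) (ha2 : (a ^ 2).im = 0)
    (hb2 : (b ^ 2).im = 0) : 0 ≤ a.re * b.re + a.im * b.im := by
  have key : ∀ {z : ℂ}, (z ^ 2).im = 0 → z.re = 0 ∨ z.im = 0 := by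
    intro z hz
    rw [pow_two, Complex.mul_im] at hz
    exact mul_eq_zero.1 (by linarith)
  have ha0 := re_nonneg_of_arg ha
  have hb0 := re_nonneg_of_arg hb
  rcases key ha2 with h1 | h1 <;> rcases key hb2 with h2 | h2
  · have := mul_nonneg_of_nonpos_of_nonpos (im_nonpos_of_arg ha h1) (im_nonpos_of_arg hb h2)
    rw [h1, h2]; simpa using this
  · rw [h1, h2]; simp
  · rw [h1, h2]; simp
  · rw [h1, h2]; simpa using mul_nonneg ha0 hb0

/-- A nonzero purely imaginary number has a negative square, which `hz` excludes. -/
theorem re_pos_of_sq_not_neg {z : ℂ} (h : z.arg ∈ Set.Ico (-(Real.pi / 2)) (Real.pi / 2))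
    (hz : ¬((z ^ 2).im = 0 ∧ (z ^ 2).re < 0)) (h0 : z ≠ 0) : 0 < z.re := by
  refine lt_of_le_of_ne (re_nonneg_of_arg h) fun hre => hz ?_
  have him : z.im ≠ 0 := fun him => h0 (Complex.ext hre.symm him)
  rw [pow_two, Complex.mul_im, Complex.mul_re, ← hre]
  have := mul_self_pos.2 him
  constructor <;> [ring; linarith]

theorem norm_sub_lt_of_sq_mem_sqDisc {k : ℕ} (hk : 1 ≤ k) {z : ℂ} (hre : 0 ≤ z.re)
    (hz : z ^ 2 ∈ sqDisc k) : ‖z - k‖ < 1 / 100 := by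
  obtain ⟨ρ, hρ, h⟩ := hz
  rcases sq_eq_sq_iff_eq_or_eq_neg.1 h with rfl | rfl
  · exact hρ
  · have h1 := (Complex.abs_re_le_norm (ρ - k)).trans_lt hρ
    rw [Complex.sub_re, Complex.natCast_re, abs_lt] at h1
    rw [Complex.neg_re] at hre
    have hk' : (1 : ℝ) ≤ k := by exact_mod_cast hk
    linarith

/-- Ensures that no sign is changed in the tail: a disc around `k ≥ 1` contains no purely imaginary
number. -/
theorem not_neg_of_mem_sqDisc {k : ℕ} (hk : 1 ≤ k) {z : ℂ} (hz : z ∈ sqDisc k) :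
    ¬(z.im = 0 ∧ z.re < 0) := by
  obtain ⟨ρ, hρ, rfl⟩ := hz
  rintro ⟨h1, h2⟩
  have h3 := (Complex.abs_re_le_norm (ρ - k)).trans_lt hρ
  rw [Complex.sub_re, Complex.natCast_re, abs_lt] at h3
  have hk' : (1 : ℝ) ≤ k := by exact_mod_cast hk
  rw [pow_two, Complex.mul_im] at h1
  rw [pow_two, Complex.mul_re] at h2
  have h4 : ρ.re * ρ.im = 0 := by linarith
  rcases mul_eq_zero.1 h4 with h5 | h5
  · linarith
  · rw [h5] at h2
    nlinarith

theorem tendsto_l2norm_of_eLpNorm {f : ℕ → ℝ → ℂ}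
    (h : Tendsto (fun N => eLpNorm (f N) 2 (volume.restrict (Set.Ioo 0 Real.pi))) atTop (𝓝 0)) :
    Tendsto (fun N => l2norm (f N)) atTop (𝓝 0) := by
  have := (ENNReal.tendsto_toReal ENNReal.zero_ne_top).comp h
  rwa [ENNReal.toReal_zero] at this

/-- A family of series tends to zero if finitely many terms and the remaining sums do. -/
theorem tendsto_tsum_ofReal_zero {b : ℕ → ℕ → ℝ} (hb : ∀ N n, 0 ≤ b N n) {head : Finset ℕ}
    (hhead : ∀ n ∈ head, Tendsto (fun N => b N n) atTop (𝓝 0)) {c : ℕ → ℝ}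
    (hc : Tendsto c atTop (𝓝 0))
    (htail : ∀ᶠ N in atTop, ∀ s : Finset ℕ, (∀ n ∈ s, n ∉ head) → ∑ n ∈ s, b N n ≤ c N) :
    Tendsto (fun N => ∑' n, ENNReal.ofReal (b N n)) atTop (𝓝 0) := by
  have hup : Tendsto (fun N => ENNReal.ofReal (∑ n ∈ head, b N n + c N)) atTop (𝓝 0) := by
    have h1 := (tendsto_finsetSum head hhead).add hc
    rw [Finset.sum_const_zero, add_zero] at h1
    have h2 := (ENNReal.continuous_ofReal.tendsto 0).comp h1
    rwa [ENNReal.ofReal_zero] at h2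
  refine tendsto_of_tendsto_of_tendsto_of_le_of_le' tendsto_const_nhds hup
    (Eventually.of_forall fun _ => zero_le) ?_
  filter_upwards [htail] with N hN
  rw [ENNReal.tsum_eq_iSup_sum]
  refine iSup_le fun s => ?_
  rw [← ENNReal.ofReal_sum_of_nonneg fun n _ => hb N n]
  refine ENNReal.ofReal_le_ofReal ?_
  rw [← Finset.sum_filter_add_sum_filter_not s (· ∈ head)]
  refine add_le_add (Finset.sum_le_sum_of_subset_of_nonneg ?_ fun n _ _ => hb N n)
    (hN _ fun n hn => (Finset.mem_filter.1 hn).2)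
  exact fun n hn => (Finset.mem_filter.1 hn).2

section convergence

variable {σ : ℝ → ℂ} {σN : ℕ → ℝ → ℂ} {H : ℂ} {HN : ℕ → ℂ}

theorem tendsto_integral_phi_sq (hσ : MemL2 σ) (hσN : ∀ N, MemL2 (σN N))
    (hlim : Tendsto (fun N => l2norm fun x => σN N x - σ x) atTop (𝓝 0)) {μN : ℕ → ℂ} {μ : ℂ}
    (hμ : Tendsto μN atTop (𝓝 μ)) :
    Tendsto (fun N => ∫ x in (0 : ℝ)..Real.pi, slPhi (σN N) x (μN N) ^ 2) atTop
      (𝓝 (∫ x in (0 : ℝ)..Real.pi, slPhi σ x μ ^ 2)) := by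
  obtain ⟨C, -, h⟩ := integral_phi_mul_sub_le (l2norm σ + 1) (‖μ‖ + 1)
    (by have := l2norm_nonneg σ; positivity)
  rw [tendsto_iff_norm_sub_tendsto_zero]
  have hμ0 := tendsto_iff_norm_sub_tendsto_zero.1 hμ
  have hup : Tendsto (fun N => C * ((l2norm fun x => σN N x - σ x) + ‖μN N - μ‖ + ‖μN N - μ‖))
      atTop (𝓝 0) := by
    simpa using ((hlim.add hμ0).add hμ0).const_mul C
  refine tendsto_of_tendsto_of_tendsto_of_le_of_le' tendsto_const_nhds hup
    (Eventually.of_forall fun _ => norm_nonneg _) ?_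
  filter_upwards [eventually_l2norm_le hσ hσN hlim, eventually_norm_le hμ] with N h1 h2
  have h3 := h σ (σN N) hσ (hσN N) (by linarith) h1 μ (μN N) μ (μN N) (by linarith) h2
    (by linarith) h2
  simpa only [← pow_two] using h3

end convergence

/-! ### Assembly: choice of signs, convergence of the head, summation of the tail -/

theorem mainTheorem5
    (σ : ℝ → ℂ) (σN : ℕ → ℝ → ℂ) (H : ℂ) (HN : ℕ → ℂ)
    (hσ : MemLp σ 2 (volume.restrict (Set.Ioo 0 Real.pi)))
    (hσN : ∀ N, MemLp (σN N) 2 (volume.restrict (Set.Ioo 0 Real.pi)))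
    (hσlim : Tendsto
      (fun N => eLpNorm (fun x => σN N x - σ x) 2 (volume.restrict (Set.Ioo 0 Real.pi)))
      atTop (𝓝 0))
    (hHlim : Tendsto HN atTop (𝓝 H))
    (lam rho alpha : ℕ → ℂ) (lamN rhoN alphaN : ℕ → ℕ → ℂ)
    (hdata : IsSLSpectralData σ H lam rho alpha)
    (hdataN : ∀ N, IsSLSpectralData (σN N) (HN N) (lamN N) (rhoN N) (alphaN N)) :
    ∃ (p : ℕ → Equiv.Perm ℕ) (s : ℕ → ℕ → ℂ),
      -- the renumbering acts inside the groups of limit eigenvalues of equal modulus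
      (∀ N n, ‖lam (p N n)‖ = ‖lam n‖) ∧
      -- the sign of the root is changed at most where the limit eigenvalue is negative,
      (∀ N n, s N n = 1 ∨ (s N n = -1 ∧ (lam n).im = 0 ∧ (lam n).re < 0)) ∧
      -- and never in the self-adjoint case
      ((IsSLReal σ H ∧ ∀ N, IsSLReal (σN N) (HN N)) → ∀ N n, s N n = 1) ∧
      Tendsto
        (fun N => ∑' n, ENNReal.ofReal
          ((‖s N n * rhoN N (p N n) - rho n‖ + ‖alphaN N (p N n) - alpha n‖) ^ 2))
        atTop (𝓝 0) := by

  classical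
  have hlim := tendsto_l2norm_of_eLpNorm hσlim
  obtain ⟨p, head, κ, R, hR, hp, hhead, hκ, hκinj, hTC, htail, hreal⟩ :=
    exists_matching hσ hσN hlim hHlim hdata hdataN
  set allReal : Prop := IsSLReal σ H ∧ ∀ N, IsSLReal (σN N) (HN N) with hallReal
  set neg : ℕ → Prop := fun n => (lam n).im = 0 ∧ (lam n).re < 0 with hneg
  -- Where a change is allowed, the sign selects the one of the two roots nearer to `rho n`. In the
  -- self-adjoint case it is fixed as 1: for head indices and large `N` both eigenvalues are real,
  -- and `inner_nonneg_of_sq_im` shows that the given root is already no farther than its negative.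
  set s : ℕ → ℕ → ℂ := fun N n => if allReal ∨ ¬neg n then 1 else
    if ‖rhoN N (p N n) - rho n‖ ≤ ‖rhoN N (p N n) + rho n‖ then 1 else -1 with hs
  have hsgn : ∀ N n, s N n = 1 ∨ (s N n = -1 ∧ neg n) := by
    intro N n
    by_cases h : allReal ∨ ¬neg n
    · exact Or.inl (if_pos h)
    · have hn : neg n := by tauto
      simp only [hs, if_neg h]
      split_ifs
      · exact Or.inl rfl
      · exact Or.inr ⟨rfl, hn⟩
  have hsq : ∀ N n, (s N n * rhoN N (p N n)) ^ 2 = lamN N (p N n) := by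
    intro N n
    rcases hsgn N n with h | ⟨h, -⟩ <;> rw [h, ← (hdataN N).rho_sq] <;> ring
  have hheadrho : ∀ n ∈ head, Tendsto (fun N => s N n * rhoN N (p N n)) atTop (𝓝 (rho n)) := by
    intro n hn
    have hsqlim : Tendsto (fun N => (s N n * rhoN N (p N n)) ^ 2) atTop (𝓝 (rho n ^ 2)) := by
      simp_rw [hsq, hdata.rho_sq]
      exact hhead n hn
    by_cases hng : neg n
    · refine tendsto_of_sq_tendsto_of_le hsqlim ?_
      by_cases hall : allReal
      · filter_upwards [hreal] with N hN
        have h1 : s N n = 1 := if_pos (Or.inl hall)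
        rw [h1, one_mul]
        refine norm_sub_le_norm_add_of_inner_nonneg (inner_nonneg_of_sq_im
          ((hdataN N).rho_arg _) (hdata.rho_arg n) ?_ ?_)
        · rw [(hdataN N).rho_sq]
          exact hN (hall.2 N) n hn hng.1
        · rw [hdata.rho_sq]
          exact hng.1
      · refine Eventually.of_forall fun N => ?_
        have h1 : ¬(allReal ∨ ¬neg n) := by tauto
        by_cases h2 : ‖rhoN N (p N n) - rho n‖ ≤ ‖rhoN N (p N n) + rho n‖
        · have h3 : s N n = 1 := by simp only [hs, if_neg h1, if_pos h2]
          rw [h3, one_mul]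
          exact h2
        · have h3 : s N n = -1 := by simp only [hs, if_neg h1, if_neg h2]
          have e1 : -1 * rhoN N (p N n) - rho n = -(rhoN N (p N n) + rho n) := by ring
          have e2 : -1 * rhoN N (p N n) + rho n = -(rhoN N (p N n) - rho n) := by ring
          rw [h3, e1, e2, norm_neg, norm_neg]
          exact (not_le.1 h2).le
    -- At a zero eigenvalue both roots are equally distant from the limit, so no branch has to be
    -- chosen.
    · by_cases h0 : rho n = 0
      · refine tendsto_of_sq_tendsto_of_le hsqlim (Eventually.of_forall fun N => ?_)
        rw [h0, sub_zero, add_zero]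
      · refine tendsto_of_sq_tendsto_of_re_pos hsqlim
          (re_pos_of_sq_not_neg (hdata.rho_arg n) (by rwa [hdata.rho_sq]) h0) fun N => ?_
        have h1 : s N n = 1 := if_pos (Or.inr hng)
        rw [h1, one_mul]
        exact re_nonneg_of_arg ((hdataN N).rho_arg _)
  have hheadalpha : ∀ n ∈ head, Tendsto (fun N => alphaN N (p N n)) atTop (𝓝 (alpha n)) := by
    intro n hn
    simp_rw [fun N => (hdataN N).alpha_eq (p N n), hdata.alpha_eq]
    exact (tendsto_integral_phi_sq hσ hσN hlim (hhead n hn)).inv₀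
      (integral_phi_sq_ne_zero hσ (hdata.slCharFun_eq_zero hσ n) (hdata.simple n))
  obtain ⟨C, -, hC⟩ := sum_spectral_gap_le (l2norm σ + 1) ‖H‖
    (by have := l2norm_nonneg σ; positivity) (norm_nonneg H)
  refine ⟨p, s, hp, hsgn, fun hall N n => if_pos (Or.inl hall), ?_⟩
  refine tendsto_tsum_ofReal_zero (head := head) (fun N n => sq_nonneg _) (fun n hn => ?_)
    (c := fun N => C * ((l2norm fun x => σN N x - σ x) ^ 2 + ‖HN N - H‖ ^ 2)) ?_ ?_
  · have h1 := tendsto_iff_norm_sub_tendsto_zero.1 (hheadrho n hn)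
    have h2 := tendsto_iff_norm_sub_tendsto_zero.1 (hheadalpha n hn)
    simpa using (h1.add h2).pow 2
  · simpa using ((hlim.pow 2).add
      ((tendsto_iff_norm_sub_tendsto_zero.1 hHlim).pow 2)).const_mul C
  · filter_upwards [htail, eventually_l2norm_le hσ hσN hlim] with N hN hS F hF
    have hk1 : ∀ n ∈ F, 1 ≤ κ n := fun n hn => by
      have := (hκ n (hF n hn)).1
      exact_mod_cast (by linarith : (1 : ℝ) ≤ κ n)
    have h1 := hC σ (σN N) hσ (hσN N) (by linarith) hS H (HN N) R le_rfl hR hTC hN.1 F κ rho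
      (fun n => rhoN N (p N n)) (fun n hn m hm h => hκinj n (hF n hn) m (hF m hm) h)
      fun n hn => ⟨(hκ n (hF n hn)).1, ?_, ?_, ?_, ?_⟩
    · refine le_trans (le_of_eq (Finset.sum_congr rfl fun n hn => ?_)) h1
      have h2 : s N n = 1 :=
        if_pos (Or.inr (not_neg_of_mem_sqDisc (hk1 n hn) (hκ n (hF n hn)).2))
      rw [h2, one_mul, (hdataN N).alpha_eq, hdata.alpha_eq, (hdataN N).rho_sq, hdata.rho_sq]
    · refine (norm_sub_lt_of_sq_mem_sqDisc (hk1 n hn) (re_nonneg_of_arg (hdata.rho_arg n)) ?_).le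
      rw [hdata.rho_sq]
      exact (hκ n (hF n hn)).2
    · refine (norm_sub_lt_of_sq_mem_sqDisc (hk1 n hn)
        (re_nonneg_of_arg ((hdataN N).rho_arg _)) ?_).le
      rw [(hdataN N).rho_sq]
      exact hN.2 n (hF n hn)
    · rw [hdata.rho_sq]
      exact hdata.slCharFun_eq_zero hσ n
    · rw [(hdataN N).rho_sq]
      exact (hdataN N).slCharFun_eq_zero (hσN N) _
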